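/- **Setting.** Let $N+1=2^m$. A device has two components with inputs $x'_i,y'_i\in\{0,\dots,N\}$ and outputs $a_i,b_i\in\{0,1\}$ in runs $i=1,\dots,M$; an adversary has an input $z$ and an output $w$; a source emits a bit string $t$ about which the adversary holds classical side information $e$ ($w,z,e$ range over arbitrary finite sets). All this is described by a family of probability distributions $P(a,b,w,t,e\mid x',y',z)$ such that: * (no-signaling) $P(a,b\mid x',y',z)$ does not depend on $z$, $P(a,w\mid x',y',z)$ does not depend on $y'$, and $P(b,w\mid x',y',z)$ does not depend on $x'$; * (time order) for every $k$, $P(a_{\le k},b,w\mid x',y',z)$ does not depend on $x'_i$ with $i>k$, and $P(a,b_{\le k},w\mid x',y',z)$ does not depend on $y'_i$ with $i>k$; * ($\epsilon$-SV source) $\frac12-\epsilon\le \Pr(t_i=0\mid t_{i-1},\dots,t_1,e)\le\frac12+\epsilon$ for all $i$; * the law of $(t,e)$ does not depend on $(x',y',z)$, and $P(a,b,w,t,e\mid x',y',z)=P(a,b,w\mid x',y',z)\,P(t,e)$. **Protocol I.** The first $2mM$ bits of $t$ give the settings $(x_i,y_i)$, $i=1,\dots,M$ ($m$ bits each), which are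 used as inputs $x'=x$, $y'=y$. Let $S_{\rm H}$ be the set of runs with $|x_i-y_i|=1$, $(x_i,y_i)=(0,0)$ or $(x_i,y_i)=(N,N)$, and $S_{\rm nz}$ the set of runs with $(x_i,y_i)=(N,N)$. The protocol accepts (event ACC) if 1. $|S_{\rm H}|\in[\frac{M}{N+1},\frac{3M}{N+1}]$ and $|S_{\rm nz}|\in[\frac{M}{2(N+1)^2},\frac{3M}{2(N+1)^2}]$ (cardinality checks); 2. the fraction of runs $i\in S_{\rm H}$ with $(a_i,b_i\mid x_i,y_i)$ of the form $(0,1\mid k,k-1)$, $(1,0\mid k-1,k)$ with $1\le k\le N$, or $(0,0\mid 0,0)$, is at most $\delta_1$ (first test); 3. the fraction of runs $i\in S_{\rm nz}$ with $(a_i,b_i)=(0,0)$ is at least $\frac12-\delta_2$ (second test); otherwise it aborts. If it accepts, a run $r\in S_{\rm nz}$ is selected with the next $\lfloor\log_2|S_{\rm nz}|\rfloor$ bits of $t$, read as the position of $r$ in the increasing list of $S_{\rm nz}$, and the output is $R_r=0$ if $(a_r,b_r)=(0,0)$ and $R_r=1$ otherwise. **Security.** As the source is public, the quality of $R_r$ is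 measured by $$d_{\rm comp}=\sum_{s\in\{0,1\}}\sum_{x,y,e}\max_z\sum_{w}\sum_{t\mapsto(x,y)}\Big|P(R_r=s,w,t,e\mid z,\mathrm{ACC})-\tfrac12P(w,t,e\mid z,\mathrm{ACC})\Big| ,$$ where $t$ runs over the strings that yield the settings $(x,y)$. (The adversary's input may depend on all settings and on $e$; the selection bits are revealed to the adversary at the end.) The protocol is $\eta$-secure for $P$ if $\Pr(\mathrm{ACC})\le\eta$ or $d_{\rm comp}\le\eta$. **Quantum behavior.** The device behaves as quantum theory predicts if $P(a,b\mid x',y')=\prod_i p(a_i,b_i\mid x'_i,y'_i)$, where $p$ is the behavior obtained from the two-qubit state $\alpha|00\rangle-\beta|11\rangle$, $\alpha/\beta=q\in[0,1]$, $\alpha^2+\beta^2=1$, when both parties measure, for input $k$, in the basis $\cos a_k|0\rangle+\sin a_k|1\rangle$ (outcome $0$), $-\sin a_k|0\rangle+\cos a_k|1\rangle$ (outcome $1$), $\tan a_k=(-1)^kq^{k+1/2}$, and $q$ maximizes $p(0,0\mid N,N)$ over $[0,1]$. **Theorem.** There are an integer $\rho\geq 0$ and thresholds $\delta_1(m),\delta_2(m)>0$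 such that Protocol I with $N+1=2^m$, $M=(N+1)^\rho$, $\delta_1=\delta_1(m)$, $\delta_2=\delta_2(m)$ satisfies the following. 1. For every $0\le\epsilon<0.09$ there is $c>0$ such that, for all large $m$, the protocol is $(N+1)^{-c}$-secure for every $P$ as above. 2. For every $0\le\epsilon<0.5$ there is $c>0$ such that, for all large $m$, the protocol is $(N+1)^{-c}$-secure for every $P$ as above whose device behaves as quantum theory predicts. 3. (Correctness.) For every $0\le\epsilon<0.5$ there is $c>0$ such that, for all large $m$ and every $P$ as in 2, the probability that the cardinality checks are passed but one of the two tests fails is at most $(N+1)^{-c}$. For $\epsilon=0$ there is $c>0$ such that, for all large $m$ and every such $P$, $\Pr(\mathrm{ACC})\ge1-(N+1)^{-c}$. -/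

import Mathlib

open scoped BigOperators

noncomputable section

namespace PublicSV

/-! ### Parameters of the protocol -/

/-- Parameters of the protocol. Each of the two components has `N + 1 = 2 ^ m` measurement settings
`0, …, N` (so that a setting is chosen with `m = log (N + 1)` bits), the device is used in `M` runs,
and `δ₁`, `δ₂` are the thresholds of the two statistical tests. -/
structure Params where
  m : ℕ
  M : ℕ
  δ₁ : ℝ
  δ₂ : ℝ

/-- Bits: outputs of the components, and bits of the source. -/
abbrev Bit := Fin 2

/-- The settings `0, …, N` with `N + 1 = 2 ^ m`. -/
abbrev Setting (p : Params) := Fin (2 ^ p.m)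

/-- The inputs of one component in the `M` runs. -/
abbrev Inputs (p : Params) := Fin p.M → Setting p

/-- The outputs of one component in the `M` runs. -/
abbrev Outputs (p : Params) := Fin p.M → Bit

/-- Number of bits drawn from the source: `2 m` for the settings of each run, and then at most
`⌊log₂ M⌋` for the choice of the final run. -/
def numBits (p : Params) : ℕ := p.M * (2 * p.m) + Nat.log 2 p.M

/-- The bit strings drawn from the source, in the order in which they are drawn. -/
abbrev Str (p : Params) := Fin (numBits p) → Bit

/-! ### Santha–Vazirani sources with classical side information -/

open Classical in
/-- `Q t e` is the joint law of the source string `t` and the side information `e`.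
`prefixProb Q e i t` is the probability that the side information is `e` and that the bits before
position `i` are those of `t`. -/
def prefixProb {T : ℕ} {E : Type} (Q : (Fin T → Bit) → E → ℝ) (e : E) (i : Fin T)
    (t : Fin T → Bit) : ℝ :=
  ∑ t' : Fin T → Bit, if ∀ j, j < i → t' j = t j then Q t' e else 0

open Classical in
/-- As `prefixProb`, and moreover the bit at position `i` is `0`. -/
def prefixZeroProb {T : ℕ} {E : Type} (Q : (Fin T → Bit) → E → ℝ) (e : E) (i : Fin T)
    (t : Fin T → Bit) : ℝ :=
  ∑ t' : Fin T → Bit, if (∀ j, j < i → t' j = t j) ∧ t' i = 0 then Q t' e else 0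

/-- The `ε`-SV condition `1/2 - ε ≤ Pr(bᵢ = 0 | bᵢ₋₁, …, b₁, e) ≤ 1/2 + ε`, multiplied by the
probability of the conditioning event. -/
def IsSV {T : ℕ} {E : Type} (ε : ℝ) (Q : (Fin T → Bit) → E → ℝ) : Prop :=
  ∀ (e : E) (i : Fin T) (t : Fin T → Bit),
    (1 / 2 - ε) * prefixProb Q e i t ≤ prefixZeroProb Q e i t ∧
      prefixZeroProb Q e i t ≤ (1 / 2 + ε) * prefixProb Q e i t

/-! ### The device, the adversary and the source -/

/-- A family `P a b w t e x' y' z`, read as `P(a, b, w, t, e | x', y', z)`: outputs `a`, `b` of the two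
components, output `w` of the adversary, source string `t`, side information `e` about the source,
given the inputs `x'`, `y'` of the components and the input `z` of the adversary. -/
abbrev Box (p : Params) (W Z E : Type) :=
  Outputs p → Outputs p → W → Str p → E → Inputs p → Inputs p → Z → ℝ

section Device

variable {p : Params} {W Z E : Type} [Fintype W] [Fintype E]

/-- The marginal `P(a, b, w | x', y', z)`. -/
def dev (P : Box p W Z E) (a b : Outputs p) (w : W) (x y : Inputs p) (z : Z) : ℝ :=
  ∑ t, ∑ e, P a b w t e x y z

/-- The marginal `P(t, e | x', y', z)`. -/
def src (P : Box p W Z E) (x y : Inputs p) (z : Z) (t : Str p) (e : E) : ℝ :=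
  ∑ a, ∑ b, ∑ w, P a b w t e x y z

open Classical in
/-- All the assumptions on the box: it is a family of probability distributions; there is no
signaling between the two components and the adversary; each component is time-ordered no-signaling,
that is, what happens outside the component and its outputs up to run `k` do not depend on
its inputs after run `k`; the source is `ε`-SV; nothing signals to the source; the
device is independent of the source. -/
structure Admissible (ε : ℝ) (P : Box p W Z E) : Prop where
  nonneg : ∀ a b w t e x y z, 0 ≤ P a b w t e x y z
  sum_one : ∀ x y z, ∑ a, ∑ b, ∑ w, ∑ t, ∑ e, P a b w t e x y z = 1
  ns_AB : ∀ a b x y z z', ∑ w, dev P a b w x y z = ∑ w, dev P a b w x y z'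
  ns_AW : ∀ a w x y y' z, ∑ b, dev P a b w x y z = ∑ b, dev P a b w x y' z
  ns_BW : ∀ b w x x' y z, ∑ a, dev P a b w x y z = ∑ a, dev P a b w x' y z
  tons_A : ∀ (k : Fin p.M) (x x' y : Inputs p) (z : Z), (∀ i, i ≤ k → x i = x' i) →
    ∀ (a b : Outputs p) (w : W),
      (∑ a' : Outputs p, if ∀ i, i ≤ k → a' i = a i then dev P a' b w x y z else 0) =
        ∑ a' : Outputs p, if ∀ i, i ≤ k → a' i = a i then dev P a' b w x' y z else 0
  tons_B : ∀ (k : Fin p.M) (x y y' : Inputs p) (z : Z), (∀ i, i ≤ k → y i = y' i) →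
    ∀ (a b : Outputs p) (w : W),
      (∑ b' : Outputs p, if ∀ i, i ≤ k → b' i = b i then dev P a b' w x y z else 0) =
        ∑ b' : Outputs p, if ∀ i, i ≤ k → b' i = b i then dev P a b' w x y' z else 0
  source_SV : ∀ x y z, IsSV ε (src P x y z)
  no_signal_to_source : ∀ x x' y y' z z', src P x y z = src P x' y' z'
  source_device_indep : ∀ a b w t e x y z,
    P a b w t e x y z = dev P a b w x y z * src P x y z t e

end Device

/-! ### The protocol -/

theorem settingBit_lt (p : Params) (i : Fin p.M) (k : ℕ) (hk : k < 2 * p.m) :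
    (i : ℕ) * (2 * p.m) + k < numBits p := by
  have h : ((i : ℕ) + 1) * (2 * p.m) ≤ p.M * (2 * p.m) := Nat.mul_le_mul_right _ i.isLt
  have h' : ((i : ℕ) + 1) * (2 * p.m) = (i : ℕ) * (2 * p.m) + 2 * p.m := by ring
  unfold numBits
  omega

/-- Settings of the first component: in run `i` the first `m` of the `2 m` bits of that run, read as a
binary number. -/
def settingA (p : Params) (t : Str p) : Inputs p := fun i =>
  finFunctionFinEquiv fun k : Fin p.m =>
    t ⟨(i : ℕ) * (2 * p.m) + k, settingBit_lt p i k (by have := k.isLt; omega)⟩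

/-- Settings of the second component: in run `i` the last `m` of the `2 m` bits of that run. -/
def settingB (p : Params) (t : Str p) : Inputs p := fun i =>
  finFunctionFinEquiv fun k : Fin p.m =>
    t ⟨(i : ℕ) * (2 * p.m) + (p.m + k), settingBit_lt p i (p.m + k) (by have := k.isLt; omega)⟩

/-- The runs in which one of the settings of the ladder Hardy test appears. -/
def SH (p : Params) (x y : Inputs p) : Finset (Fin p.M) :=
  Finset.univ.filter fun i =>
    (x i : ℕ) = (y i : ℕ) + 1 ∨ (y i : ℕ) = (x i : ℕ) + 1 ∨
      ((x i : ℕ) = 0 ∧ (y i : ℕ) = 0) ∨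
      ((x i : ℕ) + 1 = 2 ^ p.m ∧ (y i : ℕ) + 1 = 2 ^ p.m)

/-- The runs in which the setting `(N, N)` appears. -/
def SHnz (p : Params) (x y : Inputs p) : Finset (Fin p.M) :=
  Finset.univ.filter fun i => (x i : ℕ) + 1 = 2 ^ p.m ∧ (y i : ℕ) + 1 = 2 ^ p.m

/-- Indicator of the events to which the Hardy conditions assign probability zero. -/
def BH (p : Params) (a b : Bit) (x y : Setting p) : ℝ :=
  if ((x : ℕ) = (y : ℕ) + 1 ∧ a = 0 ∧ b = 1) ∨ ((y : ℕ) = (x : ℕ) + 1 ∧ a = 1 ∧ b = 0) ∨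
    ((x : ℕ) = 0 ∧ (y : ℕ) = 0 ∧ a = 0 ∧ b = 0) then 1 else 0

/-- Indicator of the Hardy event: outputs `(0, 0)` on the setting `(N, N)`. -/
def BHnz (p : Params) (a b : Bit) (x y : Setting p) : ℝ :=
  if (x : ℕ) + 1 = 2 ^ p.m ∧ (y : ℕ) + 1 = 2 ^ p.m ∧ a = 0 ∧ b = 0 then 1 else 0

def ZH (p : Params) (a b : Outputs p) (x y : Inputs p) : ℝ :=
  (∑ i ∈ SH p x y, BH p (a i) (b i) (x i) (y i)) / ((SH p x y).card : ℝ)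

def ZHnz (p : Params) (a b : Outputs p) (x y : Inputs p) : ℝ :=
  (∑ i ∈ SHnz p x y, BHnz p (a i) (b i) (x i) (y i)) / ((SHnz p x y).card : ℝ)

/-- `|S_H| ∈ [M / (N+1), 3 M / (N+1)]` and `|S_H-nz| ∈ [M / (2 (N+1)²), 3 M / (2 (N+1)²)]`. -/
def SizeCheck (p : Params) (x y : Inputs p) : Prop :=
  ((SH p x y).card : ℝ) ∈ Set.Icc ((p.M : ℝ) / 2 ^ p.m) (3 * (p.M : ℝ) / 2 ^ p.m) ∧
    ((SHnz p x y).card : ℝ) ∈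
      Set.Icc ((p.M : ℝ) / (2 * (2 ^ p.m) ^ 2)) (3 * (p.M : ℝ) / (2 * (2 ^ p.m) ^ 2))

/-- The two statistical tests. -/
def Tests (p : Params) (a b : Outputs p) (x y : Inputs p) : Prop :=
  ZH p a b x y ≤ p.δ₁ ∧ 1 / 2 - p.δ₂ ≤ ZHnz p a b x y

theorem selectionBit_lt (p : Params) (S : Finset (Fin p.M)) (k : Fin (Nat.log 2 S.card)) :
    p.M * (2 * p.m) + (k : ℕ) < numBits p := by
  have h1 : S.card ≤ p.M := by simpa using S.card_le_univ
  have h2 : Nat.log 2 S.card ≤ Nat.log 2 p.M := Nat.log_mono_right h1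
  have h3 := k.isLt
  unfold numBits
  omega

/-- The number, in `{0, …, 2 ^ ⌊log₂ |S|⌋ - 1}`, given by the `⌊log₂ |S|⌋` bits that follow
the bits used for the settings. -/
def selectionIndex (p : Params) (S : Finset (Fin p.M)) (t : Str p) : ℕ :=
  ((finFunctionFinEquiv fun k : Fin (Nat.log 2 S.card) =>
    t ⟨p.M * (2 * p.m) + (k : ℕ), selectionBit_lt p S k⟩ : Fin (2 ^ Nat.log 2 S.card)) : ℕ)

open Classical in
/-- The output of the protocol, `none` standing for abortion. If all checks are
passed, the run `r` is the element of `S_H-nz` (listed in increasing order) whose position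
is the number given by the selection bits, and the output is `0` if
`(a_r, b_r) = (0, 0)` and `1` otherwise. -/
def output (p : Params) (a b : Outputs p) (t : Str p) : Option Bit :=
  if SizeCheck p (settingA p t) (settingB p t) ∧ Tests p a b (settingA p t) (settingB p t) then
    (((SHnz p (settingA p t) (settingB p t)).sort (· ≤ ·))[selectionIndex p
      (SHnz p (settingA p t) (settingB p t)) t]?).map
        fun r => if a r = 0 ∧ b r = 0 then 0 else 1
  else none

/-! ### Security -/

section Security

variable {p : Params} {W Z E : Type} [Fintype W] [Fintype E]

open Classical in
/-- Probability of an event when the source string supplies the inputs of the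
components and the adversary's input is `z`. -/
def eventProb (P : Box p W Z E) (z : Z) (ev : Outputs p → Outputs p → Str p → Prop) : ℝ :=
  ∑ a, ∑ b, ∑ w, ∑ t, ∑ e,
    if ev a b t then P a b w t e (settingA p t) (settingB p t) z else 0

/-- Probability that the protocol does not abort. -/
def accProb (P : Box p W Z E) (z : Z) : ℝ :=
  eventProb P z fun a b t => output p a b t ≠ none

open Classical in
/-- The probability `P(R_r = s, w, t, e | z, ACC)`. -/
def condProb (P : Box p W Z E) (s : Bit) (w : W) (t : Str p) (e : E) (z : Z) : ℝ :=
  (∑ a, ∑ b, if output p a b t = some s then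
    P a b w t e (settingA p t) (settingB p t) z else 0) / accProb P z

open Classical in
/-- The composable distance of the output bit from a uniform bit that is independent of everything the
adversary has. The source being public, the adversary's input `z` may depend on all the
settings `x`, `y` and on the side information `e`; the bits that selected the final
run are handed over as well (they are part of the string `t`), after `z` has been chosen. -/
def dComp (P : Box p W Z E) : ℝ :=
  ∑ s : Bit, ∑ x : Inputs p, ∑ y : Inputs p, ∑ e : E, ⨆ z : Z, ∑ w : W,
    ∑ t ∈ Finset.univ.filter fun t : Str p => settingA p t = x ∧ settingB p t = y,
      |condProb P s w t e z - 1 / 2 * ∑ s' : Bit, condProb P s' w t e z|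

/-- Except with probability at most `η` the protocol aborts, or else, conditioned on
acceptance, the output bit is `η`-close to uniform and private. -/
def Secure (P : Box p W Z E) (η : ℝ) : Prop :=
  (∀ z, accProb P z ≤ η) ∨ dComp P ≤ η

end Security

/-! ### The quantum ladder correlations -/

/-- The two-qubit state `α |00⟩ - β |11⟩` with `α / β = q`, `α² + β² = 1`. -/
def ladderState (q : ℝ) : EuclideanSpace ℂ (Fin 2 × Fin 2) :=
  WithLp.toLp 2 fun u =>
    if u = (0, 0) then ((q / Real.sqrt (1 + q ^ 2) : ℝ) : ℂ)
    else if u = (1, 1) then ((-(1 / Real.sqrt (1 + q ^ 2)) : ℝ) : ℂ)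
    else 0

/-- The angle of the `k`-th measurement (the same for both parties): `tan a_k = (-1)^k q^(k + 1/2)`. -/
def ladderAngle (q : ℝ) (k : ℕ) : ℝ := Real.arctan ((-1) ^ k * q ^ k * Real.sqrt q)

/-- The measurement basis: `cos a_k |0⟩ + sin a_k |1⟩` for the outcome `0` and
`- sin a_k |0⟩ + cos a_k |1⟩` for the outcome `1`. -/
def ladderVec (q : ℝ) (k : ℕ) (j : Bit) : Fin 2 → ℂ :=
  if j = 0 then ![(Real.cos (ladderAngle q k) : ℂ), (Real.sin (ladderAngle q k) : ℂ)]
  else ![(-Real.sin (ladderAngle q k) : ℂ), (Real.cos (ladderAngle q k) : ℂ)]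

/-- Product vectors. -/
def prodVec (u v : Fin 2 → ℂ) : EuclideanSpace ℂ (Fin 2 × Fin 2) :=
  WithLp.toLp 2 fun ij => u ij.1 * v ij.2

/-- Born's rule: probability of the outcomes `(a, b)` for the measurements `(x, y)`. -/
def ladderProb (q : ℝ) (a b : Bit) (x y : ℕ) : ℝ :=
  ‖inner ℂ (prodVec (ladderVec q x a) (ladderVec q y b)) (ladderState q)‖ ^ 2

/-- The state parameter `q ∈ [0, 1]` maximizes the Hardy probability `P(0, 0 | N, N)`,
where `N + 1 = 2 ^ m`. -/
def IsOptimalLadder (m : ℕ) (q : ℝ) : Prop :=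
  q ∈ Set.Icc (0 : ℝ) 1 ∧
    IsMaxOn (fun q' => ladderProb q' 0 0 (2 ^ m - 1) (2 ^ m - 1)) (Set.Icc (0 : ℝ) 1) q

/-- The two components behave as quantum theory predicts: in the `M` runs they
show the statistics of the optimal ladder measurements on `M` copies of the
state. Nothing is assumed about the adversary. -/
def BehavesQuantum {p : Params} {W Z E : Type} [Fintype W] [Fintype E] (P : Box p W Z E) : Prop :=
  ∃ q : ℝ, IsOptimalLadder p.m q ∧ ∀ (a b : Outputs p) (x y : Inputs p) (z : Z),
    ∑ w, dev P a b w x y z = ∏ i, ladderProb q (a i) (b i) (x i) (y i)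

/-- The protocol with `N + 1 = 2 ^ m` settings and `M = (N + 1) ^ ρ` runs. -/
def protocolI (ρ : ℕ) (δ₁ δ₂ : ℕ → ℝ) (m : ℕ) : Params where
  m := m
  M := (2 ^ m) ^ ρ
  δ₁ := δ₁ m
  δ₂ := δ₂ m

end PublicSV

end

/-! Write n = 2^m for the number of settings. Chaining the Hardy conditions along 0, 1, …, N shows
that a no-signaling box gives the outputs (0,0) on (N,N) a weight exceeding half the total by at
most half the weight of forbidden events (`ladder_inequality`). Time ordering extends this to run r
conditioned on the earlier outputs and on the adversary's output w (`ladder_inequality_run`). So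
(0,0) can be predicted with confidence only at the price of likely violations under some settings.

For an arbitrary device this upper bound is combined with the lower bound of the second test. The
deviations of the indicators of (0,0) from their conditional means are martingale increments. Hence
the sum of the biases over the runs of S_nz is bounded by a fluctuation of order √|S_nz|, the slack
δ₂|S_nz| of the test, and the excess of the conditional means over 1/2 (`sum_abs_bias_le`). Summed
over w, the excess is at most a sum of violation weights, which depend neither on z nor on the
inputs from run r onwards (`sum_excess_le`, `violation_congr`).

The source produces each pair of settings with probability at least (1/2-ε)^(2m), whatever came
before. Likely violations therefore tend to be observed. Acceptance allows at most τ of them, and at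
most τ+1 violations are preceded by at most τ others, so the expected excess is at most
(τ+1)/(1/2-ε)^(2m) (`sum_violation_le`). Finally, the source selects a given run with probability at
most (1/2+ε)^⌊log₂|S_nz|⌋. With n^6 runs the total bias has order (m+1)n³ and the selection factor
has order 0.59^(4m); the product decays because 8·0.59⁴ < 0.97.

For the ladder correlations the forbidden events have probability zero, so for every w the weight of
(0,0) is at most half the weight of w. The biases towards (0,0) are then all nonpositive and add up
to 2p-1, where p is the Hardy probability, which is close to 1/2 for the optimal state. Thus any
selected run is nearly unbiased (`sum_abs_bias_quantum_le`). The first test never fails, and the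
second is handled by Chebyshev's inequality (`sum_not_tests_le`). For ε = 0 the settings of
different runs are independent and uniform, and Chebyshev's inequality also controls the cardinality
checks. Conditioning on acceptance divides by Pr(ACC), so bounds of size η² suffice
(`secure_of_dComp_le`). -/

noncomputable section

namespace PublicSV

/-! ### Conditional expectations on finite sets -/

section FiniteConditioning

/-- Functions that are constant on the classes of an equivalence relation. -/
def IsClassFun {Ω : Type*} (R : Setoid Ω) (φ : Ω → ℝ) : Prop := ∀ ω ω', R.r ω ω' → φ ω = φ ω'

theorem IsClassFun.mul {Ω : Type*} {R : Setoid Ω} {φ ψ : Ω → ℝ} (hφ : IsClassFun R φ)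
    (hψ : IsClassFun R ψ) : IsClassFun R fun ω => φ ω * ψ ω :=
  fun ω ω' h => by simp only [hφ _ _ h, hψ _ _ h]

variable {Ω : Type*} [Fintype Ω] (R : Setoid Ω)

open Classical in
/-- The sum of `f` over the class of `ω`. -/
def classSum (f : Ω → ℝ) (ω : Ω) : ℝ := ∑ ω', if R.r ω ω' then f ω' else 0

/-- The expectation of `g`, conditioned on the class of `ω`, for the weight `D`. -/
def condE (D g : Ω → ℝ) (ω : Ω) : ℝ := classSum R (fun ω' => D ω' * g ω') ω / classSum R D ω

variable {R}

theorem classSum_isClassFun (f : Ω → ℝ) : IsClassFun R (classSum R f) := by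
  classical
  intro ω ω' h
  unfold classSum
  refine Finset.sum_congr rfl fun u _ => ?_
  have : R.r ω u ↔ R.r ω' u := ⟨fun k => R.trans (R.symm h) k, fun k => R.trans h k⟩
  simp only [this]

theorem condE_isClassFun (D g : Ω → ℝ) : IsClassFun R (condE R D g) := by
  intro ω ω' h
  unfold condE
  rw [classSum_isClassFun _ _ _ h, classSum_isClassFun D _ _ h]

theorem classSum_nonneg {f : Ω → ℝ} (hf : ∀ ω, 0 ≤ f ω) (ω : Ω) : 0 ≤ classSum R f ω := by
  classical
  exact Finset.sum_nonneg fun u _ => by split_ifs <;> simp [hf]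

theorem classSum_mono {f g : Ω → ℝ} (hfg : ∀ ω, f ω ≤ g ω) (ω : Ω) :
    classSum R f ω ≤ classSum R g ω := by
  classical
  exact Finset.sum_le_sum fun u _ => by split_ifs <;> simp [hfg]

theorem le_classSum {f : Ω → ℝ} (hf : ∀ ω, 0 ≤ f ω) (ω : Ω) : f ω ≤ classSum R f ω := by
  classical
  have h := Finset.single_le_sum (f := fun u => if R.r ω u then f u else 0)
    (fun u _ => by split_ifs <;> simp [hf]) (Finset.mem_univ ω)
  unfold classSum
  simpa [R.refl ω] using h

theorem classSum_mul_classFun {φ : Ω → ℝ} (hφ : IsClassFun R φ) (f : Ω → ℝ) (ω : Ω) :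
    classSum R (fun u => f u * φ u) ω = classSum R f ω * φ ω := by
  classical
  unfold classSum
  rw [Finset.sum_mul]
  refine Finset.sum_congr rfl fun u _ => ?_
  split_ifs with h
  · rw [hφ _ _ h]
  · simp

/-- The operator `classSum R` is self-adjoint, because its kernel, the indicator of `R`, is
symmetric. -/
theorem sum_mul_classSum_comm (f g : Ω → ℝ) :
    ∑ ω, f ω * classSum R g ω = ∑ ω, g ω * classSum R f ω := by
  classical
  unfold classSum
  simp only [Finset.mul_sum]
  rw [Finset.sum_comm]
  refine Finset.sum_congr rfl fun u _ => Finset.sum_congr rfl fun v _ => ?_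
  have : R.r v u ↔ R.r u v := ⟨fun k => R.symm k, fun k => R.symm k⟩
  simp only [this]
  split_ifs <;> ring

theorem classSum_one_pos (ω : Ω) : 0 < classSum R (fun _ => 1) ω :=
  lt_of_lt_of_le one_pos (le_classSum (f := fun _ => (1 : ℝ)) (fun _ => zero_le_one) ω)

/-- Summing class sums with one representative for each class recovers the full sum. -/
theorem sum_div_card_mul_classSum {φ : Ω → ℝ} (hφ : IsClassFun R φ) (f : Ω → ℝ) :
    ∑ ω, φ ω / classSum R (fun _ => 1) ω * classSum R f ω = ∑ ω, f ω * φ ω := by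
  rw [sum_mul_classSum_comm]
  refine Finset.sum_congr rfl fun ω _ => ?_
  have h : IsClassFun R fun u => φ u / classSum R (fun _ => 1) u := fun u v huv => by
    simp only [hφ _ _ huv, classSum_isClassFun _ _ _ huv]
  have h2 := classSum_mul_classFun h (fun _ => 1) ω
  simp only [one_mul] at h2
  rw [h2, mul_div_cancel₀ _ (classSum_one_pos ω).ne']

theorem eq_zero_of_classSum_eq_zero {D : Ω → ℝ} (hD : ∀ ω, 0 ≤ D ω) {ω : Ω}
    (h : classSum R D ω = 0) : D ω = 0 :=
  le_antisymm (h ▸ le_classSum hD ω) (hD ω)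

/-- The defining property of the conditional expectation. -/
theorem sum_mul_condE {D φ : Ω → ℝ} (hD : ∀ ω, 0 ≤ D ω) (hφ : IsClassFun R φ) (g : Ω → ℝ) :
    ∑ ω, D ω * φ ω * condE R D g ω = ∑ ω, D ω * φ ω * g ω := by
  have h : IsClassFun R fun u => φ u / classSum R D u := fun u v huv => by
    simp only [hφ _ _ huv, classSum_isClassFun D _ _ huv]
  calc ∑ ω, D ω * φ ω * condE R D g ω
      = ∑ ω, (D ω * (φ ω / classSum R D ω)) * classSum R (fun u => D u * g u) ω :=
        Finset.sum_congr rfl fun ω _ => by unfold condE; ring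
    _ = ∑ ω, (D ω * g ω) * (classSum R D ω * (φ ω / classSum R D ω)) := by
        rw [sum_mul_classSum_comm]
        exact Finset.sum_congr rfl fun ω _ => by rw [classSum_mul_classFun h]
    _ = ∑ ω, D ω * φ ω * g ω := Finset.sum_congr rfl fun ω _ => by
        -- On a class of weight zero `condE` takes the value 0 by the convention for division; this
        -- is harmless since `D` vanishes there.
        by_cases h0 : classSum R D ω = 0
        · simp [eq_zero_of_classSum_eq_zero hD h0]
        · field_simp

/-- For a nonnegative class function, the average of `φ` divided by the class weight is at most
the sum of `φ` over the classes. -/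
theorem sum_mul_div_classSum_le {D φ : Ω → ℝ} (hφ : IsClassFun R φ)
    (hφ0 : ∀ ω, 0 ≤ φ ω) :
    ∑ ω, D ω * (φ ω / classSum R D ω) ≤ ∑ ω, φ ω / classSum R (fun _ => 1) ω := by
  have h : IsClassFun R fun u => φ u / classSum R D u := fun u v huv => by
    simp only [hφ _ _ huv, classSum_isClassFun D _ _ huv]
  rw [← sum_div_card_mul_classSum h]
  refine Finset.sum_le_sum fun ω _ => ?_
  -- Classes of weight zero contribute nothing on the left but possibly something on the right,
  -- hence only an inequality.
  by_cases h0 : classSum R D ω = 0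
  · simp only [h0, mul_zero]
    exact div_nonneg (hφ0 ω) (classSum_one_pos ω).le
  · apply le_of_eq; field_simp

theorem condE_nonneg {D g : Ω → ℝ} (hD : ∀ ω, 0 ≤ D ω) (hg : ∀ ω, 0 ≤ g ω) (ω : Ω) :
    0 ≤ condE R D g ω :=
  div_nonneg (classSum_nonneg (fun u => mul_nonneg (hD u) (hg u)) ω) (classSum_nonneg hD ω)

theorem condE_le_one {D g : Ω → ℝ} (hD : ∀ ω, 0 ≤ D ω) (hg : ∀ ω, g ω ≤ 1) (ω : Ω) :
    condE R D g ω ≤ 1 :=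
  div_le_one_of_le₀ (classSum_mono (fun u => mul_le_of_le_one_right (hD u) (hg u)) ω)
    (classSum_nonneg hD ω)

end FiniteConditioning

/-! ### Second moments -/

section SecondMoment

variable {Ω ι : Type*} [Fintype Ω]

theorem sum_mul_sq_sum_le {D : Ω → ℝ} (X : ι → Ω → ℝ) (S : Finset ι)
    {v : ℝ} (hX : ∀ i ∈ S, ∑ ω, D ω * X i ω ^ 2 ≤ v)
    (hXX : ∀ i ∈ S, ∀ j ∈ S, i ≠ j → ∑ ω, D ω * (X i ω * X j ω) = 0) :
    ∑ ω, D ω * (∑ i ∈ S, X i ω) ^ 2 ≤ S.card * v := by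
  classical
  have h : ∑ ω, D ω * (∑ i ∈ S, X i ω) ^ 2 = ∑ i ∈ S, ∑ j ∈ S, ∑ ω, D ω * (X i ω * X j ω) := by
    simp_rw [sq, Finset.sum_mul_sum, Finset.mul_sum]
    rw [Finset.sum_comm]
    exact Finset.sum_congr rfl fun i _ => Finset.sum_comm
  rw [h]
  calc ∑ i ∈ S, ∑ j ∈ S, ∑ ω, D ω * (X i ω * X j ω)
      = ∑ i ∈ S, ∑ ω, D ω * X i ω ^ 2 := by
        refine Finset.sum_congr rfl fun i hi => ?_
        rw [Finset.sum_eq_single_of_mem i hi fun j hj hji => hXX i hi j hj hji.symm]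
        simp only [sq]
    _ ≤ ∑ _i ∈ S, v := Finset.sum_le_sum hX
    _ = S.card * v := by simp

/-- The mean absolute value of a sum of orthogonal bounded variables. -/
theorem sum_mul_abs_sum_le {D : Ω → ℝ} (hD : ∀ ω, 0 ≤ D ω) (X : ι → Ω → ℝ) (S : Finset ι)
    (hX : ∀ i ∈ S, ∀ ω, |X i ω| ≤ 1)
    (hXX : ∀ i ∈ S, ∀ j ∈ S, i ≠ j → ∑ ω, D ω * (X i ω * X j ω) = 0) :
    ∑ ω, D ω * |∑ i ∈ S, X i ω| ≤ Real.sqrt S.card * ∑ ω, D ω := by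
  have hT : 0 ≤ ∑ ω, D ω := Finset.sum_nonneg fun ω _ => hD ω
  have h1 : ∑ ω, D ω * (∑ i ∈ S, X i ω) ^ 2 ≤ S.card * ∑ ω, D ω :=
    sum_mul_sq_sum_le X S (fun i hi => Finset.sum_le_sum fun ω _ =>
      mul_le_of_le_one_right (hD ω) ((sq_le_one_iff_abs_le_one _).2 (hX i hi ω))) hXX
  -- Cauchy–Schwarz for the weight `D`, which need not have total mass one: (E|S|)² ≤ E[1]·E[S²].
  have h2 := Finset.sum_mul_sq_le_sq_mul_sq Finset.univ (fun ω => Real.sqrt (D ω))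
    fun ω => Real.sqrt (D ω) * |∑ i ∈ S, X i ω|
  simp only [mul_pow, sq_abs, Real.sq_sqrt (hD _), ← mul_assoc, Real.mul_self_sqrt (hD _)] at h2
  refine le_of_sq_le_sq ?_ (mul_nonneg (Real.sqrt_nonneg _) hT)
  rw [mul_pow, Real.sq_sqrt (Nat.cast_nonneg _)]
  nlinarith

open Classical in
/-- Chebyshev's inequality for pairwise independent indicators with equal means. -/
theorem chebyshev_count {D : Ω → ℝ} (hD : ∀ ω, 0 ≤ D ω) (hD1 : ∑ ω, D ω = 1)
    (X : ι → Ω → ℝ) (S : Finset ι) {q d : ℝ} (hd : 0 < d) (hX2 : ∀ i ∈ S, ∀ ω, X i ω ^ 2 = X i ω)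
    (hX : ∀ i ∈ S, ∑ ω, D ω * X i ω = q)
    (hXX : ∀ i ∈ S, ∀ j ∈ S, i ≠ j → ∑ ω, D ω * (X i ω * X j ω) = q * q)
    (ev : Ω → Prop) (hev : ∀ ω, ev ω → d ≤ |∑ i ∈ S, X i ω - S.card * q|) :
    ∑ ω, (if ev ω then D ω else 0) ≤ S.card * q / d ^ 2 := by
  have h1 : ∑ ω, D ω * (∑ i ∈ S, (X i ω - q)) ^ 2 ≤ S.card * q := by
    refine sum_mul_sq_sum_le (fun i ω => X i ω - q) S (fun i hi => ?_) fun i hi j hj hij => ?_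
    -- The variance of an indicator of mean q is q - q² ≤ q.
    · have : ∀ ω, D ω * (X i ω - q) ^ 2 = (1 - 2 * q) * (D ω * X i ω) + q ^ 2 * D ω := fun ω => by
        linear_combination D ω * hX2 i hi ω
      simp only [this, Finset.sum_add_distrib, ← Finset.mul_sum, hX i hi, hD1]
      nlinarith [sq_nonneg q]
    · have : ∀ ω, D ω * ((X i ω - q) * (X j ω - q)) =
          D ω * (X i ω * X j ω) - q * (D ω * X i ω) - q * (D ω * X j ω) + q * q * D ω :=
        fun ω => by ring
      simp only [this, Finset.sum_add_distrib, Finset.sum_sub_distrib, ← Finset.mul_sum, hX i hi,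
        hX j hj, hXX i hi j hj hij, hD1]
      ring
  rw [le_div_iff₀ (by positivity), Finset.sum_mul]
  refine le_trans (Finset.sum_le_sum fun ω _ => ?_) h1
  have hs : ∑ i ∈ S, (X i ω - q) = ∑ i ∈ S, X i ω - S.card * q := by simp
  rw [hs]
  split_ifs with h
  · refine mul_le_mul_of_nonneg_left ?_ (hD ω)
    rw [← sq_abs (∑ i ∈ S, X i ω - S.card * q)]
    exact pow_le_pow_left₀ hd.le (hev ω h) 2
  · rw [zero_mul]; exact mul_nonneg (hD ω) (sq_nonneg _)

end SecondMoment

/-! ### Prefixes of sequences -/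

/-- Two sequences agree on the positions before `n`. -/
def agree {T : ℕ} (α : Type*) (n : ℕ) : Setoid (Fin T → α) where
  r u v := ∀ j : Fin T, (j : ℕ) < n → u j = v j
  iseqv := ⟨fun _ _ _ => rfl, fun h j hj => (h j hj).symm, fun h k j hj => (h j hj).trans (k j hj)⟩

/-! ### Cylinder probabilities of a Santha–Vazirani source -/

section Source

variable {T : ℕ} {E : Type} {ε : ℝ} {Q : (Fin T → Bit) → E → ℝ}

/-- The SV condition speaks of the bit 0; the bounds for the bit 1 follow by taking complements, as
the interval [1/2-ε, 1/2+ε] is symmetric about 1/2. -/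
theorem classSum_agree_succ_bounds (hSV : IsSV ε Q) (e : E) (i : Fin T)
    (t : Fin T → Bit) :
    (1 / 2 - ε) * classSum (agree Bit i) (fun t => Q t e) t ≤
        classSum (agree Bit (i + 1)) (fun t => Q t e) t ∧
      classSum (agree Bit (i + 1)) (fun t => Q t e) t ≤
        (1 / 2 + ε) * classSum (agree Bit i) (fun t => Q t e) t := by
  classical
  have h := hSV e i t
  have h1 : prefixProb Q e i t = classSum (agree Bit i) (fun t => Q t e) t := by
    unfold prefixProb classSum
    refine Finset.sum_congr rfl fun u _ => ?_
    have : (∀ j, j < i → u j = t j) ↔ (agree Bit (i : ℕ)).r t u :=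
      ⟨fun h j hj => (h j hj).symm, fun h j hj => (h j hj).symm⟩
    simp only [this]
  rw [h1] at h
  have hsucc : ∀ u, (agree Bit ((i : ℕ) + 1)).r t u ↔ (agree Bit (i : ℕ)).r t u ∧ t i = u i := by
    intro u
    constructor
    · exact fun h => ⟨fun j hj => h j (by omega), h i (by omega)⟩
    · rintro ⟨h, hi⟩ j hj
      rcases Nat.lt_succ_iff_lt_or_eq.1 hj with hj | hj
      · exact h j hj
      · rw [Fin.ext hj, hi]
  have h2 : prefixZeroProb Q e i t =
      ∑ u, if (agree Bit (i : ℕ)).r t u ∧ u i = 0 then Q u e else 0 := by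
    unfold prefixZeroProb
    refine Finset.sum_congr rfl fun u _ => ?_
    have : (∀ j, j < i → u j = t j) ↔ (agree Bit (i : ℕ)).r t u :=
      ⟨fun h j hj => (h j hj).symm, fun h j hj => (h j hj).symm⟩
    simp only [this]
  by_cases h0 : t i = 0
  · have : classSum (agree Bit (i + 1)) (fun t => Q t e) t = prefixZeroProb Q e i t := by
      rw [h2]
      unfold classSum
      refine Finset.sum_congr rfl fun u _ => ?_
      simp only [hsucc, h0, eq_comm]
    rw [this]
    exact h
  · have h3 : classSum (agree Bit (i + 1)) (fun t => Q t e) t + prefixZeroProb Q e i t =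
        classSum (agree Bit i) (fun t => Q t e) t := by
      rw [h2]
      unfold classSum
      rw [← Finset.sum_add_distrib]
      refine Finset.sum_congr rfl fun u _ => ?_
      simp only [hsucc]
      have h1 : t i = 1 := Fin.eq_one_of_ne_zero _ h0
      by_cases hr : (agree Bit (i : ℕ)).r t u
      · by_cases hu : u i = 0
        · simp [hr, hu, h0]
        · have hu1 : u i = 1 := Fin.eq_one_of_ne_zero _ hu
          simp [hr, hu1, h1]
      · simp [hr]
    constructor <;> linarith [h.1, h.2]

theorem classSum_agree_add_ge (hSV : IsSV ε Q) (hε : ε ≤ 1 / 2) (e : E)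
    {i n : ℕ} (hn : i + n ≤ T) (t : Fin T → Bit) :
    (1 / 2 - ε) ^ n * classSum (agree Bit i) (fun t => Q t e) t ≤
      classSum (agree Bit (i + n)) (fun t => Q t e) t := by
  induction n with
  | zero => simp
  | succ n ih =>
    refine le_trans ?_ (classSum_agree_succ_bounds hSV e ⟨i + n, by omega⟩ t).1
    rw [pow_succ, mul_comm (_ ^ n), mul_assoc]
    exact mul_le_mul_of_nonneg_left (ih (by omega)) (by linarith)

theorem classSum_agree_add_le (hSV : IsSV ε Q) (hε : 0 ≤ ε) (e : E)
    {i n : ℕ} (hn : i + n ≤ T) (t : Fin T → Bit) :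
    classSum (agree Bit (i + n)) (fun t => Q t e) t ≤
      (1 / 2 + ε) ^ n * classSum (agree Bit i) (fun t => Q t e) t := by
  induction n with
  | zero => simp
  | succ n ih =>
    refine le_trans (classSum_agree_succ_bounds hSV e ⟨i + n, by omega⟩ t).2 ?_
    rw [pow_succ, mul_comm (_ ^ n), mul_assoc]
    exact mul_le_mul_of_nonneg_left (ih (by omega)) (by linarith)

end Source

/-! ### Settings and selected runs as functions of the source string -/

section Settings

variable {p : Params}

/-- Binary expansion is injective, so events about settings are events about blocks of bits. The
strings with prescribed settings in all runs form a cylinder, to which the SV bounds apply. -/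
theorem settings_eq_iff (t t' : Str p) (r : Fin p.M) :
    (settingA p t r = settingA p t' r ∧ settingB p t r = settingB p t' r) ↔
      ∀ j : Fin (numBits p), (r : ℕ) * (2 * p.m) ≤ j → (j : ℕ) < r * (2 * p.m) + 2 * p.m →
        t j = t' j := by
  unfold settingA settingB
  simp only [EmbeddingLike.apply_eq_iff_eq, funext_iff]
  constructor
  · rintro ⟨hA, hB⟩ j h1 h2
    obtain ⟨k, hk⟩ := Nat.exists_eq_add_of_le h1
    by_cases hkm : k < p.m
    · have := hA ⟨k, hkm⟩
      rwa [show (⟨r * (2 * p.m) + k, _⟩ : Fin (numBits p)) = j from Fin.ext hk.symm] at this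
    · have := hB ⟨k - p.m, by omega⟩
      rwa [show (⟨r * (2 * p.m) + (p.m + (k - p.m)), _⟩ : Fin (numBits p)) = j from
        Fin.ext (by simp only; omega)] at this
  · intro h
    refine ⟨fun k => h _ ?_ ?_, fun k => h _ ?_ ?_⟩ <;> simp only <;> omega

theorem settings_eq_of_agree {t t' : Str p} {n : ℕ} (h : (agree Bit (n * (2 * p.m))).r t t')
    (r : Fin p.M) (hr : (r : ℕ) < n) :
    settingA p t r = settingA p t' r ∧ settingB p t r = settingB p t' r := by
  refine (settings_eq_iff t t' r).2 fun j _ h2 => h j ?_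
  have : ((r : ℕ) + 1) * (2 * p.m) ≤ n * (2 * p.m) := Nat.mul_le_mul_right _ hr
  have h' : ((r : ℕ) + 1) * (2 * p.m) = (r : ℕ) * (2 * p.m) + 2 * p.m := by ring
  omega

theorem settings_eq_iff_agree (t t' : Str p) :
    (settingA p t = settingA p t' ∧ settingB p t = settingB p t') ↔
      (agree Bit (p.M * (2 * p.m))).r t t' := by
  constructor
  · rintro ⟨hA, hB⟩ j hj
    have hm : 0 < 2 * p.m := Nat.pos_of_ne_zero fun h => by simp [h] at hj
    have hr : (j : ℕ) / (2 * p.m) < p.M := (Nat.div_lt_iff_lt_mul hm).2 hj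
    refine (settings_eq_iff t t' ⟨_, hr⟩).1 ⟨congrFun hA _, congrFun hB _⟩ j
      (Nat.div_mul_le_self _ _) ?_
    have := Nat.lt_div_mul_add (a := (j : ℕ)) hm
    simpa using this
  · intro h
    exact ⟨funext fun r => (settings_eq_of_agree h r r.isLt).1,
      funext fun r => (settings_eq_of_agree h r r.isLt).2⟩

theorem selectionIndex_eq_iff (S : Finset (Fin p.M)) (t t' : Str p) :
    selectionIndex p S t = selectionIndex p S t' ↔
      ∀ j : Fin (numBits p), p.M * (2 * p.m) ≤ j →
        (j : ℕ) < p.M * (2 * p.m) + Nat.log 2 S.card → t j = t' j := by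
  unfold selectionIndex
  rw [Fin.val_inj]
  simp only [EmbeddingLike.apply_eq_iff_eq, funext_iff]
  constructor
  · intro h j h1 h2
    obtain ⟨k, hk⟩ := Nat.exists_eq_add_of_le h1
    have := h ⟨k, by omega⟩
    rwa [show (⟨p.M * (2 * p.m) + k, _⟩ : Fin (numBits p)) = j from Fin.ext hk.symm] at this
  · intro h k
    refine h _ ?_ ?_ <;> simp only <;> omega

/-- The settings of a given run can be changed without changing the bits before this run. -/
theorem exists_agree_settings (t : Str p) (r : Fin p.M) (ξ υ : Setting p) :
    ∃ t' : Str p, (agree Bit ((r : ℕ) * (2 * p.m))).r t t' ∧ settingA p t' r = ξ ∧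
      settingB p t' r = υ := by
  refine ⟨fun j => if (j : ℕ) < r * (2 * p.m) then t j else
    if h : (j : ℕ) - r * (2 * p.m) < p.m then finFunctionFinEquiv.symm ξ ⟨_, h⟩ else
    if h : (j : ℕ) - r * (2 * p.m) - p.m < p.m then finFunctionFinEquiv.symm υ ⟨_, h⟩ else 0,
    fun j hj => by simp [hj], ?_, ?_⟩
  · unfold settingA
    rw [← Equiv.eq_symm_apply]
    funext k
    simp
  · unfold settingB
    rw [← Equiv.eq_symm_apply]
    funext k
    simp

variable {E : Type} {ε : ℝ} {Q : Str p → E → ℝ}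

open Classical in
/-- Whatever the previous bits, a Santha–Vazirani source yields each pair of settings with a
probability that is not too small. -/
theorem sum_ite_settings_ge (hQ : ∀ t e, 0 ≤ Q t e) (hSV : IsSV ε Q) (hε : ε ≤ 1 / 2) (e : E)
    (r : Fin p.M) {φ : Str p → ℝ} (hφ : IsClassFun (agree Bit ((r : ℕ) * (2 * p.m))) φ)
    (hφ0 : ∀ t, 0 ≤ φ t) (ξ υ : Setting p) :
    (1 / 2 - ε) ^ (2 * p.m) * ∑ t, Q t e * φ t ≤
      ∑ t, if settingA p t r = ξ ∧ settingB p t r = υ then Q t e * φ t else 0 := by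
  have h1 : ∀ t, (if settingA p t r = ξ ∧ settingB p t r = υ then Q t e * φ t else 0) =
      (if settingA p t r = ξ ∧ settingB p t r = υ then Q t e else 0) * φ t := fun t => by
    split_ifs <;> simp
  simp only [h1]
  rw [← sum_div_card_mul_classSum hφ, ← sum_div_card_mul_classSum hφ, Finset.mul_sum]
  refine Finset.sum_le_sum fun t _ => ?_
  rw [mul_left_comm]
  refine mul_le_mul_of_nonneg_left ?_ (div_nonneg (hφ0 t) (classSum_one_pos t).le)
  -- Within each class of strings with a common past, continuing by the 2m bits that encode (ξ, υ)
  -- gives a single subcylinder; its relative weight is at least (1/2-ε)^(2m).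
  obtain ⟨t', ht, hA, hB⟩ := exists_agree_settings t r ξ υ
  have hlen : (r : ℕ) * (2 * p.m) + 2 * p.m ≤ numBits p := by
    have h : ((r : ℕ) + 1) * (2 * p.m) ≤ p.M * (2 * p.m) := Nat.mul_le_mul_right _ r.isLt
    have h' : ((r : ℕ) + 1) * (2 * p.m) = (r : ℕ) * (2 * p.m) + 2 * p.m := by ring
    unfold numBits; omega
  rw [classSum_isClassFun (R := agree Bit ((r : ℕ) * (2 * p.m))) (fun t => Q t e) _ _ ht]
  refine (classSum_agree_add_ge hSV hε e hlen t').trans ?_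
  unfold classSum
  refine Finset.sum_le_sum fun u _ => ?_
  by_cases hu : (agree Bit ((r : ℕ) * (2 * p.m) + 2 * p.m)).r t' u
  · have h2 := (settings_eq_iff t' u r).2 fun j _ hj => hu j hj
    have h3 : (agree Bit ((r : ℕ) * (2 * p.m))).r t u :=
      (agree Bit _).trans ht fun j hj => hu j (by omega)
    simp [hu, h3, ← h2.1, ← h2.2, hA, hB]
  · simp only [hu, if_false]
    split_ifs <;> simp [hQ]

open Classical in
/-- A Santha–Vazirani source selects each run with a probability that is not too large. -/
theorem sum_ite_selection_le (hQ : ∀ t e, 0 ≤ Q t e) (hSV : IsSV ε Q) (hε : 0 ≤ ε) (e : E)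
    (x y : Inputs p) (S : Finset (Fin p.M)) (u : ℕ) :
    (∑ t, if (settingA p t = x ∧ settingB p t = y) ∧ selectionIndex p S t = u then Q t e else 0) ≤
      (1 / 2 + ε) ^ Nat.log 2 S.card *
        ∑ t, if settingA p t = x ∧ settingB p t = y then Q t e else 0 := by
  have hpos : 0 ≤ (1 / 2 + ε) ^ Nat.log 2 S.card *
        ∑ t, if settingA p t = x ∧ settingB p t = y then Q t e else 0 :=
    mul_nonneg (by positivity) (Finset.sum_nonneg fun t _ => by split_ifs <;> simp [hQ])
  -- If the event is possible, it is a cylinder that extends the cylinder of the settings by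
  -- `Nat.log 2 S.card` bits; otherwise it is empty.
  by_cases hex : ∃ t', (settingA p t' = x ∧ settingB p t' = y) ∧ selectionIndex p S t' = u
  · obtain ⟨t', ⟨rfl, rfl⟩, rfl⟩ := hex
    have hlen : p.M * (2 * p.m) + Nat.log 2 S.card ≤ numBits p := by
      have h1 : S.card ≤ p.M := by simpa using S.card_le_univ
      have h2 : Nat.log 2 S.card ≤ Nat.log 2 p.M := Nat.log_mono_right h1
      unfold numBits; omega
    refine le_trans (le_trans (le_of_eq ?_) (classSum_agree_add_le hSV hε e hlen t'))
      (le_of_eq ?_)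
    · unfold classSum
      refine Finset.sum_congr rfl fun t _ => ?_
      have : ((settingA p t = settingA p t' ∧ settingB p t = settingB p t') ∧
          selectionIndex p S t = selectionIndex p S t') ↔
          (agree Bit (p.M * (2 * p.m) + Nat.log 2 S.card)).r t' t := by
        rw [settings_eq_iff_agree, selectionIndex_eq_iff]
        constructor
        · rintro ⟨h, h'⟩ j hj
          rcases lt_or_ge (j : ℕ) (p.M * (2 * p.m)) with h2 | h2
          · exact (h j h2).symm
          · exact (h' j h2 hj).symm
        · exact fun h => ⟨fun j hj => (h j (by omega)).symm, fun j _ hj => (h j hj).symm⟩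
      simp only [this]
    · unfold classSum
      congr 1
      refine Finset.sum_congr rfl fun t _ => ?_
      have : (agree Bit (p.M * (2 * p.m))).r t' t ↔
          settingA p t = settingA p t' ∧ settingB p t = settingB p t' := by
        rw [settings_eq_iff_agree]
        exact ⟨fun h => (agree Bit _).symm h, fun h => (agree Bit _).symm h⟩
      simp only [this]
  · rw [Finset.sum_eq_zero fun t _ => if_neg fun h => hex ⟨t, h⟩]
    exact hpos

end Settings

/-! ### The ladder inequality for no-signaling boxes -/

section Ladder

variable {p : Params}

theorem BH_nonneg (a b : Bit) (x y : Setting p) : 0 ≤ BH p a b x y := by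
  unfold BH; split_ifs <;> simp

theorem BH_le_one (a b : Bit) (x y : Setting p) : BH p a b x y ≤ 1 := by
  unfold BH; split_ifs <;> simp

/-- For a nonnegative no-signaling box of total weight `τ`, the weight of the outputs `(0, 0)` on the
last pair of settings exceeds `τ / 2` at most by half the weight of the events forbidden by the Hardy
conditions. -/
theorem ladder_inequality (E : Bit → Bit → Setting p → Setting p → ℝ)
    (hE : ∀ α β ξ υ, 0 ≤ E α β ξ υ) (A B : Setting p → ℝ) (τ : ℝ)
    (hA : ∀ ξ υ, E 0 0 ξ υ + E 0 1 ξ υ = A ξ) (hB : ∀ ξ υ, E 0 0 ξ υ + E 1 0 ξ υ = B υ)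
    (hτ : ∀ ξ υ, E 0 0 ξ υ + E 0 1 ξ υ + (E 1 0 ξ υ + E 1 1 ξ υ) = τ) (ξ₀ : Setting p) :
    2 * E 0 0 ξ₀ ξ₀ - τ ≤ ∑ ξ, ∑ υ, ∑ α, ∑ β, BH p α β ξ υ * E α β ξ υ := by
  classical
  set v : Setting p × Setting p → ℝ := fun s => ∑ α, ∑ β, BH p α β s.1 s.2 * E α β s.1 s.2 with hv
  have hv0 : ∀ s, 0 ≤ v s := fun s => Finset.sum_nonneg fun α _ => Finset.sum_nonneg fun β _ =>
    mul_nonneg (BH_nonneg _ _ _ _) (hE _ _ _ _)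
  have hle : ∀ (s : Setting p × Setting p) α β, BH p α β s.1 s.2 = 1 → E α β s.1 s.2 ≤ v s := by
    intro s α β h
    have h1 : E α β s.1 s.2 = BH p α β s.1 s.2 * E α β s.1 s.2 := by rw [h, one_mul]
    rw [h1]
    exact (Finset.single_le_sum (f := fun β => BH p α β s.1 s.2 * E α β s.1 s.2)
      (fun β _ => mul_nonneg (BH_nonneg _ _ _ _) (hE _ _ _ _)) (Finset.mem_univ β)).trans
      (Finset.single_le_sum (f := fun α => ∑ β, BH p α β s.1 s.2 * E α β s.1 s.2)
        (fun α _ => Finset.sum_nonneg fun β _ => mul_nonneg (BH_nonneg _ _ _ _) (hE _ _ _ _))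
        (Finset.mem_univ α))
  -- `F k` contains the pairs used up to rung k. The pairs (k+1, k) and (k, k+1) lie outside it, so
  -- no violation is counted twice.
  let F : ℕ → Finset (Setting p × Setting p) := fun k =>
    Finset.univ.filter fun s => (s.1 : ℕ) ≤ k ∧ (s.2 : ℕ) ≤ k
  -- At rung 0, A + B = τ + E(0,0) - E(1,1). Climbing one rung swaps the parties: A at k+1 exceeds B
  -- at k by at most the weight of (0,1) on (k+1, k), and symmetrically for B at k+1.
  have key : ∀ (k : ℕ) (hk : k < 2 ^ p.m), A ⟨k, hk⟩ + B ⟨k, hk⟩ ≤ τ + ∑ s ∈ F k, v s := by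
    intro k
    induction k with
    | zero =>
      intro hk
      have h1 := hA ⟨0, hk⟩ ⟨0, hk⟩
      have h2 := hB ⟨0, hk⟩ ⟨0, hk⟩
      have h3 := hτ ⟨0, hk⟩ ⟨0, hk⟩
      have h4 := hle (⟨0, hk⟩, ⟨0, hk⟩) 0 0 (by simp [BH])
      have h5 : v (⟨0, hk⟩, ⟨0, hk⟩) ≤ ∑ s ∈ F 0, v s :=
        Finset.single_le_sum (fun s _ => hv0 s) (by simp [F])
      have h6 := hE 1 1 ⟨0, hk⟩ ⟨0, hk⟩
      simp only at h4
      linarith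
    | succ k ih =>
      intro hk
      have hk' : k < 2 ^ p.m := by omega
      have ih := ih hk'
      have h1 := hA ⟨k + 1, hk⟩ ⟨k, hk'⟩
      have h2 := hB ⟨k + 1, hk⟩ ⟨k, hk'⟩
      have h3 := hB ⟨k, hk'⟩ ⟨k + 1, hk⟩
      have h4 := hA ⟨k, hk'⟩ ⟨k + 1, hk⟩
      have h5 := hle (⟨k + 1, hk⟩, ⟨k, hk'⟩) 0 1 (by simp [BH])
      have h6 := hle (⟨k, hk'⟩, ⟨k + 1, hk⟩) 1 0 (by simp [BH])
      have h7 := hE 1 0 ⟨k + 1, hk⟩ ⟨k, hk'⟩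
      have h8 := hE 0 1 ⟨k, hk'⟩ ⟨k + 1, hk⟩
      have h9 : ∑ s ∈ F k, v s + (v (⟨k + 1, hk⟩, ⟨k, hk'⟩) + v (⟨k, hk'⟩, ⟨k + 1, hk⟩)) ≤
          ∑ s ∈ F (k + 1), v s := by
        rw [← Finset.sum_pair (show ((⟨k + 1, hk⟩, ⟨k, hk'⟩) : Setting p × Setting p) ≠
          (⟨k, hk'⟩, ⟨k + 1, hk⟩) by simp), ← Finset.sum_union]
        · refine Finset.sum_le_sum_of_subset_of_nonneg ?_ fun s _ _ => hv0 s
          intro s hs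
          simp only [F, Finset.mem_union, Finset.mem_filter, Finset.mem_univ, true_and,
            Finset.mem_insert, Finset.mem_singleton] at hs ⊢
          rcases hs with hs | rfl | rfl
          · omega
          · simp
          · simp
        · rw [Finset.disjoint_left]
          intro s hs hs'
          simp only [F, Finset.mem_filter, Finset.mem_univ, true_and,
            Finset.mem_insert, Finset.mem_singleton] at hs hs'
          rcases hs' with rfl | rfl <;> simp at hs
      simp only at h5 h6
      linarith
  have h1 := key ξ₀ ξ₀.isLt
  have h2 := hA ξ₀ ξ₀
  have h3 := hB ξ₀ ξ₀
  have h4 := hE 0 1 ξ₀ ξ₀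
  have h5 := hE 1 0 ξ₀ ξ₀
  have h6 : ∑ s ∈ F ξ₀, v s ≤ ∑ s, v s :=
    Finset.sum_le_sum_of_subset_of_nonneg (Finset.subset_univ _) fun s _ _ => hv0 s
  rw [Fintype.sum_prod_type] at h6
  simp only [hv] at h1 h6
  simp only [Fin.eta] at h1
  linarith

end Ladder

/-! ### Time-ordered devices -/

/-- The outputs of both components. -/
abbrev Outcomes (p : Params) := Outputs p × Outputs p

/-- Two pairs of output sequences agree on the runs before `n`. -/
def agreeRuns (p : Params) (n : ℕ) : Setoid (Outcomes p) where
  r o o' := (agree Bit n).r o.1 o'.1 ∧ (agree Bit n).r o.2 o'.2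
  iseqv := ⟨fun o => ⟨(agree Bit n).refl o.1, (agree Bit n).refl o.2⟩,
    fun h => ⟨(agree Bit n).symm h.1, (agree Bit n).symm h.2⟩,
    fun h k => ⟨(agree Bit n).trans h.1 k.1, (agree Bit n).trans h.2 k.2⟩⟩

section TimeOrder

variable {p : Params} {W Z E : Type} [Fintype W] [Fintype E] {ε : ℝ} {P : Box p W Z E}

theorem dev_nonneg (hP : Admissible ε P) (a b : Outputs p) (w : W) (x y : Inputs p) (z : Z) :
    0 ≤ dev P a b w x y z :=
  Finset.sum_nonneg fun t _ => Finset.sum_nonneg fun e _ => hP.nonneg a b w t e x y z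

/-- A function of the outputs before n is a combination of indicators of output prefixes, and time
ordering applies to each of them. -/
theorem sum_mul_dev_congr_left (hP : Admissible ε P) {n : ℕ} {x x' : Inputs p}
    (hx : (agree (Setting p) n).r x x') {f : Outputs p → ℝ} (hf : IsClassFun (agree Bit n) f)
    (b : Outputs p) (w : W) (y : Inputs p) (z : Z) :
    ∑ a, dev P a b w x y z * f a = ∑ a, dev P a b w x' y z * f a := by
  classical
  rw [← sum_div_card_mul_classSum hf, ← sum_div_card_mul_classSum hf]
  refine Finset.sum_congr rfl fun a _ => ?_
  congr 1
  unfold classSum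
  -- The time-order condition only concerns nonempty prefixes; for the empty one the claim is
  -- no-signaling. A prefix longer than `M` forces x = x'.
  rcases n with _ | k
  · have : ∀ a', (agree Bit 0).r a a' := fun a' j hj => absurd hj (Nat.not_lt_zero _)
    simp only [this, if_true]
    exact hP.ns_BW b w x x' y z
  · by_cases hk : k < p.M
    · have h := hP.tons_A ⟨k, hk⟩ x x' y z (fun i hi => hx i (Nat.lt_succ_of_le hi)) a b w
      have h2 : ∀ a', (agree Bit (k + 1)).r a a' ↔ ∀ i, i ≤ (⟨k, hk⟩ : Fin p.M) → a' i = a i :=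
        fun a' => ⟨fun h i hi => (h i (Nat.lt_succ_of_le hi)).symm,
          fun h i hi => (h i (Nat.le_of_lt_succ hi)).symm⟩
      simp only [h2]
      exact h
    · have : x = x' := funext fun i => hx i (by omega)
      rw [this]

theorem sum_mul_dev_congr_right (hP : Admissible ε P) {n : ℕ} {y y' : Inputs p}
    (hy : (agree (Setting p) n).r y y') {f : Outputs p → ℝ} (hf : IsClassFun (agree Bit n) f)
    (a : Outputs p) (w : W) (x : Inputs p) (z : Z) :
    ∑ b, dev P a b w x y z * f b = ∑ b, dev P a b w x y' z * f b := by
  classical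
  rw [← sum_div_card_mul_classSum hf, ← sum_div_card_mul_classSum hf]
  refine Finset.sum_congr rfl fun b _ => ?_
  congr 1
  unfold classSum
  rcases n with _ | k
  · have : ∀ b', (agree Bit 0).r b b' := fun b' j hj => absurd hj (Nat.not_lt_zero _)
    simp only [this, if_true]
    exact hP.ns_AW a w x y y' z
  · by_cases hk : k < p.M
    · have h := hP.tons_B ⟨k, hk⟩ x y y' z (fun i hi => hy i (Nat.lt_succ_of_le hi)) a b w
      have h2 : ∀ b', (agree Bit (k + 1)).r b b' ↔ ∀ i, i ≤ (⟨k, hk⟩ : Fin p.M) → b' i = b i :=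
        fun a' => ⟨fun h i hi => (h i (Nat.lt_succ_of_le hi)).symm,
          fun h i hi => (h i (Nat.le_of_lt_succ hi)).symm⟩
      simp only [h2]
      exact h
    · have : y = y' := funext fun i => hy i (by omega)
      rw [this]

/-- The joint law of the outputs before run `n` of the first component, the outputs before run `k` of
the second one, and the output of the adversary depends only on the corresponding inputs. -/
theorem sum_mul_dev_congr (hP : Admissible ε P) {n k : ℕ} {x x' y y' : Inputs p}
    (hx : (agree (Setting p) n).r x x') (hy : (agree (Setting p) k).r y y') {f : Outcomes p → ℝ}
    (hf : ∀ o o' : Outcomes p, (agree Bit n).r o.1 o'.1 → (agree Bit k).r o.2 o'.2 → f o = f o')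
    (w : W) (z : Z) :
    ∑ o : Outcomes p, dev P o.1 o.2 w x y z * f o =
      ∑ o : Outcomes p, dev P o.1 o.2 w x' y' z * f o := by
  calc ∑ o : Outcomes p, dev P o.1 o.2 w x y z * f o
      = ∑ o : Outcomes p, dev P o.1 o.2 w x' y z * f o := by
        simp only [Fintype.sum_prod_type_right]
        exact Finset.sum_congr rfl fun b _ => sum_mul_dev_congr_left hP hx
          (fun a a' h => hf (a, b) (a', b) h ((agree Bit k).refl b)) b w y z
    _ = ∑ o : Outcomes p, dev P o.1 o.2 w x' y' z * f o := by
        simp only [Fintype.sum_prod_type]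
        exact Finset.sum_congr rfl fun a _ => sum_mul_dev_congr_right hP hy
          (fun b b' h => hf (a, b) (a, b') ((agree Bit n).refl a) h) a w x' z

/-- Indicator of the outputs `(0, 0)` in run `r`. -/
def hardyInd (r : Fin p.M) (o : Outcomes p) : ℝ := if o.1 r = 0 ∧ o.2 r = 0 then 1 else 0

theorem agree_update {T : ℕ} {α : Type*} (u : Fin T → α) (r : Fin T) (c d : α) :
    (agree α (r : ℕ)).r (Function.update u r c) (Function.update u r d) := by
  intro j hj
  have : j ≠ r := fun h => by simp [h] at hj
  simp [this]

/-- The ladder inequality for run `r`, conditioned on the previous outputs and on the output of the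
adversary. -/
theorem ladder_inequality_run (hP : Admissible ε P) (w : W) (z : Z) (x y : Inputs p) (r : Fin p.M)
    (hxy : x r = y r) (o : Outcomes p) :
    2 * classSum (agreeRuns p r) (fun o => dev P o.1 o.2 w x y z * hardyInd r o) o -
        classSum (agreeRuns p r) (fun o => dev P o.1 o.2 w x y z) o ≤
      ∑ ξ, ∑ υ, classSum (agreeRuns p r) (fun o =>
        dev P o.1 o.2 w (Function.update x r ξ) (Function.update y r υ) z *
          BH p (o.1 r) (o.2 r) ξ υ) o := by
  classical
  -- Restricting to the past of `o` and reading only run r turns the M-run device into a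
  -- subnormalized one-run box `E` with inputs ξ, υ.
  let I : Bit → Bit → Outcomes p → ℝ := fun α β o' =>
    if (agreeRuns p r).r o o' ∧ o'.1 r = α ∧ o'.2 r = β then 1 else 0
  let E : Bit → Bit → Setting p → Setting p → ℝ := fun α β ξ υ =>
    ∑ o' : Outcomes p, dev P o'.1 o'.2 w (Function.update x r ξ) (Function.update y r υ) z * I α β o'
  have hb : ∀ c : Bit, c = 0 ∨ c = 1 := by decide
  have hI1 : ∀ α o', I α 0 o' + I α 1 o' =
      if (agreeRuns p r).r o o' ∧ o'.1 r = α then 1 else 0 := by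
    intro α o'
    simp only [I]
    rcases hb (o'.2 r) with h | h <;> simp [h]
  have hI2 : ∀ β o', I 0 β o' + I 1 β o' =
      if (agreeRuns p r).r o o' ∧ o'.2 r = β then 1 else 0 := by
    intro β o'
    simp only [I]
    rcases hb (o'.1 r) with h | h <;> simp [h]
  have hI3 : ∀ o', I 0 0 o' + I 0 1 o' + (I 1 0 o' + I 1 1 o') =
      if (agreeRuns p r).r o o' then 1 else 0 := by
    intro o'
    rw [hI1, hI1]
    rcases hb (o'.1 r) with h | h <;> simp [h]
  have hrel : ∀ o' o'' : Outcomes p, (agree Bit (r : ℕ)).r o'.1 o''.1 →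
      (agree Bit (r : ℕ)).r o'.2 o''.2 → ((agreeRuns p r).r o o' ↔ (agreeRuns p r).r o o'') :=
    fun o' o'' h1 h2 => ⟨fun h => (agreeRuns p r).trans h ⟨h1, h2⟩,
      fun h => (agreeRuns p r).trans h ((agreeRuns p r).symm ⟨h1, h2⟩)⟩
  have hsucc : ∀ {u v : Outputs p}, (agree Bit ((r : ℕ) + 1)).r u v → (agree Bit (r : ℕ)).r u v :=
    fun h j hj => h j (by omega)
  have hA : ∀ ξ υ, E 0 0 ξ υ + E 0 1 ξ υ =
      ∑ o' : Outcomes p, dev P o'.1 o'.2 w (Function.update x r ξ) (Function.update y r (y r)) z *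
        if (agreeRuns p r).r o o' ∧ o'.1 r = 0 then 1 else 0 := by
    intro ξ υ
    rw [← Finset.sum_add_distrib]
    simp only [← mul_add, hI1]
    refine sum_mul_dev_congr hP (n := r + 1) (k := r) ((agree _ _).refl _)
      (agree_update y r υ (y r)) (fun o' o'' h1 h2 => ?_) w z
    simp only [hrel o' o'' (hsucc h1) h2, h1 r (Nat.lt_succ_self _)]
  have hB : ∀ ξ υ, E 0 0 ξ υ + E 1 0 ξ υ =
      ∑ o' : Outcomes p, dev P o'.1 o'.2 w (Function.update x r (x r)) (Function.update y r υ) z *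
        if (agreeRuns p r).r o o' ∧ o'.2 r = 0 then 1 else 0 := by
    intro ξ υ
    rw [← Finset.sum_add_distrib]
    simp only [← mul_add, hI2]
    refine sum_mul_dev_congr hP (n := r) (k := r + 1)
      (agree_update x r ξ (x r)) ((agree _ _).refl _) (fun o' o'' h1 h2 => ?_) w z
    simp only [hrel o' o'' h1 (hsucc h2), h2 r (Nat.lt_succ_self _)]
  have hT : ∀ ξ υ, E 0 0 ξ υ + E 0 1 ξ υ + (E 1 0 ξ υ + E 1 1 ξ υ) =
      classSum (agreeRuns p r) (fun o => dev P o.1 o.2 w x y z) o := by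
    intro ξ υ
    simp only [E, ← Finset.sum_add_distrib, ← mul_add, hI3]
    rw [sum_mul_dev_congr hP (n := r) (k := r) (agree_update x r ξ (x r))
      (agree_update y r υ (y r)) (fun o' o'' h1 h2 => ?_) w z]
    · rw [Function.update_eq_self, Function.update_eq_self]
      unfold classSum
      exact Finset.sum_congr rfl fun o' _ => by split_ifs <;> simp
    · simp only [hrel o' o'' h1 h2]
  have main := ladder_inequality E
    (fun α β ξ υ => Finset.sum_nonneg fun o' _ => mul_nonneg (dev_nonneg hP _ _ _ _ _ _)
      (by simp only [I]; split_ifs <;> simp)) _ _ _ hA hB hT (x r)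
  have h1 : classSum (agreeRuns p r) (fun o => dev P o.1 o.2 w x y z * hardyInd r o) o =
      E 0 0 (x r) (x r) := by
    simp only [E]
    rw [Function.update_eq_self]
    rw [hxy, Function.update_eq_self]
    unfold classSum
    refine Finset.sum_congr rfl fun o' _ => ?_
    simp only [I, hardyInd]
    by_cases h : (agreeRuns p r).r o o' <;> simp [h]
  have h2 : ∀ ξ υ, ∑ α, ∑ β, BH p α β ξ υ * E α β ξ υ =
      classSum (agreeRuns p r) (fun o =>
        dev P o.1 o.2 w (Function.update x r ξ) (Function.update y r υ) z *
          BH p (o.1 r) (o.2 r) ξ υ) o := by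
    intro ξ υ
    simp only [Fin.sum_univ_two, E, Finset.mul_sum]
    simp only [← Finset.sum_add_distrib]
    unfold classSum
    refine Finset.sum_congr rfl fun o' _ => ?_
    simp only [I]
    by_cases h : (agreeRuns p r).r o o'
    · rcases hb (o'.1 r) with h1 | h1 <;> rcases hb (o'.2 r) with h2 | h2 <;>
        simp [h, h1, h2, mul_comm]
    · simp [h]
  rw [h1]
  simp only [h2] at main
  exact main

end TimeOrder

/-! ### Bias of indicators on an event -/

section Bias

variable {Ω ι : Type*} [Fintype Ω] [LinearOrder ι]

/-- The increments `h r - E[h r | past]` are orthogonal. -/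
theorem sum_mul_increments_eq_zero {D : Ω → ℝ} (hD : ∀ ω, 0 ≤ D ω) {R : ι → Setoid Ω}
    {h : ι → Ω → ℝ} (hR : ∀ i j, i < j → ∀ ω ω', (R j).r ω ω' → (R i).r ω ω')
    (hh : ∀ i j, i < j → IsClassFun (R j) (h i)) {i j : ι} (hij : i ≠ j) :
    ∑ ω, D ω * ((h i ω - condE (R i) D (h i) ω) * (h j ω - condE (R j) D (h j) ω)) = 0 := by
  have key : ∀ i j, i < j →
      ∑ ω, D ω * ((h i ω - condE (R i) D (h i) ω) * (h j ω - condE (R j) D (h j) ω)) = 0 := by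
    intro i j hij
    have hc : IsClassFun (R j) fun ω => h i ω - condE (R i) D (h i) ω := fun ω ω' hω => by
      simp only [hh i j hij ω ω' hω, condE_isClassFun D (h i) ω ω' (hR i j hij ω ω' hω)]
    have := sum_mul_condE hD hc (h j)
    rw [← sub_eq_zero, ← Finset.sum_sub_distrib] at this
    rw [← neg_eq_zero, ← Finset.sum_neg_distrib, ← this]
    exact Finset.sum_congr rfl fun ω _ => by ring
  rcases lt_or_gt_of_ne hij with hlt | hlt
  · exact key i j hlt
  · rw [← key j i hlt]
    exact Finset.sum_congr rfl fun ω _ => by ring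

open Classical in
/-- If on the event `ev` at least a fraction `1 / 2 - δ` of the indicators `h r`, `r ∈ S`, are `1`,
then the sum of the biases of these indicators on `ev` is small, unless the conditional
probabilities given the past exceed `1 / 2`. -/
theorem sum_abs_bias_le {D : Ω → ℝ} (hD : ∀ ω, 0 ≤ D ω) {R : ι → Setoid Ω}
    {h : ι → Ω → ℝ} (hR : ∀ i j, i < j → ∀ ω ω', (R j).r ω ω' → (R i).r ω ω')
    (hh : ∀ i j, i < j → IsClassFun (R j) (h i)) (h0 : ∀ i ω, 0 ≤ h i ω) (h1 : ∀ i ω, h i ω ≤ 1)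
    (S : Finset ι) (ev : Ω → Prop) {δ : ℝ} (hδ : 0 ≤ δ)
    (hev : ∀ ω, ev ω → (1 / 2 - δ) * S.card ≤ ∑ r ∈ S, h r ω)
    (ok : ι → Ω → ℝ) (hok0 : ∀ r ω, 0 ≤ ok r ω) (hok : ∀ r ω, ev ω → ok r ω = 1) :
    ∑ r ∈ S, |∑ ω, if ev ω then D ω * (2 * h r ω - 1) else 0| ≤
      (4 * Real.sqrt S.card + 2 * δ * S.card) * ∑ ω, D ω +
        2 * ∑ r ∈ S, ∑ ω, D ω * (ok r ω * max (2 * condE (R r) D (h r) ω - 1) 0) := by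
  set G : ι → ℝ := fun r => ∑ ω, if ev ω then D ω * (2 * h r ω - 1) else 0 with hG
  set X : ι → Ω → ℝ := fun r ω => h r ω - condE (R r) D (h r) ω with hX
  -- The signs are fixed before summing over ω, so `σ r * X r` are again orthogonal increments and
  -- the sum of absolute values becomes one expectation.
  set σ : ι → ℝ := fun r => if 0 ≤ G r then 1 else -1 with hσ
  have hσ1 : ∀ r, σ r = 1 ∨ σ r = -1 := fun r => by
    simp only [hσ]; split_ifs <;> simp
  have hX1 : ∀ r ω, |X r ω| ≤ 1 := fun r ω => by
    have := condE_nonneg (R := R r) hD (h0 r) ω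
    have := condE_le_one (R := R r) hD (h1 r) ω
    have := h0 r ω
    have := h1 r ω
    rw [abs_le]
    constructor <;> simp only [hX] <;> linarith
  have horth : ∀ i ∈ S, ∀ j ∈ S, i ≠ j → ∑ ω, D ω * (X i ω * X j ω) = 0 := fun i _ j _ hij =>
    sum_mul_increments_eq_zero hD hR hh hij
  have hm1 := sum_mul_abs_sum_le hD X S (fun r _ => hX1 r) horth
  have hm2 := sum_mul_abs_sum_le hD (fun r ω => σ r * X r ω) S
    (fun r _ ω => by rcases hσ1 r with h | h <;> simp [h, hX1]) fun i hi j hj hij => by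
      have : ∀ ω, D ω * (σ i * X i ω * (σ j * X j ω)) = σ i * σ j * (D ω * (X i ω * X j ω)) :=
        fun ω => by ring
      simp only [this, ← Finset.mul_sum, horth i hi j hj hij, mul_zero]
  have habs : ∀ r, |G r| = σ r * G r := fun r => by
    simp only [hσ]
    split_ifs with h
    · rw [abs_of_nonneg h, one_mul]
    · rw [abs_of_neg (not_le.1 h)]; ring
  have hswap : ∑ r ∈ S, |G r| =
      ∑ ω, if ev ω then D ω * ∑ r ∈ S, σ r * (2 * h r ω - 1) else 0 := by
    rw [Finset.sum_congr rfl fun r _ => habs r]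
    simp only [hG, Finset.mul_sum]
    rw [Finset.sum_comm]
    refine Finset.sum_congr rfl fun ω _ => ?_
    split_ifs
    · exact Finset.sum_congr rfl fun r _ => by ring
    · simp
  set K : Ω → ℝ := fun ω => ∑ r ∈ S, ok r ω * max (2 * condE (R r) D (h r) ω - 1) 0 with hK
  have hK0 : ∀ ω, 0 ≤ K ω := fun ω => Finset.sum_nonneg fun r _ =>
    mul_nonneg (hok0 r ω) (le_max_right _ _)
  have hpt : ∀ ω, (if ev ω then D ω * ∑ r ∈ S, σ r * (2 * h r ω - 1) else 0) ≤
      D ω * (2 * |∑ r ∈ S, σ r * X r ω| + 2 * |∑ r ∈ S, X r ω| + 2 * δ * S.card + 2 * K ω) := by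
    intro ω
    split_ifs with he
    · refine mul_le_mul_of_nonneg_left ?_ (hD ω)
      -- Let c be the conditional mean, so h = X + c. For σ = 1 this is the inequality 2c - 1 ≤ 1 -
      -- 2c + 2·max(2c - 1, 0), up to increments; for σ = -1 the term 1 - 2h is already there. The
      -- sum of the terms 1 - 2h is what the hypothesis on `ev` bounds.
      have ht : ∀ r ∈ S, σ r * (2 * h r ω - 1) ≤ 2 * (σ r * X r ω) + 2 * X r ω + (1 - 2 * h r ω) +
          2 * (ok r ω * max (2 * condE (R r) D (h r) ω - 1) 0) := by
        intro r _
        rw [hok r ω he, one_mul]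
        have a1 := le_max_left (2 * condE (R r) D (h r) ω - 1) 0
        have a2 := le_max_right (2 * condE (R r) D (h r) ω - 1) 0
        rcases hσ1 r with hs | hs <;> simp only [hs, hX] <;> linarith
      have hs := Finset.sum_le_sum ht
      simp only [Finset.sum_add_distrib, Finset.sum_sub_distrib, ← Finset.mul_sum,
        Finset.sum_const, nsmul_eq_mul, mul_one] at hs
      have b1 := le_abs_self (∑ r ∈ S, σ r * X r ω)
      have b2 := le_abs_self (∑ r ∈ S, X r ω)
      have b3 := hev ω he
      simp only [hK]
      linarith
    · exact mul_nonneg (hD ω) (by have := hK0 ω; positivity)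
  rw [hswap]
  refine (Finset.sum_le_sum fun ω _ => hpt ω).trans ?_
  have e1 : ∑ ω, D ω * (2 * |∑ r ∈ S, σ r * X r ω| + 2 * |∑ r ∈ S, X r ω| + 2 * δ * S.card +
      2 * K ω) = 2 * ∑ ω, D ω * |∑ r ∈ S, σ r * X r ω| + 2 * ∑ ω, D ω * |∑ r ∈ S, X r ω| +
      2 * δ * S.card * ∑ ω, D ω + 2 * ∑ ω, D ω * K ω := by
    simp only [Finset.mul_sum, ← Finset.sum_add_distrib]
    exact Finset.sum_congr rfl fun ω _ => by ring
  have e2 : ∑ ω, D ω * K ω =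
      ∑ r ∈ S, ∑ ω, D ω * (ok r ω * max (2 * condE (R r) D (h r) ω - 1) 0) := by
    simp only [hK, Finset.mul_sum]
    rw [Finset.sum_comm]
  rw [e1, e2]
  linarith

end Bias

/-- Counting only the violations that are preceded by at most `τ` others, one finds at most `τ + 1`
of them. -/
theorem sum_ite_partial_sum_le {M : ℕ} (c : Fin M → ℝ) (hc0 : ∀ i, 0 ≤ c i) (hc1 : ∀ i, c i ≤ 1)
    {τ : ℝ} (hτ : 0 ≤ τ) :
    (∑ r, c r * (if ∑ i ∈ Finset.univ.filter (· < r), c i ≤ τ then 1 else 0)) ≤ τ + 1 := by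
  classical
  set f : Fin M → ℝ := fun r =>
    c r * (if ∑ i ∈ Finset.univ.filter (· < r), c i ≤ τ then 1 else 0) with hf
  -- A term is added only while the full sum is at most τ. The truncated sum is then at most τ too,
  -- and one more term adds at most 1.
  have key : ∀ n ≤ M, ∑ r ∈ Finset.univ.filter (fun i : Fin M => (i : ℕ) < n), f r ≤
      ∑ r ∈ Finset.univ.filter (fun i : Fin M => (i : ℕ) < n), c r ∧
      ∑ r ∈ Finset.univ.filter (fun i : Fin M => (i : ℕ) < n), f r ≤ τ + 1 := by
    intro n
    induction n with
    | zero => intro _; simp; linarith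
    | succ n ih =>
      intro hn
      obtain ⟨ih1, ih2⟩ := ih (by omega)
      have hins : Finset.univ.filter (fun i : Fin M => (i : ℕ) < n + 1) =
          insert ⟨n, hn⟩ (Finset.univ.filter fun i : Fin M => (i : ℕ) < n) := by
        ext i
        simp only [Finset.mem_filter, Finset.mem_univ, true_and, Finset.mem_insert, Fin.ext_iff]
        omega
      have hnot : (⟨n, hn⟩ : Fin M) ∉ Finset.univ.filter fun i : Fin M => (i : ℕ) < n := by simp
      have hlt : Finset.univ.filter (· < (⟨n, hn⟩ : Fin M)) =
          Finset.univ.filter fun i : Fin M => (i : ℕ) < n := by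
        ext i; simp [Fin.lt_def]
      rw [hins, Finset.sum_insert hnot, Finset.sum_insert hnot]
      have h1 := hc1 ⟨n, hn⟩
      have h0 := hc0 ⟨n, hn⟩
      have hfn : f ⟨n, hn⟩ = c ⟨n, hn⟩ *
          (if ∑ i ∈ Finset.univ.filter (fun i : Fin M => (i : ℕ) < n), c i ≤ τ then 1 else 0) := by
        simp only [hf, hlt]
      rw [hfn]
      split_ifs with h
      · constructor <;> linarith
      · constructor <;> linarith
  have h := (key M le_rfl).2
  rwa [Finset.filter_true_of_mem fun i _ => i.isLt] at h

/-! ### Acceptance and the bias of the output -/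

section Security

variable {p : Params} {W Z E : Type} [Fintype W] [Fintype E] {ε : ℝ} {P : Box p W Z E}

/-- The law of the source does not depend on any input. -/
theorem exists_source [Nonempty Z] (hP : Admissible ε P) : ∃ Q : Str p → E → ℝ,
    (∀ t e, 0 ≤ Q t e) ∧ ∑ t, ∑ e, Q t e = 1 ∧ IsSV ε Q ∧
      ∀ a b w t e x y z, P a b w t e x y z = dev P a b w x y z * Q t e := by
  obtain ⟨z₀⟩ := ‹Nonempty Z›
  let x₀ : Inputs p := fun _ => ⟨0, by positivity⟩
  refine ⟨src P x₀ x₀ z₀, fun t e => ?_, ?_, hP.source_SV _ _ _, fun a b w t e x y z => ?_⟩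
  · exact Finset.sum_nonneg fun a _ => Finset.sum_nonneg fun b _ => Finset.sum_nonneg fun w _ =>
      hP.nonneg a b w t e _ _ _
  · have h := hP.sum_one x₀ x₀ z₀
    unfold src
    rw [← h]
    simp only [← Fintype.sum_prod_type']
    refine Fintype.sum_equiv ⟨fun u => (u.2.2.1, u.2.2.2.1, u.2.2.2.2, u.1, u.2.1),
      fun v => (v.2.2.2.1, v.2.2.2.2, v.1, v.2.1, v.2.2.1), fun _ => rfl, fun _ => rfl⟩ _ _
      fun _ => rfl
  · rw [hP.source_device_indep, hP.no_signal_to_source x x₀ y x₀ z z₀]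

theorem sum_dev (hP : Admissible ε P) (x y : Inputs p) (z : Z) :
    ∑ w, ∑ o : Outcomes p, dev P o.1 o.2 w x y z = 1 := by
  have h := hP.sum_one x y z
  rw [← h, Finset.sum_comm]
  simp only [Fintype.sum_prod_type]
  rfl

/-- The law `P(a, b | x', y')` of the device. -/
def devAB (P : Box p W Z E) (z : Z) (x y : Inputs p) (o : Outcomes p) : ℝ :=
  ∑ w, dev P o.1 o.2 w x y z

theorem devAB_nonneg (hP : Admissible ε P) (z : Z) (x y : Inputs p) (o : Outcomes p) :
    0 ≤ devAB P z x y o := Finset.sum_nonneg fun w _ => dev_nonneg hP _ _ w _ _ _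

theorem sum_devAB (hP : Admissible ε P) (z : Z) (x y : Inputs p) :
    ∑ o, devAB P z x y o = 1 := by
  unfold devAB
  rw [Finset.sum_comm]
  exact sum_dev hP x y z

theorem devAB_congr (hP : Admissible ε P) (z z' : Z) (x y : Inputs p) :
    devAB P z x y = devAB P z' x y := funext fun o => hP.ns_AB o.1 o.2 x y z z'

open Classical in
-- The adversary's output is summed out, so only the law of the two components enters, and this law
-- does not depend on z.
theorem eventProb_eq {Q : Str p → E → ℝ}
    (hPQ : ∀ a b w t e x y z, P a b w t e x y z = dev P a b w x y z * Q t e) (z : Z)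
    (ev : Outputs p → Outputs p → Str p → Prop) :
    eventProb P z ev = ∑ t, ∑ e, Q t e *
      ∑ o : Outcomes p, if ev o.1 o.2 t then devAB P z (settingA p t) (settingB p t) o else 0 := by
  unfold eventProb devAB
  have h1 : ∀ t e, Q t e * (∑ o : Outcomes p, if ev o.1 o.2 t then
      ∑ w, dev P o.1 o.2 w (settingA p t) (settingB p t) z else 0) =
      ∑ a, ∑ b, ∑ w, if ev a b t then P a b w t e (settingA p t) (settingB p t) z else 0 := by
    intro t e
    rw [Fintype.sum_prod_type, Finset.mul_sum]
    refine Finset.sum_congr rfl fun a _ => ?_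
    rw [Finset.mul_sum]
    refine Finset.sum_congr rfl fun b _ => ?_
    split_ifs
    · simp only [hPQ, Finset.mul_sum, mul_comm]
    · simp
  simp only [h1]
  simp only [← Fintype.sum_prod_type']
  refine Fintype.sum_equiv ⟨fun u => (u.2.2.2.1, u.2.2.2.2, u.1, u.2.1, u.2.2.1),
      fun v => (v.2.2.1, v.2.2.2.1, v.2.2.2.2, v.1, v.2.1), fun _ => rfl, fun _ => rfl⟩ _ _
      fun _ => rfl

theorem eventProb_congr [Nonempty Z] (hP : Admissible ε P) (z z' : Z)
    (ev : Outputs p → Outputs p → Str p → Prop) : eventProb P z ev = eventProb P z' ev := by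
  obtain ⟨Q, -, -, -, hPQ⟩ := exists_source hP
  rw [eventProb_eq hPQ, eventProb_eq hPQ]
  simp only [devAB_congr hP z z']

/-- The run selected by the source, if the settings are `x`, `y`. -/
def selRun (p : Params) (x y : Inputs p) (t : Str p) : Option (Fin p.M) :=
  ((SHnz p x y).sort (· ≤ ·))[selectionIndex p (SHnz p x y) t]?

theorem card_SHnz_pos {x y : Inputs p} (hM : 0 < p.M) (h : SizeCheck p x y) :
    0 < (SHnz p x y).card := by
  have h1 : (0 : ℝ) < (SHnz p x y).card := lt_of_lt_of_le (by positivity) h.2.1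
  exact_mod_cast h1

/-- A position read from ⌊log₂|S|⌋ bits is below |S|, so once the cardinality check is passed the
selection never falls outside the list. -/
theorem exists_selRun {x y : Inputs p} (hM : 0 < p.M) (h : SizeCheck p x y) (t : Str p) :
    ∃ r ∈ SHnz p x y, selRun p x y t = some r := by
  have h1 : selectionIndex p (SHnz p x y) t < (SHnz p x y).card :=
    lt_of_lt_of_le (Fin.isLt _) (Nat.pow_log_le_self 2 (card_SHnz_pos hM h).ne')
  have h2 : selectionIndex p (SHnz p x y) t < ((SHnz p x y).sort (· ≤ ·)).length := by simpa
  refine ⟨((SHnz p x y).sort (· ≤ ·))[selectionIndex p (SHnz p x y) t], ?_, ?_⟩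
  · rw [← Finset.mem_sort (r := (· ≤ ·))]
    exact List.getElem_mem h2
  · exact List.getElem?_eq_getElem h2

open Classical in
theorem output_eq_of_selRun {t : Str p} {r : Fin p.M}
    (h : SizeCheck p (settingA p t) (settingB p t))
    (hr : selRun p (settingA p t) (settingB p t) t = some r) (a b : Outputs p) :
    output p a b t = if Tests p a b (settingA p t) (settingB p t) then
      some (if a r = 0 ∧ b r = 0 then 0 else 1) else none := by
  unfold selRun at hr
  unfold output
  rw [hr]
  simp [h]

open Classical in
/-- The difference of the probabilities of the outputs `0` and `1`, if run `r` is selected. -/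
def bias (P : Box p W Z E) (w : W) (x y : Inputs p) (z : Z) (r : Fin p.M) : ℝ :=
  ∑ o : Outcomes p, if Tests p o.1 o.2 x y then dev P o.1 o.2 w x y z * (2 * hardyInd r o - 1) else 0

open Classical in
-- For a bit, the distance from uniform is half the difference of the two probabilities, for either
-- value of s. This difference is the weight of (t, e) times the bias of the selected run.
theorem abs_condProb_sub {Q : Str p → E → ℝ} (hQ : ∀ t e, 0 ≤ Q t e)
    (hPQ : ∀ a b w t e x y z, P a b w t e x y z = dev P a b w x y z * Q t e) (hM : 0 < p.M)
    (s : Bit) (w : W) (t : Str p) (e : E) (z : Z) (hA : 0 ≤ accProb P z) :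
    |condProb P s w t e z - 1 / 2 * ∑ s' : Bit, condProb P s' w t e z| =
      (if SizeCheck p (settingA p t) (settingB p t) then
        1 / 2 * (Q t e * (selRun p (settingA p t) (settingB p t) t).elim 0
          fun r => |bias P w (settingA p t) (settingB p t) z r|) else 0) / accProb P z := by
  have hsub : |condProb P s w t e z - 1 / 2 * ∑ s' : Bit, condProb P s' w t e z| =
      1 / 2 * |condProb P 0 w t e z - condProb P 1 w t e z| := by
    rw [Fin.sum_univ_two, ← abs_of_nonneg (show (0 : ℝ) ≤ 1 / 2 by norm_num), ← abs_mul,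
      abs_of_nonneg (show (0 : ℝ) ≤ 1 / 2 by norm_num)]
    fin_cases s
    · simp only [Fin.zero_eta]; congr 1; ring
    · simp only [Fin.mk_one]; rw [abs_sub_comm]; congr 1; ring
  rw [hsub]
  unfold condProb
  by_cases h : SizeCheck p (settingA p t) (settingB p t)
  · obtain ⟨r, -, hr⟩ := exists_selRun hM h t
    simp only [h, hr, if_true, Option.elim_some]
    rw [← sub_div, abs_div, abs_of_nonneg hA, ← mul_div_assoc]
    congr 2
    rw [← abs_of_nonneg (hQ t e), ← abs_mul]
    congr 1
    unfold bias
    rw [Fintype.sum_prod_type, Finset.mul_sum, ← Finset.sum_sub_distrib]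
    refine Finset.sum_congr rfl fun a _ => ?_
    rw [Finset.mul_sum, ← Finset.sum_sub_distrib]
    refine Finset.sum_congr rfl fun b _ => ?_
    rw [output_eq_of_selRun h hr]
    by_cases hT : Tests p a b (settingA p t) (settingB p t)
    · by_cases hab : a r = 0 ∧ b r = 0
      · simp [hT, hab, hardyInd, hPQ]; ring
      · simp [hT, hab, hardyInd, hPQ]; ring
    · simp [hT]
  · have hn : ∀ a b, output p a b t = none := fun a b => by unfold output; simp [h]
    simp [h, hn]

open Classical in
/-- The composable distance in terms of the biases in the selected runs. -/
theorem dComp_le [Nonempty Z] {Q : Str p → E → ℝ} (hQ : ∀ t e, 0 ≤ Q t e)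
    (hPQ : ∀ a b w t e x y z, P a b w t e x y z = dev P a b w x y z * Q t e) (hM : 0 < p.M)
    {A : ℝ} (hA : 0 < A) (hacc : ∀ z, accProb P z = A) (C : Inputs p → Inputs p → E → ℝ)
    (hC0 : ∀ x y e, 0 ≤ C x y e)
    (hC : ∀ x y e z, SizeCheck p x y →
      ∑ w, ∑ t, (if settingA p t = x ∧ settingB p t = y then
        Q t e * (selRun p x y t).elim 0 fun r => |bias P w x y z r| else 0) ≤ C x y e) :
    dComp P ≤ (∑ x, ∑ y, ∑ e, C x y e) / A := by
  have key : ∀ s x y e z, ∑ w : W,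
      ∑ t ∈ Finset.univ.filter fun t : Str p => settingA p t = x ∧ settingB p t = y,
        |condProb P s w t e z - 1 / 2 * ∑ s' : Bit, condProb P s' w t e z| ≤
      1 / 2 * (C x y e / A) := by
    intro s x y e z
    have h1 : ∀ w, ∑ t ∈ Finset.univ.filter fun t : Str p => settingA p t = x ∧ settingB p t = y,
        |condProb P s w t e z - 1 / 2 * ∑ s' : Bit, condProb P s' w t e z| =
        (if SizeCheck p x y then 1 / 2 * ∑ t, (if settingA p t = x ∧ settingB p t = y then
          Q t e * (selRun p x y t).elim 0 fun r => |bias P w x y z r| else 0) else 0) / A := by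
      intro w
      rw [Finset.sum_filter]
      by_cases h : SizeCheck p x y
      · simp only [h, if_true]
        rw [Finset.mul_sum, Finset.sum_div]
        refine Finset.sum_congr rfl fun t _ => ?_
        split_ifs with hxy
        · obtain ⟨rfl, rfl⟩ := hxy
          rw [abs_condProb_sub hQ hPQ hM s w t e z (by rw [hacc]; exact hA.le), hacc, if_pos h]
        · simp
      · simp only [h, if_false, zero_div]
        refine Finset.sum_eq_zero fun t _ => ?_
        split_ifs with hxy
        · obtain ⟨rfl, rfl⟩ := hxy
          rw [abs_condProb_sub hQ hPQ hM s w t e z (by rw [hacc]; exact hA.le), if_neg h, zero_div]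
        · rfl
    simp only [h1]
    rw [← Finset.sum_div, ← mul_div_assoc]
    refine div_le_div_of_nonneg_right ?_ hA.le
    by_cases h : SizeCheck p x y
    · simp only [h, if_true, ← Finset.mul_sum]
      exact mul_le_mul_of_nonneg_left (hC x y e z h) (by norm_num)
    · simp only [h, if_false, Finset.sum_const_zero]
      have := hC0 x y e
      positivity
  unfold dComp
  calc _ ≤ ∑ _s : Bit, ∑ x : Inputs p, ∑ y : Inputs p, ∑ e : E, 1 / 2 * (C x y e / A) :=
        Finset.sum_le_sum fun s _ => Finset.sum_le_sum fun x _ => Finset.sum_le_sum fun y _ =>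
          Finset.sum_le_sum fun e _ => ciSup_le fun z => key s x y e z
    _ = (∑ x, ∑ y, ∑ e, C x y e) / A := by
        simp only [Fin.sum_univ_two, ← Finset.mul_sum, ← Finset.sum_div]
        ring

open Classical in
/-- The sum over all strings with given settings, as a sum over all strings. -/
theorem sum_settings_eq (q F : Str p → ℝ) (f : Inputs p → Inputs p → ℝ)
    (hF : ∀ t, F t = f (settingA p t) (settingB p t)) :
    ∑ x, ∑ y, (∑ t, if settingA p t = x ∧ settingB p t = y then q t else 0) * f x y =
      ∑ t, q t * F t := by
  simp only [Finset.sum_mul]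
  rw [Finset.sum_congr rfl fun x _ => Finset.sum_comm, Finset.sum_comm]
  refine Finset.sum_congr rfl fun t _ => ?_
  rw [Finset.sum_eq_single (settingA p t), Finset.sum_eq_single (settingB p t)]
  · simp [hF]
  · intro y _ hy; simp [hy.symm]
  · simp
  · intro x _ hx; simp [hx.symm]
  · simp

open Classical in
-- The bound on the selection probability is the same for each run, so the average over selected
-- runs is replaced by the plain sum over all of `SHnz`; this loses only the bias of the selection.
theorem sum_selRun_le {E : Type} {Q : Str p → E → ℝ} (hQ : ∀ t e, 0 ≤ Q t e) (hSV : IsSV ε Q) (hε : 0 ≤ ε)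
    (e : E) (x y : Inputs p) {f : Fin p.M → ℝ} (hf : ∀ r, 0 ≤ f r) :
    (∑ t, if settingA p t = x ∧ settingB p t = y then Q t e * (selRun p x y t).elim 0 f else 0) ≤
      (1 / 2 + ε) ^ Nat.log 2 (SHnz p x y).card *
        (∑ t, if settingA p t = x ∧ settingB p t = y then Q t e else 0) *
          ∑ r ∈ SHnz p x y, f r := by
  set S := SHnz p x y with hS
  have h1 : ∀ t, (selRun p x y t).elim 0 f =
      ∑ u : Fin S.card, if selectionIndex p S t = u then f (S.orderEmbOfFin rfl u) else 0 := by
    intro t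
    unfold selRun
    rw [← hS]
    by_cases hu : selectionIndex p S t < S.card
    · have h2 : selectionIndex p S t < (S.sort (· ≤ ·)).length := by simpa
      rw [List.getElem?_eq_getElem h2, Finset.sum_eq_single ⟨_, hu⟩]
      · simp [Finset.orderEmbOfFin_apply]
      · intro u _ hne
        rw [if_neg fun h => hne (Fin.ext h.symm)]
      · simp
    · rw [List.getElem?_eq_none (by simpa using hu)]
      refine (Finset.sum_eq_zero fun u _ => if_neg fun h => hu ?_).symm
      rw [h]
      exact u.isLt
  have h2 : ∑ r ∈ S, f r = ∑ u : Fin S.card, f (S.orderEmbOfFin rfl u) := by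
    rw [← Finset.sum_coe_sort S f]
    exact (Fintype.sum_equiv (S.orderIsoOfFin rfl).toEquiv _ _ fun u => rfl).symm
  rw [h2, Finset.mul_sum]
  calc _ = ∑ u : Fin S.card, (∑ t, if (settingA p t = x ∧ settingB p t = y) ∧
        selectionIndex p S t = u then Q t e else 0) * f (S.orderEmbOfFin rfl u) := by
        simp only [Finset.sum_mul]
        rw [Finset.sum_comm]
        refine Finset.sum_congr rfl fun t _ => ?_
        by_cases hxy : settingA p t = x ∧ settingB p t = y
        · simp only [hxy, and_self, true_and, if_true, h1, Finset.mul_sum]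
          exact Finset.sum_congr rfl fun u _ => by split_ifs <;> simp
        · simp [hxy]
    _ ≤ _ := Finset.sum_le_sum fun u _ =>
        mul_le_mul_of_nonneg_right (sum_ite_selection_le hQ hSV hε e x y S u) (hf _)

end Security

/-! ### Security against no-signaling devices -/

section NoSignaling

variable {p : Params} {W Z E : Type} [Fintype W] [Fintype E] {ε : ℝ} {P : Box p W Z E}

theorem hardyInd_nonneg (r : Fin p.M) (o : Outcomes p) : 0 ≤ hardyInd r o := by
  unfold hardyInd; split_ifs <;> simp

theorem hardyInd_le_one (r : Fin p.M) (o : Outcomes p) : hardyInd r o ≤ 1 := by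
  unfold hardyInd; split_ifs <;> simp

theorem eq_of_mem_SHnz {x y : Inputs p} {r : Fin p.M} (hr : r ∈ SHnz p x y) : x r = y r := by
  simp only [SHnz, Finset.mem_filter] at hr
  exact Fin.ext (by omega)

/-- Indicator of having seen at most `τ` violations of the Hardy conditions before run `r`. -/
def okInd (p : Params) (τ : ℝ) (x y : Inputs p) (r : Fin p.M) (o : Outcomes p) : ℝ :=
  if ∑ i ∈ Finset.univ.filter (· < r), BH p (o.1 i) (o.2 i) (x i) (y i) ≤ τ then 1 else 0

theorem okInd_nonneg (τ : ℝ) (x y : Inputs p) (r : Fin p.M) (o : Outcomes p) :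
    0 ≤ okInd p τ x y r o := by
  unfold okInd; split_ifs <;> simp

theorem okInd_congr (τ : ℝ) {x x' y y' : Inputs p} {r : Fin p.M} {o o' : Outcomes p}
    (hx : (agree (Setting p) r).r x x') (hy : (agree (Setting p) r).r y y')
    (ho : (agreeRuns p r).r o o') : okInd p τ x y r o = okInd p τ x' y' r o' := by
  unfold okInd
  have : ∑ i ∈ Finset.univ.filter (· < r), BH p (o.1 i) (o.2 i) (x i) (y i) =
      ∑ i ∈ Finset.univ.filter (· < r), BH p (o'.1 i) (o'.2 i) (x' i) (y' i) :=
    Finset.sum_congr rfl fun i hi => by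
      have hi : (i : ℕ) < r := (Finset.mem_filter.1 hi).2
      rw [hx i hi, hy i hi, ho.1 i hi, ho.2 i hi]
  rw [this]

/-- The weight of a violation of the Hardy conditions in run `r`, preceded by at most `τ` others, if
the settings of this run are `ξ`, `υ`. -/
def violation (P : Box p W Z E) (τ : ℝ) (z : Z) (x y : Inputs p) (r : Fin p.M)
    (ξ υ : Setting p) : ℝ :=
  ∑ o, devAB P z (Function.update x r ξ) (Function.update y r υ) o *
    (BH p (o.1 r) (o.2 r) ξ υ * okInd p τ x y r o)

theorem violation_nonneg (hP : Admissible ε P) (τ : ℝ) (z : Z) (x y : Inputs p) (r : Fin p.M)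
    (ξ υ : Setting p) : 0 ≤ violation P τ z x y r ξ υ :=
  Finset.sum_nonneg fun _ _ => mul_nonneg (devAB_nonneg hP _ _ _ _)
    (mul_nonneg (BH_nonneg _ _ _ _) (okInd_nonneg _ _ _ _ _))

/-- Overwriting the settings of run r and using time order leave only the settings before run r.
They are functions of earlier source bits, so the violation weight can be compared with the
conditional law of the next settings. -/
theorem violation_congr (hP : Admissible ε P) (τ : ℝ) (z : Z) {x x' y y' : Inputs p} {r : Fin p.M}
    (hx : (agree (Setting p) r).r x x') (hy : (agree (Setting p) r).r y y') (ξ υ : Setting p) :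
    violation P τ z x y r ξ υ = violation P τ z x' y' r ξ υ := by
  have hupd : ∀ {u v : Inputs p} (c : Setting p), (agree (Setting p) r).r u v →
      (agree (Setting p) ((r : ℕ) + 1)).r (Function.update u r c) (Function.update v r c) := by
    intro u v c h j hj
    by_cases hjr : j = r
    · subst hjr; simp
    · have : (j : ℕ) ≠ r := fun h => hjr (Fin.ext h)
      simpa [hjr] using h j (by omega)
  unfold violation devAB
  simp only [okInd_congr τ hx hy ((agreeRuns p r).refl _), Finset.sum_mul]
  rw [Finset.sum_comm, Finset.sum_comm (s := Finset.univ (α := Outcomes p))]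
  refine Finset.sum_congr rfl fun w _ => ?_
  refine sum_mul_dev_congr hP (n := r + 1) (k := r + 1) (hupd ξ hx) (hupd υ hy)
    (fun o o' h1 h2 => ?_) w z
  rw [h1 r (Nat.lt_succ_self _), h2 r (Nat.lt_succ_self _),
    okInd_congr τ ((agree _ _).refl x') ((agree _ _).refl y')
      ⟨fun j hj => h1 j (by omega), fun j hj => h2 j (by omega)⟩]

/-- The excess over `1 / 2` of the conditional probability of the outputs `(0, 0)` is controlled by
the violations of the Hardy conditions, whatever the adversary does. -/
theorem sum_excess_le (hP : Admissible ε P) (τ : ℝ) (z : Z) (x y : Inputs p) (r : Fin p.M)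
    (hxy : x r = y r) :
    ∑ w, ∑ o : Outcomes p, dev P o.1 o.2 w x y z * (okInd p τ x y r o *
      max (2 * condE (agreeRuns p r) (fun o => dev P o.1 o.2 w x y z) (hardyInd r) o - 1) 0) ≤
      ∑ ξ, ∑ υ, violation P τ z x y r ξ υ := by
  have hokc : IsClassFun (agreeRuns p r) (okInd p τ x y r) := fun o o' h =>
    okInd_congr τ ((agree _ _).refl x) ((agree _ _).refl y) h
  have hw : ∀ w, ∑ o : Outcomes p, dev P o.1 o.2 w x y z * (okInd p τ x y r o *
      max (2 * condE (agreeRuns p r) (fun o => dev P o.1 o.2 w x y z) (hardyInd r) o - 1) 0) ≤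
      ∑ ξ, ∑ υ, ∑ o : Outcomes p,
        dev P o.1 o.2 w (Function.update x r ξ) (Function.update y r υ) z *
          (BH p (o.1 r) (o.2 r) ξ υ * okInd p τ x y r o) := by
    intro w
    set D : Outcomes p → ℝ := fun o => dev P o.1 o.2 w x y z with hDdef
    have hD : ∀ o, 0 ≤ D o := fun o => dev_nonneg hP _ _ _ _ _ _
    set B : Setting p → Setting p → Outcomes p → ℝ := fun ξ υ o =>
      dev P o.1 o.2 w (Function.update x r ξ) (Function.update y r υ) z *
        BH p (o.1 r) (o.2 r) ξ υ with hB
    have hB0 : ∀ ξ υ o, 0 ≤ B ξ υ o := fun ξ υ o =>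
      mul_nonneg (dev_nonneg hP _ _ _ _ _ _) (BH_nonneg _ _ _ _)
    set V : Outcomes p → ℝ := fun o => ∑ ξ, ∑ υ, classSum (agreeRuns p r) (B ξ υ) o with hV
    have hV0 : ∀ o, 0 ≤ V o := fun o => Finset.sum_nonneg fun ξ _ => Finset.sum_nonneg fun υ _ =>
      classSum_nonneg (hB0 ξ υ) o
    have hVc : IsClassFun (agreeRuns p r) V := fun o o' h => by
      simp only [hV, classSum_isClassFun _ _ _ h]
    -- The denominator is the weight of the past under the actual inputs, while `V` is computed
    -- under all alternative settings of run r. Averaging over the pasts cancels the denominator.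
    have hmax : ∀ o, max (2 * condE (agreeRuns p r) D (hardyInd r) o - 1) 0 ≤
        V o / classSum (agreeRuns p r) D o := by
      intro o
      have hcs := classSum_nonneg (R := agreeRuns p r) hD o
      refine max_le ?_ (div_nonneg (hV0 o) hcs)
      rcases hcs.eq_or_lt with h0 | h0
      · unfold condE; rw [← h0]; simp
      · rw [le_div_iff₀ h0]
        refine le_trans (le_of_eq ?_) (ladder_inequality_run hP w z x y r hxy o)
        unfold condE
        simp only [hDdef] at h0 ⊢
        field_simp
    calc ∑ o, D o * (okInd p τ x y r o * max (2 * condE (agreeRuns p r) D (hardyInd r) o - 1) 0)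
        ≤ ∑ o, D o * ((okInd p τ x y r o * V o) / classSum (agreeRuns p r) D o) := by
          refine Finset.sum_le_sum fun o _ => mul_le_mul_of_nonneg_left ?_ (hD o)
          rw [mul_div_assoc]
          exact mul_le_mul_of_nonneg_left (hmax o) (okInd_nonneg _ _ _ _ _)
      _ ≤ ∑ o, (okInd p τ x y r o * V o) / classSum (agreeRuns p r) (fun _ => 1) o :=
          sum_mul_div_classSum_le (hokc.mul hVc) fun o =>
            mul_nonneg (okInd_nonneg _ _ _ _ _) (hV0 o)
      _ = ∑ ξ, ∑ υ, ∑ o, okInd p τ x y r o / classSum (agreeRuns p r) (fun _ => 1) o *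
            classSum (agreeRuns p r) (B ξ υ) o := by
          rw [Finset.sum_congr rfl fun ξ _ => Finset.sum_comm, Finset.sum_comm]
          refine Finset.sum_congr rfl fun o _ => ?_
          simp only [hV, ← Finset.mul_sum]
          ring
      _ = _ := by
          refine Finset.sum_congr rfl fun ξ _ => Finset.sum_congr rfl fun υ _ => ?_
          rw [sum_div_card_mul_classSum hokc]
          exact Finset.sum_congr rfl fun o _ => by simp only [hB]; ring
  refine (Finset.sum_le_sum fun w _ => hw w).trans (le_of_eq ?_)
  rw [Finset.sum_comm]
  refine Finset.sum_congr rfl fun ξ _ => ?_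
  rw [Finset.sum_comm]
  refine Finset.sum_congr rfl fun υ _ => ?_
  unfold violation devAB
  rw [Finset.sum_comm]
  simp only [Finset.sum_mul]

/-- In runs whose settings come from the source, few violations are preceded by at most
`τ` others. -/
theorem sum_violation_le (hP : Admissible ε P) {Q : Str p → E → ℝ} (hQ : ∀ t e, 0 ≤ Q t e)
    (hSV : IsSV ε Q) (hε : ε ≤ 1 / 2) {τ : ℝ} (hτ : 0 ≤ τ) (z : Z) (e : E) :
    (1 / 2 - ε) ^ (2 * p.m) * ∑ t, Q t e *
      ∑ r, ∑ ξ, ∑ υ, violation P τ z (settingA p t) (settingB p t) r ξ υ ≤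
      (τ + 1) * ∑ t, Q t e := by
  classical
  have h1 : ∀ r ξ υ, (1 / 2 - ε) ^ (2 * p.m) *
      ∑ t, Q t e * violation P τ z (settingA p t) (settingB p t) r ξ υ ≤
      ∑ t, if settingA p t r = ξ ∧ settingB p t r = υ then
        Q t e * violation P τ z (settingA p t) (settingB p t) r ξ υ else 0 := fun r ξ υ =>
    sum_ite_settings_ge hQ hSV hε e r
      (fun t t' h => violation_congr hP τ z (fun j hj => (settings_eq_of_agree h j hj).1)
        (fun j hj => (settings_eq_of_agree h j hj).2) ξ υ)
      (fun t => violation_nonneg hP _ _ _ _ _ _ _) ξ υ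
  have h2 : (1 / 2 - ε) ^ (2 * p.m) * ∑ t, Q t e *
      ∑ r, ∑ ξ, ∑ υ, violation P τ z (settingA p t) (settingB p t) r ξ υ =
      ∑ r, ∑ ξ, ∑ υ, (1 / 2 - ε) ^ (2 * p.m) *
        ∑ t, Q t e * violation P τ z (settingA p t) (settingB p t) r ξ υ := by
    simp only [← Finset.mul_sum]
    congr 1
    simp only [Finset.mul_sum]
    rw [Finset.sum_comm]
    refine Finset.sum_congr rfl fun r _ => ?_
    rw [Finset.sum_comm]
    exact Finset.sum_congr rfl fun ξ _ => Finset.sum_comm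
  -- Only the pair that really occurs survives; the updated inputs are then the actual ones, and the
  -- sum is an expected number of observed violations.
  have h3 : ∑ r, ∑ ξ, ∑ υ, (∑ t, if settingA p t r = ξ ∧ settingB p t r = υ then
      Q t e * violation P τ z (settingA p t) (settingB p t) r ξ υ else 0) =
      ∑ t, Q t e * ∑ r,
        violation P τ z (settingA p t) (settingB p t) r (settingA p t r) (settingB p t r) := by
    simp only [Finset.mul_sum]
    rw [Finset.sum_comm (s := Finset.univ (α := Str p))]
    refine Finset.sum_congr rfl fun r _ => ?_
    rw [Finset.sum_congr rfl fun ξ _ => Finset.sum_comm, Finset.sum_comm]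
    refine Finset.sum_congr rfl fun t _ => ?_
    rw [Finset.sum_eq_single (settingA p t r), Finset.sum_eq_single (settingB p t r)]
    · simp
    · intro υ _ hυ; simp [hυ.symm]
    · simp
    · intro ξ _ hξ; simp [hξ.symm]
    · simp
  rw [h2]
  refine (Finset.sum_le_sum fun r _ => Finset.sum_le_sum fun ξ _ => Finset.sum_le_sum fun υ _ =>
    h1 r ξ υ).trans ?_
  rw [h3, mul_comm, Finset.sum_mul]
  refine Finset.sum_le_sum fun t _ => mul_le_mul_of_nonneg_left ?_ (hQ t e)
  unfold violation
  simp only [Function.update_eq_self]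
  rw [Finset.sum_comm]
  simp only [← Finset.mul_sum]
  calc _ ≤ ∑ o, devAB P z (settingA p t) (settingB p t) o * (τ + 1) :=
        Finset.sum_le_sum fun o _ => mul_le_mul_of_nonneg_left
          (sum_ite_partial_sum_le (fun i => BH p (o.1 i) (o.2 i) (settingA p t i) (settingB p t i))
            (fun i => BH_nonneg _ _ _ _) (fun i => BH_le_one _ _ _ _) hτ) (devAB_nonneg hP _ _ _ _)
    _ = τ + 1 := by rw [← Finset.sum_mul, sum_devAB hP, one_mul]

/-- Passing the checks implies that there are at most `τ` violations. -/
theorem okInd_eq_one {τ : ℝ} {x y : Inputs p} (hs : SizeCheck p x y) (hδ₁ : 0 ≤ p.δ₁)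
    (hτ : p.δ₁ * (3 * p.M / 2 ^ p.m) ≤ τ) {o : Outcomes p} (ho : Tests p o.1 o.2 x y)
    (r : Fin p.M) : okInd p τ x y r o = 1 := by
  have h1 : ∑ i ∈ SH p x y, BH p (o.1 i) (o.2 i) (x i) (y i) ≤ p.δ₁ * (SH p x y).card := by
    -- If `SH` is empty, the quotient `ZH` is 0 by convention and says nothing, but the sum is empty
    -- as well.
    rcases (Nat.cast_nonneg (α := ℝ) (SH p x y).card).eq_or_lt with h | h
    · have : SH p x y = ∅ := by
        rw [← Finset.card_eq_zero]; exact_mod_cast h.symm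
      simp [this]
    · exact (div_le_iff₀ h).1 ho.1
  have h2 : ∑ i ∈ Finset.univ.filter (· < r), BH p (o.1 i) (o.2 i) (x i) (y i) ≤
      ∑ i ∈ SH p x y, BH p (o.1 i) (o.2 i) (x i) (y i) := by
    have h3 : ∑ i ∈ SH p x y, BH p (o.1 i) (o.2 i) (x i) (y i) =
        ∑ i, BH p (o.1 i) (o.2 i) (x i) (y i) := by
      refine Finset.sum_subset (Finset.subset_univ _) fun i _ hi => ?_
      simp only [SH, Finset.mem_filter, Finset.mem_univ, true_and] at hi
      unfold BH
      rw [if_neg]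
      tauto
    rw [h3]
    exact Finset.sum_le_sum_of_subset_of_nonneg (Finset.subset_univ _) fun i _ _ =>
      BH_nonneg _ _ _ _
  have h4 : p.δ₁ * (SH p x y).card ≤ p.δ₁ * (3 * p.M / 2 ^ p.m) :=
    mul_le_mul_of_nonneg_left hs.1.2 hδ₁
  unfold okInd
  rw [if_pos (by linarith)]

theorem sum_BHnz (x y : Inputs p) (o : Outcomes p) :
    ∑ r ∈ SHnz p x y, BHnz p (o.1 r) (o.2 r) (x r) (y r) = ∑ r ∈ SHnz p x y, hardyInd r o := by
  refine Finset.sum_congr rfl fun r hr => ?_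
  simp only [SHnz, Finset.mem_filter, Finset.mem_univ, true_and] at hr
  unfold BHnz hardyInd
  simp [hr.1, hr.2]

theorem le_sum_hardyInd {x y : Inputs p} (hs : 0 < (SHnz p x y).card) {o : Outcomes p}
    (ho : Tests p o.1 o.2 x y) :
    (1 / 2 - p.δ₂) * (SHnz p x y).card ≤ ∑ r ∈ SHnz p x y, hardyInd r o := by
  have h := ho.2
  unfold ZHnz at h
  rw [le_div_iff₀ (by exact_mod_cast hs)] at h
  exact h.trans (sum_BHnz x y o).le

/-- The total bias of the runs that can be selected. -/
theorem sum_abs_bias_SHnz_le (hP : Admissible ε P) (hM : 0 < p.M) (hδ₁ : 0 ≤ p.δ₁)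
    (hδ₂ : 0 ≤ p.δ₂) {τ : ℝ} (hτ : p.δ₁ * (3 * p.M / 2 ^ p.m) ≤ τ) {x y : Inputs p}
    (hs : SizeCheck p x y) (z z' : Z) :
    ∑ w, ∑ r ∈ SHnz p x y, |bias P w x y z r| ≤
      4 * Real.sqrt (SHnz p x y).card + 2 * p.δ₂ * (SHnz p x y).card +
        2 * ∑ r, ∑ ξ, ∑ υ, violation P τ z' x y r ξ υ := by
  have hmono : ∀ i j : Fin p.M, i < j → ∀ o o' : Outcomes p,
      (agreeRuns p j).r o o' → (agreeRuns p i).r o o' := fun i j hij o o' h =>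
    ⟨fun k hk => h.1 k (hk.trans hij), fun k hk => h.2 k (hk.trans hij)⟩
  have hcl : ∀ i j : Fin p.M, i < j → IsClassFun (agreeRuns p j) (hardyInd i) :=
    fun i j hij o o' h => by unfold hardyInd; rw [h.1 i hij, h.2 i hij]
  have h1 : ∀ w, ∑ r ∈ SHnz p x y, |bias P w x y z r| ≤
      (4 * Real.sqrt (SHnz p x y).card + 2 * p.δ₂ * (SHnz p x y).card) *
        ∑ o : Outcomes p, dev P o.1 o.2 w x y z +
      2 * ∑ r ∈ SHnz p x y, ∑ o : Outcomes p, dev P o.1 o.2 w x y z * (okInd p τ x y r o *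
        max (2 * condE (agreeRuns p r) (fun o => dev P o.1 o.2 w x y z) (hardyInd r) o - 1) 0) :=
    fun w => sum_abs_bias_le (R := fun r : Fin p.M => agreeRuns p r) (h := hardyInd)
      (fun o => dev_nonneg hP _ _ _ _ _ _) hmono hcl hardyInd_nonneg
      hardyInd_le_one (SHnz p x y) (fun o => Tests p o.1 o.2 x y) hδ₂
      (fun o ho => le_sum_hardyInd (card_SHnz_pos hM hs) ho) (okInd p τ x y)
      (okInd_nonneg τ x y) fun r o ho => okInd_eq_one hs hδ₁ hτ ho r
  refine (Finset.sum_le_sum fun w _ => h1 w).trans ?_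
  rw [Finset.sum_add_distrib, ← Finset.mul_sum, ← Finset.mul_sum, sum_dev hP, mul_one,
    Finset.sum_comm]
  refine add_le_add le_rfl (mul_le_mul_of_nonneg_left ?_ zero_le_two)
  refine (Finset.sum_le_sum fun r hr => sum_excess_le hP τ z x y r (eq_of_mem_SHnz hr)).trans ?_
  -- The adversary may choose z knowing all settings and e. Replacing z by a fixed z' makes the
  -- bound survive the supremum before it is averaged over the source.
  have : ∀ r ξ υ, violation P τ z x y r ξ υ = violation P τ z' x y r ξ υ := fun r ξ υ => by
    unfold violation; rw [devAB_congr hP z z']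
  simp only [this]
  exact Finset.sum_le_sum_of_subset_of_nonneg (Finset.subset_univ _) fun r _ _ =>
    Finset.sum_nonneg fun ξ _ => Finset.sum_nonneg fun υ _ => violation_nonneg hP _ _ _ _ _ _ _

/-- The terms in the parenthesis are the martingale fluctuation, the slack of the second test and
the violations; κ bounds the probability of selecting a given run. -/
theorem dComp_le_of_admissible [Nonempty Z] (hP : Admissible ε P) (hε0 : 0 ≤ ε) (hε : ε < 1 / 2)
    (hM : 0 < p.M) (hδ₁ : 0 ≤ p.δ₁) (hδ₂ : 0 ≤ p.δ₂) {τ : ℝ}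
    (hτ : p.δ₁ * (3 * p.M / 2 ^ p.m) ≤ τ) {A : ℝ} (hA : 0 < A) (hacc : ∀ z, accProb P z = A)
    {κ ℓ : ℝ} (hκ0 : 0 ≤ κ) (hℓ0 : 0 ≤ ℓ)
    (hκ : ∀ x y, SizeCheck p x y → (1 / 2 + ε) ^ Nat.log 2 (SHnz p x y).card ≤ κ)
    (hℓ : ∀ x y, SizeCheck p x y → ((SHnz p x y).card : ℝ) ≤ ℓ) :
    dComp P ≤ κ * (4 * Real.sqrt ℓ + 2 * p.δ₂ * ℓ + 2 * ((τ + 1) / (1 / 2 - ε) ^ (2 * p.m))) / A := by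
  classical
  have hτ0 : 0 ≤ τ := le_trans (by positivity) hτ
  obtain ⟨Q, hQ, hQ1, hSV, hPQ⟩ := exists_source hP
  have z₀ : Z := Classical.arbitrary Z
  set U : Inputs p → Inputs p → ℝ := fun x y => ∑ r, ∑ ξ, ∑ υ, violation P τ z₀ x y r ξ υ with hU
  have hU0 : ∀ x y, 0 ≤ U x y := fun x y => Finset.sum_nonneg fun r _ =>
    Finset.sum_nonneg fun ξ _ => Finset.sum_nonneg fun υ _ => violation_nonneg hP _ _ _ _ _ _ _
  set q : Inputs p → Inputs p → E → ℝ := fun x y e =>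
    ∑ t, if settingA p t = x ∧ settingB p t = y then Q t e else 0 with hq
  have hq0 : ∀ x y e, 0 ≤ q x y e := fun x y e => Finset.sum_nonneg fun t _ => by
    split_ifs <;> simp [hQ]
  set b : ℝ := 4 * Real.sqrt ℓ + 2 * p.δ₂ * ℓ with hb
  have hb0 : 0 ≤ b := by positivity
  have main := dComp_le hQ hPQ hM hA hacc (fun x y e => κ * (q x y e * (b + 2 * U x y)))
    (fun x y e => mul_nonneg hκ0 (mul_nonneg (hq0 x y e) (by linarith [hU0 x y]))) ?_
  · refine main.trans (div_le_div_of_nonneg_right ?_ hA.le)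
    simp only [← Finset.mul_sum]
    refine mul_le_mul_of_nonneg_left ?_ hκ0
    have h1 : ∑ x, ∑ y, ∑ e, q x y e * (b + 2 * U x y) =
        ∑ e, ∑ t, Q t e * (b + 2 * U (settingA p t) (settingB p t)) := by
      rw [Finset.sum_congr rfl fun x _ => Finset.sum_comm, Finset.sum_comm]
      exact Finset.sum_congr rfl fun e _ =>
        sum_settings_eq (fun t => Q t e) _ (fun x y => b + 2 * U x y) fun t => rfl
    rw [h1]
    have hl : 0 < (1 / 2 - ε) ^ (2 * p.m) := pow_pos (by linarith) _
    have h2 : ∀ e, ∑ t, Q t e * (b + 2 * U (settingA p t) (settingB p t)) ≤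
        (b + 2 * ((τ + 1) / (1 / 2 - ε) ^ (2 * p.m))) * ∑ t, Q t e := by
      intro e
      have h3 := sum_violation_le hP hQ hSV hε.le hτ0 z₀ e
      have h4 : ∑ t, Q t e * U (settingA p t) (settingB p t) ≤
          (τ + 1) / (1 / 2 - ε) ^ (2 * p.m) * ∑ t, Q t e := by
        rw [div_mul_eq_mul_div, le_div_iff₀ hl, mul_comm]
        exact h3
      have h5 : ∑ t, Q t e * (b + 2 * U (settingA p t) (settingB p t)) =
          b * ∑ t, Q t e + 2 * ∑ t, Q t e * U (settingA p t) (settingB p t) := by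
        simp only [Finset.mul_sum, ← Finset.sum_add_distrib]
        exact Finset.sum_congr rfl fun t _ => by ring
      rw [h5]
      linarith
    refine (Finset.sum_le_sum fun e _ => h2 e).trans (le_of_eq ?_)
    rw [← Finset.mul_sum, Finset.sum_comm, hQ1, mul_one]
  · intro x y e z hs
    calc _ ≤ ∑ w, (1 / 2 + ε) ^ Nat.log 2 (SHnz p x y).card * q x y e *
          ∑ r ∈ SHnz p x y, |bias P w x y z r| :=
          Finset.sum_le_sum fun w _ => sum_selRun_le hQ hSV hε0 e x y fun r => abs_nonneg _
      _ = (1 / 2 + ε) ^ Nat.log 2 (SHnz p x y).card * (q x y e *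
          ∑ w, ∑ r ∈ SHnz p x y, |bias P w x y z r|) := by
          rw [← Finset.mul_sum]; ring
      _ ≤ κ * (q x y e * (b + 2 * U x y)) := by
          refine mul_le_mul (hκ x y hs) (mul_le_mul_of_nonneg_left ?_ (hq0 x y e))
            (mul_nonneg (hq0 x y e) (Finset.sum_nonneg fun w _ => Finset.sum_nonneg fun r _ =>
              abs_nonneg _)) hκ0
          refine (sum_abs_bias_SHnz_le hP hM hδ₁ hδ₂ hτ hs z z₀).trans ?_
          have e1 : Real.sqrt (SHnz p x y).card ≤ Real.sqrt ℓ := Real.sqrt_le_sqrt (hℓ x y hs)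
          have e2 : p.δ₂ * (SHnz p x y).card ≤ p.δ₂ * ℓ :=
            mul_le_mul_of_nonneg_left (hℓ x y hs) hδ₂
          simp only [hb, hU]
          linarith

end NoSignaling

/-! ### The ladder correlations -/

section LadderCorrelations

/-- The measurement vectors have real coordinates. -/
def ladderCoord (q : ℝ) (k : ℕ) (j : Bit) : ℝ × ℝ :=
  if j = 0 then (Real.cos (ladderAngle q k), Real.sin (ladderAngle q k))
  else (-Real.sin (ladderAngle q k), Real.cos (ladderAngle q k))

theorem ladderProb_eq (q : ℝ) (a b : Bit) (x y : ℕ) :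
    ladderProb q a b x y = (q * ((ladderCoord q x a).1 * (ladderCoord q y b).1) -
      (ladderCoord q x a).2 * (ladderCoord q y b).2) ^ 2 / (1 + q ^ 2) := by
  have hc : ∀ k j, ladderVec q k j 0 = ((ladderCoord q k j).1 : ℂ) ∧
      ladderVec q k j 1 = ((ladderCoord q k j).2 : ℂ) := by
    intro k j
    unfold ladderVec ladderCoord
    split_ifs <;> simp
  have hin : inner ℂ (prodVec (ladderVec q x a) (ladderVec q y b)) (ladderState q) =
      (((q * ((ladderCoord q x a).1 * (ladderCoord q y b).1) -
        (ladderCoord q x a).2 * (ladderCoord q y b).2) / Real.sqrt (1 + q ^ 2) : ℝ) : ℂ) := by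
    unfold prodVec ladderState
    rw [PiLp.inner_apply, Fintype.sum_prod_type]
    simp only [Fin.sum_univ_two, (hc _ _).1, (hc _ _).2]
    simp
    ring
  unfold ladderProb
  rw [hin, Complex.norm_real, Real.norm_eq_abs, sq_abs, div_pow, Real.sq_sqrt (by positivity)]

theorem ladderProb_nonneg (q : ℝ) (a b : Bit) (x y : ℕ) : 0 ≤ ladderProb q a b x y := by
  unfold ladderProb; positivity

theorem sum_ladderProb (q : ℝ) (x y : ℕ) : ∑ a, ∑ b, ladderProb q a b x y = 1 := by
  simp only [Fin.sum_univ_two, ladderProb_eq]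
  have hx := Real.sin_sq_add_cos_sq (ladderAngle q x)
  have hy := Real.sin_sq_add_cos_sq (ladderAngle q y)
  simp only [ladderCoord, if_true, one_ne_zero, if_false]
  set c := Real.cos (ladderAngle q x)
  set s := Real.sin (ladderAngle q x)
  set c' := Real.cos (ladderAngle q y)
  set s' := Real.sin (ladderAngle q y)
  have h : (0 : ℝ) < 1 + q ^ 2 := by positivity
  rw [← add_div, ← add_div, ← add_div, div_eq_one_iff_eq h.ne']
  have e : (1 + q ^ 2) = (s ^ 2 + c ^ 2) * (s' ^ 2 + c' ^ 2) * (1 + q ^ 2) := by rw [hx, hy]; ring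
  rw [e]
  ring

theorem cos_ladderAngle_pos (q : ℝ) (k : ℕ) : 0 < Real.cos (ladderAngle q k) :=
  Real.cos_arctan_pos _

theorem sin_ladderAngle (q : ℝ) (k : ℕ) : Real.sin (ladderAngle q k) =
    (-1) ^ k * q ^ k * Real.sqrt q * Real.cos (ladderAngle q k) := by
  have h := Real.tan_arctan ((-1) ^ k * q ^ k * Real.sqrt q)
  rw [Real.tan_eq_sin_div_cos, div_eq_iff (Real.cos_arctan_pos _).ne'] at h
  exact h

/-- The angles satisfy tan a_(k+1) = -q tan a_k, which makes the amplitude vanish. -/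
theorem ladderProb_zero_one (q : ℝ) (k : ℕ) : ladderProb q 0 1 (k + 1) k = 0 := by
  rw [ladderProb_eq]
  simp only [ladderCoord, if_true, one_ne_zero, if_false, sin_ladderAngle]
  rw [div_eq_zero_iff, sq_eq_zero_iff]
  left; ring

theorem ladderProb_one_zero (q : ℝ) (k : ℕ) : ladderProb q 1 0 k (k + 1) = 0 := by
  rw [ladderProb_eq]
  simp only [ladderCoord, if_true, one_ne_zero, if_false, sin_ladderAngle]
  rw [div_eq_zero_iff, sq_eq_zero_iff]
  left; ring

/-- The amplitude is proportional to q - tan² a_0, and tan² a_0 = q. -/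
theorem ladderProb_zero_zero {q : ℝ} (hq : 0 ≤ q) : ladderProb q 0 0 0 0 = 0 := by
  rw [ladderProb_eq]
  simp only [ladderCoord, if_true, sin_ladderAngle]
  rw [div_eq_zero_iff, sq_eq_zero_iff]
  left
  have := Real.mul_self_sqrt hq
  linear_combination (-(Real.cos (ladderAngle q 0)) ^ 2) * this

/-- The ladder correlations satisfy the Hardy conditions. -/
theorem BH_mul_ladderProb {p : Params} {q : ℝ} (hq : 0 ≤ q) (a b : Bit) (x y : Setting p) :
    BH p a b x y * ladderProb q a b x y = 0 := by
  unfold BH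
  split_ifs with h
  · rcases h with ⟨h, rfl, rfl⟩ | ⟨h, rfl, rfl⟩ | ⟨h, h', rfl, rfl⟩
    · rw [h, ladderProb_zero_one, mul_zero]
    · rw [h, ladderProb_one_zero, mul_zero]
    · rw [h, h', ladderProb_zero_zero hq, mul_zero]
  · simp

/-- The Hardy probability is close to `1 / 2` if `q` is close to `1` and `q ^ (2 * k)` is close
to `0`. -/
theorem ladderProb_ge {q : ℝ} (hq0 : 0 ≤ q) (hq1 : q ≤ 1) (k : ℕ) :
    1 / 2 - (1 - q) - 2 * q ^ (2 * k) ≤ ladderProb q 0 0 k k := by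
  rw [ladderProb_eq]
  simp only [ladderCoord, if_true, sin_ladderAngle]
  set c := Real.cos (ladderAngle q k) with hc
  have hcpos : 0 < c := cos_ladderAngle_pos q k
  have hs := sin_ladderAngle q k
  have hsq := Real.mul_self_sqrt hq0
  have h1 := Real.sin_sq_add_cos_sq (ladderAngle q k)
  have hm : ((-1 : ℝ) ^ k) ^ 2 = 1 := by rw [← pow_mul, mul_comm, pow_mul]; simp
  set d := q ^ (2 * k) with hd
  have hd0 : 0 ≤ d := by positivity
  have hd1 : d ≤ 1 := pow_le_one₀ hq0 hq1
  have hdk : d = q ^ k * q ^ k := by rw [hd, two_mul, pow_add]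
  have hs2 : Real.sin (ladderAngle q k) ^ 2 = d * q * c ^ 2 := by
    rw [hs, hdk]
    linear_combination (q ^ k * q ^ k * Real.sqrt q ^ 2 * c ^ 2) * hm + (q ^ k * q ^ k * c ^ 2) * hsq
  have hc2 : c ^ 2 * (1 + d * q) = 1 := by rw [hs2, ← hc] at h1; linarith
  -- With d = q^(2k), tan² a_k = dq, so the amplitude before normalization is q(1-d)/(1+dq), at
  -- least q(1-d)². As d tends to 0 and q to 1, its square divided by 1 + q² tends to 1/2.
  have e1 : q * (c * c) - (-1) ^ k * q ^ k * Real.sqrt q * c * ((-1) ^ k * q ^ k * Real.sqrt q * c) =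
      q * (1 - d) * c ^ 2 := by
    rw [hdk]
    linear_combination (-(q ^ k * q ^ k * Real.sqrt q ^ 2 * c ^ 2)) * hm -
      (q ^ k * q ^ k * c ^ 2) * hsq
  rw [e1]
  have hc2' : 1 - d ≤ c ^ 2 := by
    have : c ^ 2 ≤ 1 := by nlinarith [mul_nonneg hd0 hq0, sq_nonneg c]
    nlinarith [mul_nonneg hd0 hq0, sq_nonneg c]
  have hlow : q * (1 - d) * (1 - d) ≤ q * (1 - d) * c ^ 2 :=
    mul_le_mul_of_nonneg_left hc2' (mul_nonneg hq0 (by linarith))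
  have hlow2 : (q * (1 - d) * (1 - d)) ^ 2 ≤ (q * (1 - d) * c ^ 2) ^ 2 :=
    pow_le_pow_left₀ (mul_nonneg (mul_nonneg hq0 (by linarith)) (by linarith)) hlow 2
  rw [le_div_iff₀ (by positivity)]
  have hb : 1 - 4 * d ≤ (1 - d) ^ 4 := by
    have := one_add_mul_le_pow (show (-2 : ℝ) ≤ -d by linarith) 4
    norm_num at this
    rw [sub_eq_add_neg 1 d]
    linarith
  have hq2 : q ^ 2 * (1 - 4 * d) ≤ q ^ 2 * (1 - d) ^ 4 := mul_le_mul_of_nonneg_left hb (sq_nonneg q)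
  have hexp : (q * (1 - d) * (1 - d)) ^ 2 = q ^ 2 * (1 - d) ^ 4 := by ring
  nlinarith [mul_nonneg hd0 (sq_nonneg q), mul_nonneg hq0 (sub_nonneg.2 hq1),
    mul_nonneg hd0 (show 0 ≤ 1 - q ^ 2 by nlinarith),
    mul_nonneg (sub_nonneg.2 hq1) (sq_nonneg q)]

/-- The optimal Hardy probability tends to `1 / 2`. -/
theorem IsOptimalLadder.ladderProb_ge {m : ℕ} (hm : 1 ≤ m) {q : ℝ} (hq : IsOptimalLadder m q) :
    1 / 2 - 2 * (m + 1) / 2 ^ m ≤ ladderProb q 0 0 (2 ^ m - 1) (2 ^ m - 1) := by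
  -- The trial state q = 1 - s balances the two losses: 1 - q = s, while q^(2N) ≤ exp(-(m+1)) ≤
  -- 2^(-(m+1)).
  set s : ℝ := (m + 1) / 2 ^ m with hs
  have h2 : (0 : ℝ) < 2 ^ m := by positivity
  have hs0 : 0 ≤ s := by positivity
  have hs1 : s ≤ 1 := by
    rw [hs, div_le_one h2]
    exact_mod_cast Nat.succ_le_of_lt (Nat.lt_two_pow_self (n := m))
  refine le_trans ?_ (hq.2 (show (1 - s) ∈ Set.Icc (0 : ℝ) 1 by constructor <;> linarith))
  refine le_trans ?_ (PublicSV.ladderProb_ge (by linarith) (by linarith) _)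
  have h3 : (1 - s) ^ (2 * (2 ^ m - 1)) ≤ 1 / 2 ^ (m + 1) := by
    have h4 : 2 ^ m ≤ 2 * (2 ^ m - 1) := by
      have : 2 ^ 1 ≤ 2 ^ m := Nat.pow_le_pow_right (by norm_num) hm
      omega
    calc (1 - s) ^ (2 * (2 ^ m - 1)) ≤ (1 - s) ^ 2 ^ m :=
          pow_le_pow_of_le_one (by linarith) (by linarith) h4
      _ ≤ Real.exp (-s) ^ 2 ^ m := pow_le_pow_left₀ (by linarith) (Real.one_sub_le_exp_neg s) _
      _ = Real.exp (-1) ^ (m + 1) := by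
          rw [← Real.exp_nat_mul, ← Real.exp_nat_mul]
          congr 1
          push_cast
          rw [hs]
          field_simp
      _ ≤ (1 / 2) ^ (m + 1) := by
          refine pow_le_pow_left₀ (Real.exp_pos _).le ?_ _
          rw [Real.exp_neg, ← one_div]
          exact one_div_le_one_div_of_le two_pos (by have := Real.add_one_le_exp (1 : ℝ); linarith)
      _ = 1 / 2 ^ (m + 1) := by rw [one_div_pow]
  have h5 : 2 * (1 / (2 : ℝ) ^ (m + 1)) = 1 / 2 ^ m := by rw [pow_succ]; field_simp
  have h6 : 1 / (2 : ℝ) ^ m ≤ s := by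
    rw [hs]
    exact div_le_div_of_nonneg_right (by linarith [Nat.cast_nonneg (α := ℝ) m]) h2.le
  have h7 : 2 * (m + 1) / (2 : ℝ) ^ m = 2 * s := by rw [hs]; ring
  rw [h7]
  linarith

end LadderCorrelations

/-! ### Devices that behave as quantum theory predicts -/

section ProductLaw

variable {p : Params}

theorem sum_prod_outcomes (f : Fin p.M → Bit → Bit → ℝ) :
    ∑ o : Outcomes p, ∏ i, f i (o.1 i) (o.2 i) = ∏ i, ∑ a, ∑ b, f i a b := by
  simp only [← Fintype.sum_prod_type' (fun a b => f _ a b)]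
  rw [Finset.prod_univ_sum, Fintype.piFinset_univ]
  exact (Fintype.sum_equiv (Equiv.arrowProdEquivProdArrow (Fin p.M) (fun _ => Bit) fun _ => Bit)
    _ _ fun c => rfl).symm

theorem sum_prod_mul_mul (f : Fin p.M → Bit → Bit → ℝ) (hf : ∀ i, ∑ a, ∑ b, f i a b = 1)
    (g : Bit → Bit → ℝ) {r s : Fin p.M} (hrs : r ≠ s) :
    ∑ o : Outcomes p, (∏ i, f i (o.1 i) (o.2 i)) * (g (o.1 r) (o.2 r) * g (o.1 s) (o.2 s)) =
      (∑ a, ∑ b, f r a b * g a b) * ∑ a, ∑ b, f s a b * g a b := by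
  have h1 : ∀ o : Outcomes p,
      (∏ i, f i (o.1 i) (o.2 i)) * (g (o.1 r) (o.2 r) * g (o.1 s) (o.2 s)) =
      ∏ i, f i (o.1 i) (o.2 i) * ((if i = r then g (o.1 i) (o.2 i) else 1) *
        (if i = s then g (o.1 i) (o.2 i) else 1)) := fun o => by
    simp only [Finset.prod_mul_distrib, Finset.prod_ite_eq', Finset.mem_univ, if_true]
  simp only [h1]
  rw [sum_prod_outcomes fun i a b => f i a b * ((if i = r then g a b else 1) *
    (if i = s then g a b else 1))]
  have h2 : ∀ i, ∑ a, ∑ b, f i a b * ((if i = r then g a b else 1) *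
      (if i = s then g a b else 1)) =
      (if i = r then ∑ a, ∑ b, f i a b * g a b else 1) *
        (if i = s then ∑ a, ∑ b, f i a b * g a b else 1) := by
    intro i
    by_cases hr : i = r
    · subst hr
      simp only [hrs, if_true, if_false, mul_one]
    · by_cases hs : i = s
      · subst hs
        simp only [hr, if_true, if_false, one_mul]
      · simp only [hr, hs, if_false, mul_one, hf]
  simp only [h2, Finset.prod_mul_distrib, Finset.prod_ite_eq', Finset.mem_univ, if_true]

theorem sum_prod_mul (f : Fin p.M → Bit → Bit → ℝ) (hf : ∀ i, ∑ a, ∑ b, f i a b = 1)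
    (g : Bit → Bit → ℝ) (r : Fin p.M) :
    ∑ o : Outcomes p, (∏ i, f i (o.1 i) (o.2 i)) * g (o.1 r) (o.2 r) =
      ∑ a, ∑ b, f r a b * g a b := by
  have h1 : ∀ o : Outcomes p, (∏ i, f i (o.1 i) (o.2 i)) * g (o.1 r) (o.2 r) =
      ∏ i, f i (o.1 i) (o.2 i) * (if i = r then g (o.1 i) (o.2 i) else 1) := fun o => by
    simp only [Finset.prod_mul_distrib, Finset.prod_ite_eq', Finset.mem_univ, if_true]
  simp only [h1]
  rw [sum_prod_outcomes fun i a b => f i a b * (if i = r then g a b else 1)]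
  have h2 : ∀ i, ∑ a, ∑ b, f i a b * (if i = r then g a b else 1) =
      (if i = r then ∑ a, ∑ b, f i a b * g a b else 1) := by
    intro i
    by_cases hr : i = r
    · simp only [hr, if_true]
    · simp only [hr, if_false, mul_one, hf]
  simp only [h2, Finset.prod_ite_eq', Finset.mem_univ, if_true]

end ProductLaw

/-! ### Tests and biases for the ladder correlations -/

section Quantum

variable {p : Params} {W Z E : Type} [Fintype W] [Fintype E] {ε : ℝ} {P : Box p W Z E}

theorem sum_ladderProb_mul_hardy (q : ℝ) (x y : ℕ) :
    ∑ a : Bit, ∑ b : Bit, ladderProb q a b x y * (if a = 0 ∧ b = 0 then 1 else 0) =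
      ladderProb q 0 0 x y := by
  simp [Fin.sum_univ_two]

theorem coe_eq_of_mem_SHnz {x y : Inputs p} {r : Fin p.M} (hr : r ∈ SHnz p x y) :
    (x r : ℕ) = 2 ^ p.m - 1 ∧ (y r : ℕ) = 2 ^ p.m - 1 := by
  simp only [SHnz, Finset.mem_filter, Finset.mem_univ, true_and] at hr
  omega

variable {q : ℝ} {z : Z} {x y : Inputs p}

theorem sum_devAB_mul_hardyInd
    (hD : ∀ o, devAB P z x y o = ∏ i, ladderProb q (o.1 i) (o.2 i) (x i) (y i))
    {r : Fin p.M} (hr : r ∈ SHnz p x y) :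
    ∑ o, devAB P z x y o * hardyInd r o = ladderProb q 0 0 (2 ^ p.m - 1) (2 ^ p.m - 1) := by
  simp only [hD]
  have := sum_prod_mul (fun i a b => ladderProb q a b (x i) (y i))
    (fun i => sum_ladderProb q _ _) (fun a b => if a = 0 ∧ b = 0 then 1 else 0) r
  rw [sum_ladderProb_mul_hardy, (coe_eq_of_mem_SHnz hr).1, (coe_eq_of_mem_SHnz hr).2] at this
  exact this

/-- The tests are passed with high probability if the cardinality checks are passed. -/
theorem sum_not_tests_le (hP : Admissible ε P) (hq : 0 ≤ q)
    (hD : ∀ o, devAB P z x y o = ∏ i, ladderProb q (o.1 i) (o.2 i) (x i) (y i))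
    (hδ₁ : 0 ≤ p.δ₁) (hδ₂ : 0 < p.δ₂)
    (hopt : 1 / 2 - p.δ₂ / 2 ≤ ladderProb q 0 0 (2 ^ p.m - 1) (2 ^ p.m - 1))
    (hs : 0 < (SHnz p x y).card) [DecidablePred fun o : Outcomes p => ¬ Tests p o.1 o.2 x y] :
    (∑ o : Outcomes p, if ¬ Tests p o.1 o.2 x y then devAB P z x y o else 0) ≤
      4 / ((SHnz p x y).card * p.δ₂ ^ 2) := by
  classical
  set h := ladderProb q 0 0 (2 ^ p.m - 1) (2 ^ p.m - 1) with hh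
  set L : ℝ := ((SHnz p x y).card : ℝ) with hL
  have hL0 : 0 < L := by rw [hL]; exact_mod_cast hs
  have hh1 : h ≤ 1 := by
    have := sum_ladderProb q (2 ^ p.m - 1) (2 ^ p.m - 1)
    simp only [Fin.sum_univ_two] at this
    have h1 := ladderProb_nonneg q 0 1 (2 ^ p.m - 1) (2 ^ p.m - 1)
    have h2 := ladderProb_nonneg q 1 0 (2 ^ p.m - 1) (2 ^ p.m - 1)
    have h3 := ladderProb_nonneg q 1 1 (2 ^ p.m - 1) (2 ^ p.m - 1)
    linarith
  have hZH : ∀ o, devAB P z x y o ≠ 0 → ZH p o.1 o.2 x y = 0 := by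
    intro o ho
    rw [hD, Finset.prod_ne_zero_iff] at ho
    unfold ZH
    rw [Finset.sum_eq_zero fun i _ => (mul_eq_zero.1 (BH_mul_ladderProb hq _ _ _ _)).resolve_right
      (ho i (Finset.mem_univ i)), zero_div]
  have hle : ∀ o, (if ¬ Tests p o.1 o.2 x y then devAB P z x y o else 0) ≤
      if ZHnz p o.1 o.2 x y < 1 / 2 - p.δ₂ then devAB P z x y o else 0 := by
    intro o
    by_cases h0 : devAB P z x y o = 0
    · simp [h0]
    · have h1 := hZH o h0
      have h2 : ¬ Tests p o.1 o.2 x y ↔ ZHnz p o.1 o.2 x y < 1 / 2 - p.δ₂ := by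
        unfold Tests; rw [h1]; simp only [hδ₁, true_and, not_le]
      simp only [h2, le_refl]
  refine (Finset.sum_le_sum fun o _ => hle o).trans ?_
  -- The mean is at least (1/2 - δ₂/2)L, whereas failure means a count below (1/2 - δ₂)L; the
  -- deviation is thus at least Lδ₂/2.
  have hch := chebyshev_count (D := devAB P z x y) (devAB_nonneg hP z x y) (sum_devAB hP z x y)
    (fun r => hardyInd r) (SHnz p x y) (q := h) (d := L * (p.δ₂ / 2)) (by positivity)
    (fun r _ o => by unfold hardyInd; split_ifs <;> simp)
    (fun r hr => sum_devAB_mul_hardyInd hD hr)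
    (fun r hr s hs hrs => by
      simp only [hD]
      have := sum_prod_mul_mul (fun i a b => ladderProb q a b (x i) (y i))
        (fun i => sum_ladderProb q _ _) (fun a b => if a = 0 ∧ b = 0 then 1 else 0) hrs
      rw [sum_ladderProb_mul_hardy, sum_ladderProb_mul_hardy, (coe_eq_of_mem_SHnz hr).1,
        (coe_eq_of_mem_SHnz hr).2, (coe_eq_of_mem_SHnz hs).1, (coe_eq_of_mem_SHnz hs).2] at this
      exact this)
    (fun o => ZHnz p o.1 o.2 x y < 1 / 2 - p.δ₂) (fun o ho => by
      unfold ZHnz at ho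
      rw [sum_BHnz x y o, div_lt_iff₀ hL0] at ho
      rw [abs_sub_comm]
      refine le_trans ?_ (le_abs_self _)
      rw [← hL]
      nlinarith)
  refine hch.trans ?_
  rw [← hL, div_le_div_iff₀ (by positivity) (by positivity)]
  have : 0 ≤ (1 - h) * (L ^ 2 * p.δ₂ ^ 2) := mul_nonneg (by linarith) (by positivity)
  nlinarith

/-- For a device that satisfies the Hardy conditions, no adversary can predict the output. -/
theorem sum_abs_bias_quantum_le (hP : Admissible ε P) (hq : 0 ≤ q)
    (hD : ∀ x y o, devAB P z x y o = ∏ i, ladderProb q (o.1 i) (o.2 i) (x i) (y i))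
    {r : Fin p.M} (hr : r ∈ SHnz p x y)
    [DecidablePred fun o : Outcomes p => ¬ Tests p o.1 o.2 x y] :
    ∑ w, |bias P w x y z r| ≤ 1 - 2 * ladderProb q 0 0 (2 ^ p.m - 1) (2 ^ p.m - 1) +
      ∑ o : Outcomes p, if ¬ Tests p o.1 o.2 x y then devAB P z x y o else 0 := by
  classical
  set B : W → ℝ := fun w => 2 * (∑ o : Outcomes p, dev P o.1 o.2 w x y z * hardyInd r o) -
    ∑ o : Outcomes p, dev P o.1 o.2 w x y z with hB
  set V : W → ℝ := fun w => ∑ ξ, ∑ υ, ∑ o : Outcomes p,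
    dev P o.1 o.2 w (Function.update x r ξ) (Function.update y r υ) z *
      BH p (o.1 r) (o.2 r) ξ υ with hV
  have hV0 : ∀ w, 0 ≤ V w := fun w => Finset.sum_nonneg fun ξ _ => Finset.sum_nonneg fun υ _ =>
    Finset.sum_nonneg fun o _ => mul_nonneg (dev_nonneg hP _ _ _ _ _ _) (BH_nonneg _ _ _ _)
  have hBV : ∀ w, B w ≤ V w := by
    intro w
    have hone : IsClassFun (agreeRuns p r) fun _ => (1 : ℝ) := fun _ _ _ => rfl
    have htot : ∀ f : Outcomes p → ℝ, ∑ o, f o =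
        ∑ o, 1 / classSum (agreeRuns p r) (fun _ => 1) o * classSum (agreeRuns p r) f o := fun f => by
      rw [sum_div_card_mul_classSum hone]; simp
    simp only [hB, hV]
    rw [htot, htot fun o : Outcomes p => dev P o.1 o.2 w x y z, Finset.mul_sum,
      ← Finset.sum_sub_distrib]
    simp only [htot fun o : Outcomes p => dev P o.1 o.2 w _ _ z * BH p (o.1 r) (o.2 r) _ _]
    rw [Finset.sum_congr rfl fun ξ _ => Finset.sum_comm, Finset.sum_comm]
    refine Finset.sum_le_sum fun o _ => ?_
    simp only [← Finset.mul_sum]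
    have hl := ladder_inequality_run hP w z x y r (eq_of_mem_SHnz hr) o
    have := mul_le_mul_of_nonneg_left hl
      (one_div_pos.2 (classSum_one_pos (R := agreeRuns p r) o)).le
    refine le_trans (le_of_eq ?_) this
    ring
  -- Summed over w, the product law contains the factor of run r, which vanishes on forbidden
  -- events.
  have hVs : ∑ w, V w = 0 := by
    simp only [hV]
    rw [Finset.sum_comm]
    refine Finset.sum_eq_zero fun ξ _ => ?_
    rw [Finset.sum_comm]
    refine Finset.sum_eq_zero fun υ _ => ?_
    rw [Finset.sum_comm]
    refine Finset.sum_eq_zero fun o _ => ?_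
    rw [← Finset.sum_mul]
    have := hD (Function.update x r ξ) (Function.update y r υ) o
    unfold devAB at this
    rw [this, mul_comm, ← Finset.mul_prod_erase _ _ (Finset.mem_univ r), ← mul_assoc]
    simp only [Function.update_self]
    rw [BH_mul_ladderProb hq, zero_mul]
  have hBs : ∑ w, B w = 2 * ladderProb q 0 0 (2 ^ p.m - 1) (2 ^ p.m - 1) - 1 := by
    simp only [hB, Finset.sum_sub_distrib, ← Finset.mul_sum, sum_dev hP]
    rw [← sum_devAB_mul_hardyInd (hD x y) hr, Finset.sum_comm]
    simp only [devAB, Finset.sum_mul]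
  have hbias : ∀ w, |bias P w x y z r| ≤ 2 * V w - B w +
      ∑ o : Outcomes p, if ¬ Tests p o.1 o.2 x y then dev P o.1 o.2 w x y z else 0 := by
    intro w
    have e1 : bias P w x y z r = B w -
        ∑ o : Outcomes p, if ¬ Tests p o.1 o.2 x y then
          dev P o.1 o.2 w x y z * (2 * hardyInd r o - 1) else 0 := by
      simp only [bias, hB, Finset.mul_sum]
      rw [← Finset.sum_sub_distrib, ← Finset.sum_sub_distrib]
      refine Finset.sum_congr rfl fun o _ => ?_
      by_cases hT : Tests p o.1 o.2 x y
      · simp [hT]; ring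
      · simp [hT]; ring
    -- Since B ≤ V and V ≥ 0, the absolute value is bounded by an expression linear in B, whose sum
    -- over w is known.
    have e2 : |B w| ≤ 2 * V w - B w := by
      rw [abs_le]; constructor <;> linarith [hV0 w, hBV w]
    rw [e1]
    refine (abs_sub _ _).trans (add_le_add e2 ?_)
    refine (Finset.abs_sum_le_sum_abs _ _).trans (Finset.sum_le_sum fun o _ => ?_)
    split_ifs
    · simp
    · rw [abs_mul, abs_of_nonneg (dev_nonneg hP _ _ _ _ _ _)]
      refine mul_le_of_le_one_right (dev_nonneg hP _ _ _ _ _ _) ?_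
      rw [abs_le]
      constructor <;> linarith [hardyInd_nonneg r o, hardyInd_le_one r o]
  refine (Finset.sum_le_sum fun w _ => hbias w).trans ?_
  rw [Finset.sum_add_distrib, Finset.sum_sub_distrib, ← Finset.mul_sum, hVs, hBs, Finset.sum_comm]
  refine add_le_add (by linarith) (Finset.sum_le_sum fun o _ => ?_)
  unfold devAB
  split_ifs <;> simp

/-- The composable distance for a device that behaves as quantum theory predicts. -/
theorem dComp_le_of_quantum [Nonempty Z] (hP : Admissible ε P) (hq : 0 ≤ q)
    (hD : ∀ z x y o, devAB P z x y o = ∏ i, ladderProb q (o.1 i) (o.2 i) (x i) (y i))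
    (hM : 0 < p.M) (hδ₁ : 0 ≤ p.δ₁) (hδ₂ : 0 < p.δ₂)
    (hopt : 1 / 2 - p.δ₂ / 2 ≤ ladderProb q 0 0 (2 ^ p.m - 1) (2 ^ p.m - 1))
    {A : ℝ} (hA : 0 < A) (hacc : ∀ z, accProb P z = A) {ℓ : ℝ} (hℓ0 : 0 < ℓ)
    (hℓ : ∀ x y, SizeCheck p x y → ℓ ≤ ((SHnz p x y).card : ℝ)) :
    dComp P ≤ (p.δ₂ + 4 / (ℓ * p.δ₂ ^ 2)) / A := by
  classical
  obtain ⟨Q, hQ, hQ1, -, hPQ⟩ := exists_source hP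
  set b : ℝ := p.δ₂ + 4 / (ℓ * p.δ₂ ^ 2) with hb
  have hb0 : 0 ≤ b := by positivity
  refine (dComp_le hQ hPQ hM hA hacc
    (fun x y e => (∑ t, if settingA p t = x ∧ settingB p t = y then Q t e else 0) * b)
    (fun x y e => mul_nonneg (Finset.sum_nonneg fun t _ => by split_ifs <;> simp [hQ]) hb0)
    ?_).trans (le_of_eq ?_)
  · intro x y e z hs
    rw [Finset.sum_comm, Finset.sum_mul]
    refine Finset.sum_le_sum fun t _ => ?_
    split_ifs with hxy
    · obtain ⟨r, hr, hrt⟩ := exists_selRun hM hs t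
      simp only [hrt, Option.elim_some, ← Finset.mul_sum]
      refine mul_le_mul_of_nonneg_left ?_ (hQ t e)
      refine (sum_abs_bias_quantum_le hP hq (hD z) hr).trans ?_
      have h1 := sum_not_tests_le hP hq (hD z x y) hδ₁ hδ₂ hopt (card_SHnz_pos hM hs)
      have h2 : 4 / ((SHnz p x y).card * p.δ₂ ^ 2) ≤ 4 / (ℓ * p.δ₂ ^ 2) :=
        div_le_div_of_nonneg_left (by norm_num) (by positivity)
          (mul_le_mul_of_nonneg_right (hℓ x y hs) (by positivity))
      simp only [hb]
      linarith
    · simp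
  · congr 1
    rw [Finset.sum_congr rfl fun x _ => Finset.sum_comm, Finset.sum_comm,
      Finset.sum_congr rfl fun e _ =>
        sum_settings_eq (fun t => Q t e) (fun _ => b) (fun _ _ => b) fun t => rfl]
    rw [Finset.sum_comm]
    simp only [← Finset.sum_mul, hQ1, one_mul]

open Classical in
theorem eventProb_not_tests_le [Nonempty Z] (hP : Admissible ε P) (hq : 0 ≤ q)
    (hD : ∀ z x y o, devAB P z x y o = ∏ i, ladderProb q (o.1 i) (o.2 i) (x i) (y i))
    (hM : 0 < p.M) (hδ₁ : 0 ≤ p.δ₁) (hδ₂ : 0 < p.δ₂)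
    (hopt : 1 / 2 - p.δ₂ / 2 ≤ ladderProb q 0 0 (2 ^ p.m - 1) (2 ^ p.m - 1))
    {ℓ : ℝ} (hℓ0 : 0 < ℓ) (hℓ : ∀ x y, SizeCheck p x y → ℓ ≤ ((SHnz p x y).card : ℝ)) (z : Z) :
    eventProb P z (fun a b t => SizeCheck p (settingA p t) (settingB p t) ∧
      ¬ Tests p a b (settingA p t) (settingB p t)) ≤ 4 / (ℓ * p.δ₂ ^ 2) := by
  obtain ⟨Q, hQ, hQ1, -, hPQ⟩ := exists_source hP
  rw [eventProb_eq hPQ]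
  have hb0 : 0 ≤ 4 / (ℓ * p.δ₂ ^ 2) := by positivity
  calc _ ≤ ∑ t, ∑ e, Q t e * (4 / (ℓ * p.δ₂ ^ 2)) := by
        refine Finset.sum_le_sum fun t _ => Finset.sum_le_sum fun e _ =>
          mul_le_mul_of_nonneg_left ?_ (hQ t e)
        by_cases hs : SizeCheck p (settingA p t) (settingB p t)
        · have h1 := sum_not_tests_le hP hq (hD z (settingA p t) (settingB p t)) hδ₁ hδ₂ hopt
            (card_SHnz_pos hM hs)
          have h2 : 4 / ((SHnz p (settingA p t) (settingB p t)).card * p.δ₂ ^ 2) ≤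
              4 / (ℓ * p.δ₂ ^ 2) :=
            div_le_div_of_nonneg_left (by norm_num) (by positivity)
              (mul_le_mul_of_nonneg_right (hℓ _ _ hs) (by positivity))
          simp only [hs, true_and]
          exact h1.trans h2
        · simp [hs, hb0]
    _ = 4 / (ℓ * p.δ₂ ^ 2) := by simp only [← Finset.sum_mul, hQ1, one_mul]

end Quantum

/-! ### Cardinality checks with an unbiased source -/

section Unbiased

variable {p : Params} {E : Type} {Q : Str p → E → ℝ}

open Classical in
-- Each of the n² pairs of settings has at least its share n⁻² of the total. These lower bounds add
-- up to the total, so all of them are equalities.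
theorem sum_ite_settings_eq (hQ : ∀ t e, 0 ≤ Q t e) (hSV : IsSV 0 Q) (e : E) (r : Fin p.M)
    {φ : Str p → ℝ} (hφ : IsClassFun (agree Bit ((r : ℕ) * (2 * p.m))) φ) (hφ0 : ∀ t, 0 ≤ φ t)
    (ξ υ : Setting p) :
    (∑ t, if settingA p t r = ξ ∧ settingB p t r = υ then Q t e * φ t else 0) =
      1 / (2 ^ p.m * 2 ^ p.m) * ∑ t, Q t e * φ t := by
  have hpow : (1 / 2 - 0 : ℝ) ^ (2 * p.m) = 1 / (2 ^ p.m * 2 ^ p.m) := by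
    rw [sub_zero, one_div_pow, two_mul, pow_add]
  have hle : ∀ s ∈ (Finset.univ : Finset (Setting p × Setting p)),
      1 / (2 ^ p.m * 2 ^ p.m) * ∑ t, Q t e * φ t ≤
        ∑ t, if settingA p t r = s.1 ∧ settingB p t r = s.2 then Q t e * φ t else 0 := fun s _ => by
    rw [← hpow]
    exact sum_ite_settings_ge hQ hSV (by norm_num) e r hφ hφ0 s.1 s.2
  have hsum : ∑ _s : Setting p × Setting p, 1 / (2 ^ p.m * 2 ^ p.m) * ∑ t, Q t e * φ t =
      ∑ s : Setting p × Setting p,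
        ∑ t, if settingA p t r = s.1 ∧ settingB p t r = s.2 then Q t e * φ t else 0 := by
    rw [Finset.sum_comm]
    have : ∀ t, (∑ s : Setting p × Setting p,
        if settingA p t r = s.1 ∧ settingB p t r = s.2 then Q t e * φ t else 0) = Q t e * φ t := by
      intro t
      rw [Finset.sum_eq_single (settingA p t r, settingB p t r)]
      · simp
      · rintro ⟨ξ, υ⟩ _ hne
        rw [if_neg]
        rintro ⟨rfl, rfl⟩
        exact hne rfl
      · simp
    simp only [this, Finset.sum_const, Finset.card_univ, Fintype.card_prod, Fintype.card_fin,
      nsmul_eq_mul]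
    push_cast
    field_simp
  exact (((Finset.sum_eq_sum_iff_of_le hle).1 hsum) (ξ, υ) (Finset.mem_univ _)).symm

theorem sum_mul_settingFun (hQ : ∀ t e, 0 ≤ Q t e) (hSV : IsSV 0 Q) (e : E) (r : Fin p.M)
    {φ : Str p → ℝ} (hφ : IsClassFun (agree Bit ((r : ℕ) * (2 * p.m))) φ) (hφ0 : ∀ t, 0 ≤ φ t)
    (H : Setting p → Setting p → ℝ) :
    ∑ t, Q t e * (φ t * H (settingA p t r) (settingB p t r)) =
      (∑ ξ, ∑ υ, H ξ υ) / (2 ^ p.m * 2 ^ p.m) * ∑ t, Q t e * φ t := by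
  classical
  calc ∑ t, Q t e * (φ t * H (settingA p t r) (settingB p t r))
      = ∑ ξ, ∑ υ, (∑ t, if settingA p t r = ξ ∧ settingB p t r = υ then Q t e * φ t else 0) *
          H ξ υ := by
        simp only [Finset.sum_mul]
        rw [Finset.sum_congr rfl fun ξ _ => Finset.sum_comm, Finset.sum_comm]
        refine Finset.sum_congr rfl fun t _ => ?_
        rw [Finset.sum_eq_single (settingA p t r), Finset.sum_eq_single (settingB p t r)]
        · simp only [and_self, if_true]; ring
        · intro y _ hy; simp [hy.symm]
        · simp
        · intro x _ hx; simp [hx.symm]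
        · simp
    _ = ∑ ξ, ∑ υ, 1 / (2 ^ p.m * 2 ^ p.m) * (∑ t, Q t e * φ t) * H ξ υ := by
        simp only [sum_ite_settings_eq hQ hSV e r hφ hφ0]
    _ = _ := by
        simp only [← Finset.mul_sum]
        ring

open Classical in
/-- Chebyshev's inequality for the number of runs whose settings belong to a given set. -/
theorem chebyshev_settings [Fintype E] (hQ : ∀ t e, 0 ≤ Q t e) (hQ1 : ∑ t, ∑ e, Q t e = 1)
    (hSV : IsSV 0 Q) (H : Setting p → Setting p → ℝ) (hH0 : ∀ ξ υ, 0 ≤ H ξ υ)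
    (hH2 : ∀ ξ υ, H ξ υ ^ 2 = H ξ υ) {h d : ℝ} (hh : (∑ ξ, ∑ υ, H ξ υ) / (2 ^ p.m * 2 ^ p.m) = h)
    (hd : 0 < d) (ev : Str p → Prop)
    (hev : ∀ t, ev t → d ≤ |∑ r, H (settingA p t r) (settingB p t r) - p.M * h|) :
    (∑ t, if ev t then ∑ e, Q t e else 0) ≤ p.M * h / d ^ 2 := by
  have hone : ∀ n, IsClassFun (agree Bit n : Setoid (Str p)) fun _ => (1 : ℝ) := fun _ _ _ _ => rfl
  have hmean : ∀ r : Fin p.M, ∀ e,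
      ∑ t, Q t e * H (settingA p t r) (settingB p t r) = h * ∑ t, Q t e := by
    intro r e
    have := sum_mul_settingFun hQ hSV e r (hone _) (fun _ => zero_le_one) H
    simpa only [one_mul, mul_one, hh] using this
  have hpair : ∀ r s : Fin p.M, r < s → ∀ e, ∑ t, Q t e * (H (settingA p t r) (settingB p t r) *
      H (settingA p t s) (settingB p t s)) = h * (h * ∑ t, Q t e) := by
    intro r s hrs e
    rw [← hmean r e, ← hh]
    exact sum_mul_settingFun hQ hSV e s
      (φ := fun t => H (settingA p t r) (settingB p t r))
      (fun t t' htt => by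
        simp only [(settings_eq_of_agree htt r hrs).1, (settings_eq_of_agree htt r hrs).2])
      (fun t => hH0 _ _) H
  have hsw : ∀ f : Str p → ℝ, ∑ t, (∑ e, Q t e) * f t = ∑ e, ∑ t, Q t e * f t := fun f => by
    simp only [Finset.sum_mul]
    exact Finset.sum_comm
  have htot : ∑ e, ∑ t, Q t e = 1 := by rw [Finset.sum_comm]; exact hQ1
  have := chebyshev_count (D := fun t => ∑ e, Q t e)
    (fun t => Finset.sum_nonneg fun e _ => hQ t e) hQ1
    (fun (r : Fin p.M) t => H (settingA p t r) (settingB p t r)) Finset.univ (q := h) hd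
    (fun r _ t => hH2 _ _)
    (fun r _ => by
      rw [hsw]
      simp only [hmean, ← Finset.mul_sum, htot, mul_one])
    (fun r _ s _ hrs => by
      rw [hsw]
      rcases lt_or_gt_of_ne hrs with hlt | hlt
      · simp only [hpair r s hlt, ← Finset.mul_sum, htot, mul_one]
      · simp only [mul_comm (H (settingA p _ r) (settingB p _ r)), hpair s r hlt, ← Finset.mul_sum,
          htot, mul_one])
    ev (by simpa using hev)
  simpa using this

/-- Indicator of the settings of the ladder test. -/
def ladderInd (p : Params) (ξ υ : Setting p) : ℝ :=
  if (ξ : ℕ) = (υ : ℕ) + 1 ∨ (υ : ℕ) = (ξ : ℕ) + 1 ∨ ((ξ : ℕ) = 0 ∧ (υ : ℕ) = 0) ∨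
    ((ξ : ℕ) + 1 = 2 ^ p.m ∧ (υ : ℕ) + 1 = 2 ^ p.m) then 1 else 0

/-- Indicator of the last pair of settings. -/
def lastInd (p : Params) (ξ υ : Setting p) : ℝ :=
  if (ξ : ℕ) + 1 = 2 ^ p.m ∧ (υ : ℕ) + 1 = 2 ^ p.m then 1 else 0

theorem card_SH_eq (x y : Inputs p) : ((SH p x y).card : ℝ) = ∑ r, ladderInd p (x r) (y r) := by
  unfold SH ladderInd
  rw [Finset.card_filter]
  push_cast
  rfl

theorem card_SHnz_eq (x y : Inputs p) : ((SHnz p x y).card : ℝ) = ∑ r, lastInd p (x r) (y r) := by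
  unfold SHnz lastInd
  rw [Finset.card_filter]
  push_cast
  rfl

theorem sum_lastInd (p : Params) : ∑ ξ, ∑ υ, lastInd p ξ υ = 1 := by
  have hpos : 0 < 2 ^ p.m := by positivity
  let N : Setting p := ⟨2 ^ p.m - 1, by omega⟩
  have h : ∀ ξ υ : Setting p, ((ξ : ℕ) + 1 = 2 ^ p.m ∧ (υ : ℕ) + 1 = 2 ^ p.m) ↔ (ξ = N ∧ υ = N) := by
    intro ξ υ
    simp only [N, Fin.ext_iff]
    omega
  unfold lastInd
  simp only [h]
  rw [Finset.sum_eq_single N, Finset.sum_eq_single N]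
  · simp
  · intro υ _ hυ; simp [hυ]
  · simp
  · intro ξ _ hξ; simp [hξ]
  · simp

theorem sum_ladderInd (p : Params) (hm : 1 ≤ p.m) : ∑ ξ, ∑ υ, ladderInd p ξ υ = 2 * 2 ^ p.m := by
  have hpos : 2 ≤ 2 ^ p.m := by
    simpa using Nat.pow_le_pow_right (n := 2) (by norm_num) hm
  have hrow : ∀ ξ : Setting p, ∑ υ, ladderInd p ξ υ = 2 := by
    intro ξ
    have hξ := ξ.isLt
    -- Each row meets the ladder settings in exactly two points: the neighbours ξ-1 and ξ+1, with
    -- (0,0) and (N,N) replacing the missing ones at the two ends.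
    let l : Setting p := ⟨if (ξ : ℕ) = 0 then 0 else ξ - 1, by split_ifs <;> omega⟩
    let u : Setting p := ⟨if (ξ : ℕ) + 1 = 2 ^ p.m then 2 ^ p.m - 1 else ξ + 1, by
      split_ifs <;> omega⟩
    have hlu : l ≠ u := by
      intro h
      simp only [l, u, Fin.mk.injEq] at h
      split_ifs at h <;> omega
    have h : ∀ υ : Setting p, ((ξ : ℕ) = (υ : ℕ) + 1 ∨ (υ : ℕ) = (ξ : ℕ) + 1 ∨
        ((ξ : ℕ) = 0 ∧ (υ : ℕ) = 0) ∨ ((ξ : ℕ) + 1 = 2 ^ p.m ∧ (υ : ℕ) + 1 = 2 ^ p.m)) ↔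
        υ ∈ ({l, u} : Finset (Setting p)) := by
      intro υ
      have hυ := υ.isLt
      simp only [Finset.mem_insert, Finset.mem_singleton, l, u, Fin.ext_iff]
      split_ifs <;> omega
    unfold ladderInd
    simp only [h]
    rw [Finset.sum_ite_mem, Finset.univ_inter, Finset.sum_pair hlu]
    norm_num
  simp only [hrow, Finset.sum_const, Finset.card_univ, Fintype.card_fin, nsmul_eq_mul]
  push_cast
  ring

open Classical in
/-- With an unbiased source the cardinality checks are passed with high probability. -/
theorem sum_not_sizeCheck_le [Fintype E] (hQ : ∀ t e, 0 ≤ Q t e) (hQ1 : ∑ t, ∑ e, Q t e = 1)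
    (hSV : IsSV 0 Q) (hM : 0 < p.M) (hm : 1 ≤ p.m) :
    (∑ t, if ¬ SizeCheck p (settingA p t) (settingB p t) then ∑ e, Q t e else 0) ≤
      6 * (2 ^ p.m) ^ 2 / p.M := by
  have hM' : (0 : ℝ) < p.M := by exact_mod_cast hM
  have hn : (1 : ℝ) ≤ 2 ^ p.m := one_le_pow₀ (by norm_num)
  have h1 := chebyshev_settings hQ hQ1 hSV (ladderInd p)
    (fun ξ υ => by unfold ladderInd; split_ifs <;> simp)
    -- The expected size of S_H is 2M/n, the centre of the allowed interval, and d is its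
    -- half-width.
    (fun ξ υ => by unfold ladderInd; split_ifs <;> simp) (h := 2 / 2 ^ p.m) (d := p.M / 2 ^ p.m)
    (by rw [sum_ladderInd p hm]; field_simp) (by positivity)
    (fun t => ¬ ((SH p (settingA p t) (settingB p t)).card : ℝ) ∈
      Set.Icc ((p.M : ℝ) / 2 ^ p.m) (3 * (p.M : ℝ) / 2 ^ p.m)) (fun t ht => by
        rw [← card_SH_eq]
        by_contra hlt
        rw [not_le, abs_lt] at hlt
        apply ht
        have e1 : (p.M : ℝ) * (2 / 2 ^ p.m) = 2 * (p.M / 2 ^ p.m) := by ring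
        have e2 : 3 * (p.M : ℝ) / 2 ^ p.m = 3 * (p.M / 2 ^ p.m) := by ring
        rw [e1] at hlt
        rw [Set.mem_Icc, e2]
        constructor <;> linarith [hlt.1, hlt.2])
  have h2 := chebyshev_settings hQ hQ1 hSV (lastInd p)
    (fun ξ υ => by unfold lastInd; split_ifs <;> simp)
    (fun ξ υ => by unfold lastInd; split_ifs <;> simp) (h := 1 / (2 ^ p.m) ^ 2)
    (d := p.M / (2 * (2 ^ p.m) ^ 2))
    (by rw [sum_lastInd p]; ring) (by positivity)
    (fun t => ¬ ((SHnz p (settingA p t) (settingB p t)).card : ℝ) ∈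
      Set.Icc ((p.M : ℝ) / (2 * (2 ^ p.m) ^ 2)) (3 * (p.M : ℝ) / (2 * (2 ^ p.m) ^ 2)))
    (fun t ht => by
        rw [← card_SHnz_eq]
        by_contra hlt
        rw [not_le, abs_lt] at hlt
        apply ht
        have e1 : (p.M : ℝ) * (1 / (2 ^ p.m) ^ 2) = 2 * (p.M / (2 * (2 ^ p.m) ^ 2)) := by
          field_simp
        have e2 : 3 * (p.M : ℝ) / (2 * (2 ^ p.m) ^ 2) = 3 * (p.M / (2 * (2 ^ p.m) ^ 2)) := by ring
        rw [e1] at hlt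
        rw [Set.mem_Icc, e2]
        constructor <;> linarith [hlt.1, hlt.2])
  have h3 : (p.M : ℝ) * (2 / 2 ^ p.m) / (p.M / 2 ^ p.m) ^ 2 = 2 * 2 ^ p.m / p.M := by field_simp
  have h4 : (p.M : ℝ) * (1 / (2 ^ p.m) ^ 2) / (p.M / (2 * (2 ^ p.m) ^ 2)) ^ 2 =
      4 * (2 ^ p.m) ^ 2 / p.M := by field_simp; norm_num
  rw [h3] at h1
  rw [h4] at h2
  have h5 : 2 * 2 ^ p.m / (p.M : ℝ) ≤ 2 * (2 ^ p.m) ^ 2 / p.M :=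
    div_le_div_of_nonneg_right (by nlinarith) hM'.le
  have h6 : 6 * (2 ^ p.m) ^ 2 / (p.M : ℝ) = 2 * (2 ^ p.m) ^ 2 / p.M + 4 * (2 ^ p.m) ^ 2 / p.M := by
    ring
  rw [h6]
  refine le_trans ?_ (add_le_add (h1.trans h5) h2)
  rw [← Finset.sum_add_distrib]
  refine Finset.sum_le_sum fun t _ => ?_
  have hq : 0 ≤ ∑ e, Q t e := Finset.sum_nonneg fun e _ => hQ t e
  unfold SizeCheck
  split_ifs <;> first | linarith | tauto

end Unbiased

/-! ### Probability of acceptance -/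

section Acceptance

variable {p : Params} {W Z E : Type} [Fintype W] [Fintype E] {ε : ℝ} {P : Box p W Z E}

theorem output_ne_none_iff (hM : 0 < p.M) (a b : Outputs p) (t : Str p) :
    output p a b t ≠ none ↔ SizeCheck p (settingA p t) (settingB p t) ∧
      Tests p a b (settingA p t) (settingB p t) := by
  by_cases hs : SizeCheck p (settingA p t) (settingB p t)
  · obtain ⟨r, -, hr⟩ := exists_selRun hM hs t
    rw [output_eq_of_selRun hs hr]
    simp [hs]
  · unfold output
    simp [hs]

/-- The protocol aborts only if one of the checks fails. -/
theorem one_sub_le_accProb [Nonempty Z] (hP : Admissible 0 P) (hM : 0 < p.M) (hm : 1 ≤ p.m)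
    (z : Z) :
    1 - 6 * (2 ^ p.m) ^ 2 / p.M - eventProb P z (fun a b t =>
      SizeCheck p (settingA p t) (settingB p t) ∧ ¬ Tests p a b (settingA p t) (settingB p t)) ≤
      accProb P z := by
  classical
  obtain ⟨Q, hQ, hQ1, hSV, hPQ⟩ := exists_source hP
  have hsz := sum_not_sizeCheck_le hQ hQ1 hSV hM hm
  have hfail : eventProb P z (fun a b t => SizeCheck p (settingA p t) (settingB p t) ∧
      ¬ Tests p a b (settingA p t) (settingB p t)) = ∑ t, ∑ e, Q t e *
        ∑ o : Outcomes p, if SizeCheck p (settingA p t) (settingB p t) ∧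
          ¬ Tests p o.1 o.2 (settingA p t) (settingB p t) then
            devAB P z (settingA p t) (settingB p t) o else 0 := by
    rw [eventProb_eq hPQ]
    congr!
  have hacc : accProb P z = ∑ t, ∑ e, Q t e * ∑ o : Outcomes p, if output p o.1 o.2 t ≠ none then
      devAB P z (settingA p t) (settingB p t) o else 0 := by
    unfold accProb
    rw [eventProb_eq hPQ]
    congr!
  rw [hfail, hacc]
  have key : ∀ t, ∑ e, Q t e = (if ¬ SizeCheck p (settingA p t) (settingB p t) then ∑ e, Q t e else 0)
      + ∑ e, Q t e * (∑ o : Outcomes p, if SizeCheck p (settingA p t) (settingB p t) ∧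
        ¬ Tests p o.1 o.2 (settingA p t) (settingB p t) then
          devAB P z (settingA p t) (settingB p t) o else 0)
      + ∑ e, Q t e * ∑ o : Outcomes p, if output p o.1 o.2 t ≠ none then
          devAB P z (settingA p t) (settingB p t) o else 0 := by
    intro t
    simp only [output_ne_none_iff hM]
    by_cases hs : SizeCheck p (settingA p t) (settingB p t)
    · simp only [hs, true_and, not_true_eq_false, if_false, zero_add]
      rw [← Finset.sum_add_distrib]
      refine Finset.sum_congr rfl fun e _ => ?_
      rw [← mul_add, ← Finset.sum_add_distrib]
      have : ∀ o : Outcomes p, ((if ¬ Tests p o.1 o.2 (settingA p t) (settingB p t) then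
          devAB P z (settingA p t) (settingB p t) o else 0) +
          if Tests p o.1 o.2 (settingA p t) (settingB p t) then
            devAB P z (settingA p t) (settingB p t) o else 0) =
          devAB P z (settingA p t) (settingB p t) o := fun o => by
        by_cases hT : Tests p o.1 o.2 (settingA p t) (settingB p t) <;> simp [hT]
      simp only [this, sum_devAB hP, mul_one]
    · simp [hs]
  have htot := Finset.sum_congr (rfl : (Finset.univ : Finset (Str p)) = Finset.univ) fun t _ => key t
  rw [hQ1, Finset.sum_add_distrib, Finset.sum_add_distrib] at htot
  linarith

end Acceptance

/-! ### Choice of the parameters -/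

section Parameters

theorem exists_exponent (K : ℝ) {ρ : ℝ} (hρ0 : 0 ≤ ρ) (hρ1 : ρ < 1) :
    ∃ c : ℝ, 0 < c ∧ ∀ᶠ m : ℕ in Filter.atTop,
      K * (m + 1) * ρ ^ m ≤ ((2 : ℝ) ^ m) ^ (-c) * ((2 : ℝ) ^ m) ^ (-c) := by
  -- Any s strictly between ρ and 1 would do: (m+1)(ρ/s)^m tends to 0, and c is chosen so that s^m =
  -- n^(-2c).
  set s : ℝ := (1 + ρ) / 2 with hs
  have hs0 : 0 < s := by rw [hs]; linarith
  have hs1 : s < 1 := by rw [hs]; linarith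
  have hρs : ρ < s := by rw [hs]; linarith
  have hlog2 : 0 < Real.log 2 := Real.log_pos (by norm_num)
  refine ⟨-Real.log s / (2 * Real.log 2), div_pos (neg_pos.2 (Real.log_neg hs0 hs1))
    (by positivity), ?_⟩
  have hη : ∀ m : ℕ, ((2 : ℝ) ^ m) ^ (-(-Real.log s / (2 * Real.log 2))) *
      ((2 : ℝ) ^ m) ^ (-(-Real.log s / (2 * Real.log 2))) = s ^ m := by
    intro m
    rw [← Real.rpow_add (by positivity), Real.rpow_def_of_pos (by positivity), Real.log_pow]
    have : m * Real.log 2 * (-(-Real.log s / (2 * Real.log 2)) + -(-Real.log s / (2 * Real.log 2))) =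
        m * Real.log s := by field_simp; ring
    rw [this, Real.exp_nat_mul, Real.exp_log hs0]
  have hr0 : 0 ≤ ρ / s := div_nonneg hρ0 hs0.le
  have hr1 : ρ / s < 1 := (div_lt_one hs0).2 hρs
  have ht : Filter.Tendsto (fun m : ℕ => K * ((m : ℝ) * (ρ / s) ^ m + (ρ / s) ^ m)) Filter.atTop
      (nhds (K * (0 + 0))) :=
    ((tendsto_self_mul_const_pow_of_lt_one hr0 hr1).add
      (tendsto_pow_atTop_nhds_zero_of_lt_one hr0 hr1)).const_mul K
  rw [add_zero, mul_zero] at ht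
  filter_upwards [ht.eventually_le_const one_pos] with m hm
  rw [hη]
  have hsm : 0 < s ^ m := by positivity
  have e : K * (m + 1) * ρ ^ m = K * ((m : ℝ) * (ρ / s) ^ m + (ρ / s) ^ m) * s ^ m := by
    rw [div_pow]; field_simp
  rw [e]
  exact mul_le_of_le_one_left hsm.le hm

theorem rpow_neg_le_one {c : ℝ} (hc : 0 < c) (m : ℕ) : ((2 : ℝ) ^ m) ^ (-c) ≤ 1 :=
  Real.rpow_le_one_of_one_le_of_nonpos (one_le_pow₀ (by norm_num)) (by linarith)

/-- A bound of the form `dComp P ≤ X / Pr(ACC)` with `X ≤ η²` yields `η`-security. -/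
theorem secure_of_dComp_le {p : Params} {W Z E : Type} [Fintype W] [Fintype E] [Nonempty Z] {ε : ℝ}
    {P : Box p W Z E} (hP : Admissible ε P) {η X : ℝ} (hη : 0 < η) (hX : X ≤ η * η)
    (h : ∀ A, 0 < A → (∀ z, accProb P z = A) → dComp P ≤ X / A) : Secure P η := by
  have z₀ : Z := Classical.arbitrary Z
  have hacc : ∀ z, accProb P z = accProb P z₀ := fun z => eventProb_congr hP z z₀ _
  rcases le_or_gt (accProb P z₀) η with h1 | h1
  · exact Or.inl fun z => (hacc z).trans_le h1
  · have h0 : 0 < accProb P z₀ := hη.trans h1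
    refine Or.inr ((h _ h0 hacc).trans ?_)
    rw [div_le_iff₀ h0]
    nlinarith

/-- The threshold of the first test. -/
def threshold₁ (m : ℕ) : ℝ := 1 / (2 ^ m) ^ 5

/-- The threshold of the second test. -/
def threshold₂ (m : ℕ) : ℝ := 4 * (m + 1) / 2 ^ m

/-- The protocol with `(N + 1) ^ 6` runs and the above thresholds. -/
abbrev ladderProtocol (m : ℕ) : Params := protocolI 6 threshold₁ threshold₂ m

theorem threshold₁_pos (m : ℕ) : 0 < threshold₁ m := by unfold threshold₁; positivity

theorem threshold₂_pos (m : ℕ) : 0 < threshold₂ m := by unfold threshold₂; positivity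

theorem ladderProtocol_runs (m : ℕ) : (((ladderProtocol m).M : ℕ) : ℝ) = (2 ^ m) ^ 6 := by
  simp [ladderProtocol, protocolI]

theorem ladderProtocol_runs_pos (m : ℕ) : 0 < (ladderProtocol m).M := by
  simp [ladderProtocol, protocolI]

theorem SizeCheck.card_SHnz_bounds {m : ℕ} {x y : Inputs (ladderProtocol m)}
    (h : SizeCheck (ladderProtocol m) x y) :
    (2 ^ m) ^ 4 / 2 ≤ ((SHnz (ladderProtocol m) x y).card : ℝ) ∧
      ((SHnz (ladderProtocol m) x y).card : ℝ) ≤ 4 * (2 ^ m) ^ 4 := by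
  have h1 := h.2
  rw [ladderProtocol_runs, show (ladderProtocol m).m = m from rfl, Set.mem_Icc] at h1
  have e1 : ((2 : ℝ) ^ m) ^ 6 / (2 * (2 ^ m) ^ 2) = (2 ^ m) ^ 4 / 2 := by field_simp
  have e2 : 3 * ((2 : ℝ) ^ m) ^ 6 / (2 * (2 ^ m) ^ 2) = 3 / 2 * (2 ^ m) ^ 4 := by field_simp
  rw [e1, e2] at h1
  have : (0 : ℝ) < (2 ^ m) ^ 4 := by positivity
  exact ⟨h1.1, by linarith [h1.2]⟩

variable {W Z E : Type} [Fintype W] [Fintype E] {ε : ℝ} {m : ℕ} {P : Box (ladderProtocol m) W Z E}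

theorem ladderProtocol_dComp_le [Nonempty Z] (hP : Admissible ε P) (hm : 1 ≤ m) (hε0 : 0 ≤ ε)
    (hε : ε < 0.09) {A : ℝ} (hA : 0 < A) (hacc : ∀ z, accProb P z = A) :
    dComp P ≤ 96 * (m + 1) * 0.97 ^ m / A := by
  set n : ℝ := 2 ^ m with hn
  have hn1 : 1 ≤ n := one_le_pow₀ (by norm_num)
  have hn0 : 0 < n := by linarith
  have hκ : ∀ x y, SizeCheck (ladderProtocol m) x y →
      (1 / 2 + ε) ^ Nat.log 2 (SHnz (ladderProtocol m) x y).card ≤ 2 * (0.59 ^ 4) ^ m := by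
    intro x y hs
    have h1 := hs.card_SHnz_bounds.1
    have h2 : 4 * m - 1 ≤ Nat.log 2 (SHnz (ladderProtocol m) x y).card := by
      -- The lower bound n⁴/2 on |S_nz| equals 2^(4m-1); the missing bit costs a factor 1/0.59 < 2.
      refine Nat.le_log_of_pow_le (by norm_num) ?_
      have h3 : (2 : ℝ) ^ (4 * m - 1) = (2 ^ m) ^ 4 / 2 := by
        rw [eq_div_iff two_ne_zero, ← pow_succ, ← pow_mul]
        congr 1
        omega
      rw [← h3] at h1
      exact_mod_cast h1
    calc (1 / 2 + ε) ^ Nat.log 2 (SHnz (ladderProtocol m) x y).card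
        ≤ 0.59 ^ Nat.log 2 (SHnz (ladderProtocol m) x y).card :=
          pow_le_pow_left₀ (by linarith) (by norm_num at hε ⊢; linarith) _
      _ ≤ 0.59 ^ (4 * m - 1) := pow_le_pow_of_le_one (by norm_num) (by norm_num) h2
      _ ≤ 2 * (0.59 ^ 4) ^ m := by
          have h4 : (0.59 : ℝ) ^ (4 * m - 1) * 0.59 = (0.59 ^ 4) ^ m := by
            rw [← pow_succ, ← pow_mul]
            congr 1
            omega
          have h5 : (0 : ℝ) < 0.59 ^ (4 * m - 1) := by positivity
          rw [← h4]
          linarith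
  -- |S_H| ≤ 3n⁵ and δ₁ = n⁻⁵ allow at most τ = 3 violations.
  have main := dComp_le_of_admissible hP hε0 (by norm_num at hε ⊢; linarith)
    (ladderProtocol_runs_pos m) (threshold₁_pos m).le (threshold₂_pos m).le (τ := 3)
    (le_of_eq (by
      rw [ladderProtocol_runs]
      change threshold₁ m * (3 * (2 ^ m) ^ 6 / 2 ^ m) = 3
      unfold threshold₁
      field_simp)) hA hacc (κ := 2 * (0.59 ^ 4) ^ m) (ℓ := 4 * n ^ 4) (by positivity)
    (by positivity) hκ (fun x y hs => hs.card_SHnz_bounds.2)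
  refine main.trans (div_le_div_of_nonneg_right ?_ hA.le)
  change 2 * (0.59 ^ 4) ^ m * (4 * Real.sqrt (4 * n ^ 4) + 2 * threshold₂ m * (4 * n ^ 4) +
    2 * ((3 + 1) / (1 / 2 - ε) ^ (2 * m))) ≤ _
  have h8 : (8 : ℝ) ^ m = n ^ 3 := by rw [hn, ← pow_mul, mul_comm, pow_mul]; norm_num
  have e1 : Real.sqrt (4 * n ^ 4) = 2 * n ^ 2 := by
    rw [show 4 * n ^ 4 = (2 * n ^ 2) ^ 2 by ring, Real.sqrt_sq (by positivity)]
  have e2 : threshold₂ m * (4 * n ^ 4) = 16 * (m + 1) * n ^ 3 := by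
    unfold threshold₂
    rw [← hn]
    field_simp
    ring
  have e3 : (3 + 1) / (1 / 2 - ε) ^ (2 * m) ≤ 4 * n ^ 3 := by
    have h1 : (1 / 8 : ℝ) ^ m ≤ (1 / 2 - ε) ^ (2 * m) := by
      rw [pow_mul]
      -- (1/2 - ε)² > 0.41² = 0.1681 > 1/8, so the violation term is of order n³, like the slack of
      -- the second test.
      exact pow_le_pow_left₀ (by norm_num) (by norm_num at hε; nlinarith) _
    have h2 : (0 : ℝ) < (1 / 8) ^ m := by positivity
    rw [div_le_iff₀ (lt_of_lt_of_le h2 h1)]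
    calc (3 + 1 : ℝ) = 4 * n ^ 3 * (1 / 8) ^ m := by
          rw [← h8, mul_assoc, ← mul_pow]; norm_num
      _ ≤ 4 * n ^ 3 * (1 / 2 - ε) ^ (2 * m) := mul_le_mul_of_nonneg_left h1 (by positivity)
  have e4 : n ^ 2 ≤ n ^ 3 := pow_le_pow_right₀ hn1 (by norm_num)
  have hm0 : (0 : ℝ) ≤ m := Nat.cast_nonneg m
  have e5 : 4 * Real.sqrt (4 * n ^ 4) + 2 * threshold₂ m * (4 * n ^ 4) +
      2 * ((3 + 1) / (1 / 2 - ε) ^ (2 * m)) ≤ 48 * (m + 1) * n ^ 3 := by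
    rw [e1]
    have : 0 ≤ (m : ℝ) * n ^ 3 := by positivity
    linarith
  calc _ ≤ 2 * (0.59 ^ 4) ^ m * (48 * (m + 1) * n ^ 3) :=
        mul_le_mul_of_nonneg_left e5 (by positivity)
    _ = 96 * (m + 1) * (0.59 ^ 4 * 8) ^ m := by rw [← h8, mul_pow]; ring
    _ ≤ 96 * (m + 1) * 0.97 ^ m := by
        refine mul_le_mul_of_nonneg_left ?_ (by positivity)
        exact pow_le_pow_left₀ (by norm_num) (by norm_num) _

theorem failure_bound_le (m : ℕ) :
    4 / ((2 ^ m) ^ 4 / 2 * threshold₂ m ^ 2) ≤ (1 / 2 : ℝ) ^ m := by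
  set n : ℝ := 2 ^ m with hn
  have hn1 : 1 ≤ n := one_le_pow₀ (by norm_num)
  have hn0 : 0 < n := by linarith
  have hm0 : (0 : ℝ) ≤ m := Nat.cast_nonneg m
  have e : n ^ 4 / 2 * threshold₂ m ^ 2 = 8 * (m + 1) ^ 2 * n ^ 2 := by
    unfold threshold₂
    rw [← hn]
    field_simp
    ring
  rw [e, one_div_pow, ← hn, div_le_div_iff₀ (by positivity) hn0]
  nlinarith [mul_nonneg hm0 hn0.le, sq_nonneg (m : ℝ), mul_nonneg (sq_nonneg (m : ℝ)) (sq_nonneg n),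
    mul_nonneg hm0 (sq_nonneg n)]

theorem BehavesQuantum.exists_ladder (hQ : BehavesQuantum P) (hm : 1 ≤ m) :
    ∃ q : ℝ, 0 ≤ q ∧
      (∀ z x y o, devAB P z x y o = ∏ i, ladderProb q (o.1 i) (o.2 i) (x i) (y i)) ∧
      1 / 2 - threshold₂ m / 2 ≤ ladderProb q 0 0 (2 ^ m - 1) (2 ^ m - 1) := by
  obtain ⟨q, hopt, hprod⟩ := hQ
  refine ⟨q, hopt.1.1, fun z x y o => hprod o.1 o.2 x y z, ?_⟩
  refine le_trans (le_of_eq ?_) (IsOptimalLadder.ladderProb_ge hm hopt)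
  unfold threshold₂
  ring

theorem ladderProtocol_dComp_le_of_quantum [Nonempty Z] (hP : Admissible ε P)
    (hQ : BehavesQuantum P) (hm : 1 ≤ m) {A : ℝ} (hA : 0 < A) (hacc : ∀ z, accProb P z = A) :
    dComp P ≤ 7 * (m + 1) * (1 / 2) ^ m / A := by
  obtain ⟨q, hq, hD, hopt⟩ := hQ.exists_ladder hm
  have h := dComp_le_of_quantum hP hq hD (ladderProtocol_runs_pos m) (threshold₁_pos m).le
    (threshold₂_pos m) hopt hA hacc (ℓ := (2 ^ m) ^ 4 / 2) (by positivity)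
    fun x y hs => hs.card_SHnz_bounds.1
  refine h.trans (div_le_div_of_nonneg_right ?_ hA.le)
  change threshold₂ m + 4 / ((2 ^ m) ^ 4 / 2 * threshold₂ m ^ 2) ≤ _
  have h1 := failure_bound_le m
  have h2 : threshold₂ m = 4 * (m + 1) * (1 / 2) ^ m := by
    unfold threshold₂; rw [one_div_pow]; ring
  have h3 : (0 : ℝ) ≤ m * (1 / 2) ^ m := by positivity
  have h4 : (0 : ℝ) < (1 / 2) ^ m := by positivity
  rw [h2] at h1 ⊢
  linarith

theorem ladderProtocol_eventProb_le [Nonempty Z] (hP : Admissible ε P) (hQ : BehavesQuantum P)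
    (hm : 1 ≤ m) (z : Z) :
    eventProb P z (fun a b t => SizeCheck _ (settingA _ t) (settingB _ t) ∧
      ¬ Tests _ a b (settingA _ t) (settingB _ t)) ≤ (1 / 2) ^ m := by
  obtain ⟨q, hq, hD, hopt⟩ := hQ.exists_ladder hm
  exact (eventProb_not_tests_le hP hq hD (ladderProtocol_runs_pos m) (threshold₁_pos m).le
    (threshold₂_pos m) hopt (ℓ := (2 ^ m) ^ 4 / 2) (by positivity)
    (fun x y hs => hs.card_SHnz_bounds.1) z).trans (failure_bound_le m)

theorem ladderProtocol_one_sub_le_accProb [Nonempty Z] (hP : Admissible 0 P)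
    (hQ : BehavesQuantum P) (hm : 1 ≤ m) (z : Z) : 1 - 7 * (m + 1) * (1 / 2) ^ m ≤ accProb P z := by
  have h1 := one_sub_le_accProb hP (ladderProtocol_runs_pos m) hm z
  have h2 := ladderProtocol_eventProb_le hP hQ hm z
  rw [ladderProtocol_runs, show (ladderProtocol m).m = m from rfl] at h1
  have h3 : 6 * ((2 : ℝ) ^ m) ^ 2 / (2 ^ m) ^ 6 ≤ 6 * (1 / 2) ^ m := by
    have hn1 : (1 : ℝ) ≤ 2 ^ m := one_le_pow₀ (by norm_num)
    have hn3 : (1 : ℝ) ≤ (2 ^ m) ^ 3 := one_le_pow₀ hn1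
    rw [one_div_pow, mul_one_div, div_le_div_iff₀ (by positivity) (by positivity)]
    have : (0 : ℝ) < (2 ^ m) ^ 3 := by positivity
    nlinarith [mul_le_mul_of_nonneg_left hn3 this.le]
  have h4 : (0 : ℝ) ≤ m * (1 / 2) ^ m := by positivity
  linarith

end Parameters

end PublicSV

end

/-! ### Proof of the main theorem -/

open PublicSV in
theorem theorem1 :
    ∃ (ρ : ℕ) (δ₁ δ₂ : ℕ → ℝ), (∀ m, 0 < δ₁ m ∧ 0 < δ₂ m) ∧
      -- security against no-signaling devices and adversaries
      (∀ ε : ℝ, 0 ≤ ε → ε < 0.09 → ∃ c : ℝ, 0 < c ∧ ∀ᶠ m : ℕ in Filter.atTop,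
        ∀ (W Z E : Type) [Fintype W] [Fintype Z] [Nonempty Z] [Fintype E]
          (P : Box (protocolI ρ δ₁ δ₂ m) W Z E),
          Admissible ε P → Secure P (((2 : ℝ) ^ m) ^ (-c))) ∧
      -- security when the two components behave as quantum theory predicts
      (∀ ε : ℝ, 0 ≤ ε → ε < 0.5 → ∃ c : ℝ, 0 < c ∧ ∀ᶠ m : ℕ in Filter.atTop,
        ∀ (W Z E : Type) [Fintype W] [Fintype Z] [Nonempty Z] [Fintype E]
          (P : Box (protocolI ρ δ₁ δ₂ m) W Z E),
          Admissible ε P → BehavesQuantum P → Secure P (((2 : ℝ) ^ m) ^ (-c))) ∧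
      -- such components pass the two tests when the cardinality checks are passed
      (∀ ε : ℝ, 0 ≤ ε → ε < 0.5 → ∃ c : ℝ, 0 < c ∧ ∀ᶠ m : ℕ in Filter.atTop,
        ∀ (W Z E : Type) [Fintype W] [Fintype Z] [Nonempty Z] [Fintype E]
          (P : Box (protocolI ρ δ₁ δ₂ m) W Z E),
          Admissible ε P → BehavesQuantum P → ∀ z : Z,
            eventProb P z (fun a b t =>
              SizeCheck _ (settingA _ t) (settingB _ t) ∧
                ¬ Tests _ a b (settingA _ t) (settingB _ t)) ≤ ((2 : ℝ) ^ m) ^ (-c)) ∧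
      -- and with an unbiased source the protocol does not abort
      (∃ c : ℝ, 0 < c ∧ ∀ᶠ m : ℕ in Filter.atTop,
        ∀ (W Z E : Type) [Fintype W] [Fintype Z] [Nonempty Z] [Fintype E]
          (P : Box (protocolI ρ δ₁ δ₂ m) W Z E),
          Admissible 0 P → BehavesQuantum P → ∀ z : Z,
            1 - ((2 : ℝ) ^ m) ^ (-c) ≤ accProb P z) := by
  obtain ⟨c₁, hc₁, h₁⟩ := exists_exponent 96 (ρ := 0.97) (by norm_num) (by norm_num)
  obtain ⟨c₂, hc₂, h₂⟩ := exists_exponent 7 (ρ := 1 / 2) (by norm_num) (by norm_num)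
  have hsq : ∀ m : ℕ, ((2 : ℝ) ^ m) ^ (-c₂) * ((2 : ℝ) ^ m) ^ (-c₂) ≤ ((2 : ℝ) ^ m) ^ (-c₂) :=
    fun m => mul_le_of_le_one_left (by positivity) (rpow_neg_le_one hc₂ m)
  -- At ε = 0.09 with n^ρ runs, the slack of the second test contributes about
  -- 0.59^((ρ-2)m)·2^((ρ-3)m), which decays for ρ ≤ 6; the violations contribute about
  -- 0.59^((ρ-2)m)/0.41^(2m), which decays for ρ ≥ 6. The second threshold is twice the bound
  -- 2(m+1)/n on the distance of the optimal Hardy probability from 1/2, leaving half of it for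
  -- statistical fluctuations.
  refine ⟨6, threshold₁, threshold₂, fun m => ⟨threshold₁_pos m, threshold₂_pos m⟩, ?_, ?_, ?_, ?_⟩
  · intro ε hε0 hε
    refine ⟨c₁, hc₁, ?_⟩
    filter_upwards [h₁, Filter.eventually_ge_atTop 1] with m hm hm1 W Z E _ _ _ _ P hP
    exact secure_of_dComp_le hP (by positivity) hm fun A hA hacc =>
      ladderProtocol_dComp_le hP hm1 hε0 hε hA hacc
  · intro ε _ _
    refine ⟨c₂, hc₂, ?_⟩
    filter_upwards [h₂, Filter.eventually_ge_atTop 1] with m hm hm1 W Z E _ _ _ _ P hP hQ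
    exact secure_of_dComp_le hP (by positivity) hm fun A hA hacc =>
      ladderProtocol_dComp_le_of_quantum hP hQ hm1 hA hacc
  · intro ε _ _
    refine ⟨c₂, hc₂, ?_⟩
    filter_upwards [h₂, Filter.eventually_ge_atTop 1] with m hm hm1 W Z E _ _ _ _ P hP hQ z
    refine (ladderProtocol_eventProb_le hP hQ hm1 z).trans (le_trans ?_ (hm.trans (hsq m)))
    have h3 : (0 : ℝ) ≤ m * (1 / 2) ^ m := by positivity
    have h4 : (0 : ℝ) < (1 / 2) ^ m := by positivity
    linarith
  · refine ⟨c₂, hc₂, ?_⟩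
    filter_upwards [h₂, Filter.eventually_ge_atTop 1] with m hm hm1 W Z E _ _ _ _ P hP hQ z
    have := ladderProtocol_one_sub_le_accProb hP hQ hm1 z
    linarith [hm.trans (hsq m)]
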